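/- Let $\theta\in\mathbb R$ be irrational, $q=e^{2\pi i\theta}$, and let $\tau\in\mathbb C$ have $\operatorname{Im}\tau<0$. Let $\mathcal A_\theta$ be the algebra of series $\sum_{(n_1,n_2)\in\mathbb Z^2}a_{n_1,n_2}U_1^{n_1}U_2^{n_2}$ with rapidly decreasing coefficients, where $U_2U_1=e^{2\pi i\theta}U_1U_2$, and let $\delta_\tau=\tau\delta_1+\delta_2$, where $\delta_j(U_1^{n_1}U_2^{n_2})=2\pi i\,n_j\,U_1^{n_1}U_2^{n_2}$. Let $\mathcal O(\mathbb C^*)$ be the algebra of holomorphic functions on $\mathbb C^*$, with the automorphism $\alpha(f)(z)=f(qz)$ and the derivation $\delta=\tau z\frac{d}{dz}$, and let $\psi:\mathcal O(\mathbb C^*)\to\mathcal A_\theta$ be the homomorphism $\sum_n f_nz^n\mapsto\sum_n f_nU_1^n$ (Laurent series). Let $\mathcal B_q^\tau$ be the category of triples $(M,\sigma,\nabla)$, where $M$ is a finitely presentable $\mathcal O(\mathbb C^*)$-module, $\sigma$ is a representation of $\theta\mathbb Z$ on $M$ whose generator satisfies $\sigma(m\cdot f)=\sigma(m)\cdot\alpha(f)$,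 and $\nabla:M\to M$ is a connection with $\nabla(m\cdot f)=\nabla(m)\cdot f+m\cdot\delta(f)$ and $\nabla\sigma=\sigma\nabla$ that is regular singular: $M$ has a module basis $e_1,\dots,e_n$ such that, with $\nabla e_i=\sum_jA_{ij}e_j$, every $z^{-1}A_{ij}$ has at most a simple pole at $0$. Morphisms are the $\mathcal O(\mathbb C^*)$-linear maps that commute with $\sigma$ and $\nabla$. Let $\mathsf{Vect}(\mathbb T_\theta^\tau)$ be the category of finitely generated projective right $\mathcal A_\theta$-modules $E$ with a connection $\nabla:E\to E$ satisfying $\nabla(ea)=\nabla(e)a+e\,\delta_\tau(a)$; morphisms are the $\mathcal A_\theta$-linear maps that commute with the connections. Let $\psi_*:\mathcal B_q^\tau\to\mathsf{Vect}(\mathbb T_\theta^\tau)$ be the functor $$(M,\sigma,\nabla)\longmapsto\bigl(M\otimes_{\mathcal O(\mathbb C^*)}\mathcal A_\theta,\ 2\pi i\,\nabla\otimes1+1\otimes\delta_\tau\bigr),$$ where $\mathcal O(\mathbb C^*)$ acts on $\mathcal A_\theta$ through $\psi$ and left multiplication. Then: (1) $\mathcal A_\theta$ is a flat $\mathcal O(\mathbb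 C^*)$-module via $\psi$, both for left and for right multiplication. (2) The functor $\psi_*$ is exact: it preserves finite limits and finite colimits, and it sends injective maps, surjective maps and exact sequences $X\to Y\to Z$ of underlying $\mathcal O(\mathbb C^*)$-modules to injective maps, surjective maps and exact sequences of $\mathcal A_\theta$-modules, respectively. (3) The functor $\psi_*$ is faithful. -/

import Mathlib

open CategoryTheory CategoryTheory.Limits
open scoped TensorProduct

universe u

namespace NCT

/-! The smooth noncommutative torus. -/

/-- The weight `1 + |n₁| + |n₂|` on `ℤ²`. -/
def weight (n : ℤ × ℤ) : ℝ := 1 + |(n.1 : ℝ)| + |(n.2 : ℝ)|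

/-- A rapidly decreasing (Schwartz) double sequence. -/
def RapidlyDecreasing (a : ℤ × ℤ → ℂ) : Prop :=
  ∀ k : ℕ, ∃ C : ℝ, ∀ n, weight n ^ k * ‖a n‖ ≤ C

theorem one_le_weight (n : ℤ × ℤ) : 1 ≤ weight n := by
  unfold weight; linarith [abs_nonneg (n.1 : ℝ), abs_nonneg (n.2 : ℝ)]

theorem weight_pos (n : ℤ × ℤ) : 0 < weight n := lt_of_lt_of_le one_pos (one_le_weight n)

theorem weight_le_mul (k n : ℤ × ℤ) : weight k ≤ weight n * weight (k - n) := by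
  have h1 : |(k.1 : ℝ)| ≤ |(n.1 : ℝ)| + |((k - n).1 : ℝ)| := by
    have := abs_add_le (n.1 : ℝ) ((k - n).1 : ℝ)
    simpa using this
  have h2 : |(k.2 : ℝ)| ≤ |(n.2 : ℝ)| + |((k - n).2 : ℝ)| := by
    have := abs_add_le (n.2 : ℝ) ((k - n).2 : ℝ)
    simpa using this
  unfold weight
  nlinarith [abs_nonneg (n.1 : ℝ), abs_nonneg (n.2 : ℝ), abs_nonneg ((k - n).1 : ℝ),
    abs_nonneg ((k - n).2 : ℝ), mul_nonneg (add_nonneg (abs_nonneg (n.1 : ℝ))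
      (abs_nonneg (n.2 : ℝ))) (add_nonneg (abs_nonneg ((k - n).1 : ℝ))
      (abs_nonneg ((k - n).2 : ℝ)))]

theorem summable_weight : Summable fun n : ℤ × ℤ => (weight n ^ 4)⁻¹ := by
  have h0 : Summable fun n : ℤ => (1 + (n : ℝ) ^ 2)⁻¹ := by
    have h : Summable fun n : ℤ => 1 / (n : ℝ) ^ 2 :=
      Real.summable_one_div_int_pow.mpr (by norm_num)
    refine (Summable.of_norm_bounded_eventually h ?_)
    have : ({0} : Set ℤ).Finite := Set.finite_singleton 0
    filter_upwards [this.compl_mem_cofinite] with n hn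
    have hn' : (n : ℝ) ≠ 0 := by simpa using hn
    have : 0 < (n : ℝ) ^ 2 := by positivity
    rw [Real.norm_of_nonneg (by positivity), one_div]
    gcongr
    linarith
  have h1 := h0.mul_of_nonneg h0 (fun n => by positivity) (fun n => by positivity)
  refine Summable.of_nonneg_of_le (fun n => by have := weight_pos n; positivity) (fun n => ?_) h1
  rw [← mul_inv]
  gcongr
  have e1 : (n.1 : ℝ) ^ 2 = |(n.1 : ℝ)| ^ 2 := (sq_abs _).symm
  have e2 : (n.2 : ℝ) ^ 2 = |(n.2 : ℝ)| ^ 2 := (sq_abs _).symm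
  rw [e1, e2]
  unfold weight
  have a1 := abs_nonneg (n.1 : ℝ)
  have a2 := abs_nonneg (n.2 : ℝ)
  set x := |(n.1 : ℝ)|
  set y := |(n.2 : ℝ)|
  have b1 : 1 + x ^ 2 ≤ (1 + x + y) ^ 2 := by nlinarith [mul_nonneg a1 a2]
  have b2 : 1 + y ^ 2 ≤ (1 + x + y) ^ 2 := by nlinarith [mul_nonneg a1 a2]
  calc (1 + x ^ 2) * (1 + y ^ 2) ≤ (1 + x + y) ^ 2 * (1 + x + y) ^ 2 := by gcongr
    _ = (1 + x + y) ^ 4 := by ring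

theorem RapidlyDecreasing.summable {a : ℤ × ℤ → ℂ} (ha : RapidlyDecreasing a) (k : ℕ) :
    Summable fun n => weight n ^ k * ‖a n‖ := by
  obtain ⟨C, hC⟩ := ha (k + 4)
  refine Summable.of_nonneg_of_le (fun n => ?_) (fun n => ?_) (summable_weight.mul_left C)
  · have := weight_pos n; positivity
  · have h := weight_pos n
    rw [← div_eq_mul_inv, le_div_iff₀ (by positivity)]
    calc _ = weight n ^ (k + 4) * ‖a n‖ := by ring
      _ ≤ C := hC n

theorem RapidlyDecreasing.summable_norm {a : ℤ × ℤ → ℂ} (ha : RapidlyDecreasing a) :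
    Summable fun n => ‖a n‖ := by simpa using ha.summable 0

theorem RapidlyDecreasing.bounded {a : ℤ × ℤ → ℂ} (ha : RapidlyDecreasing a) :
    ∃ C : ℝ, ∀ n, ‖a n‖ ≤ C := by simpa using ha 0

/-- The space `S(ℤ²)` of rapidly decreasing double sequences. -/
def schwartz : Submodule ℂ (ℤ × ℤ → ℂ) where
  carrier := {a | RapidlyDecreasing a}
  zero_mem' := fun k => ⟨0, fun n => by simp⟩
  add_mem' := by
    intro a b ha hb k
    obtain ⟨C, hC⟩ := ha k
    obtain ⟨D, hD⟩ := hb k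
    refine ⟨C + D, fun n => ?_⟩
    have h := pow_pos (weight_pos n) k
    calc weight n ^ k * ‖(a + b) n‖ ≤ weight n ^ k * (‖a n‖ + ‖b n‖) := by
          gcongr; exact norm_add_le _ _
      _ ≤ C + D := by rw [mul_add]; exact add_le_add (hC n) (hD n)
  smul_mem' := by
    intro c a ha k
    obtain ⟨C, hC⟩ := ha k
    refine ⟨‖c‖ * C, fun n => ?_⟩
    calc weight n ^ k * ‖(c • a) n‖ = ‖c‖ * (weight n ^ k * ‖a n‖) := by
          simp; ring
      _ ≤ ‖c‖ * C := by gcongr; exact hC n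

/-- The algebra `A_θ` of smooth functions on the noncommutative torus: the element `a`
stands for the series `∑ a (n₁, n₂) U₁ ^ n₁ U₂ ^ n₂` with rapidly decreasing coefficients. -/
def NCTorus (_θ : ℝ) : Type := schwartz

noncomputable instance (θ : ℝ) : AddCommGroup (NCTorus θ) :=
  inferInstanceAs (AddCommGroup schwartz)

noncomputable instance (θ : ℝ) : Module ℂ (NCTorus θ) := inferInstanceAs (Module ℂ schwartz)

namespace NCTorus

variable {θ : ℝ}

/-- The element of `A_θ` with given rapidly decreasing coefficients. -/
def mk (θ : ℝ) (a : ℤ × ℤ → ℂ) (ha : RapidlyDecreasing a) : NCTorus θ := ⟨a, ha⟩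

/-- The coefficient of `U₁ ^ n₁ U₂ ^ n₂`, for `n = (n₁, n₂)`. -/
def coeff (a : NCTorus θ) : ℤ × ℤ → ℂ := a.1

theorem rapid (a : NCTorus θ) : RapidlyDecreasing a.coeff := a.2

@[simp] theorem coeff_mk (a : ℤ × ℤ → ℂ) (ha : RapidlyDecreasing a) : (mk θ a ha).coeff = a := rfl
@[simp] theorem coeff_add (a b : NCTorus θ) : (a + b).coeff = a.coeff + b.coeff := rfl
@[simp] theorem coeff_zero : (0 : NCTorus θ).coeff = 0 := rfl
@[simp] theorem coeff_smul (c : ℂ) (a : NCTorus θ) : (c • a).coeff = c • a.coeff := rfl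

@[ext] theorem ext {a b : NCTorus θ} (h : ∀ n, a.coeff n = b.coeff n) : a = b :=
  Subtype.ext (funext h)

end NCTorus

/-- The phase in
`(U₁ ^ n₁ U₂ ^ n₂) (U₁ ^ m₁ U₂ ^ m₂) = exp (2 π i θ n₂ m₁) U₁ ^ (n₁ + m₁) U₂ ^ (n₂ + m₂)`,
which is forced by `U₂ U₁ = exp (2 π i θ) U₁ U₂`. -/
noncomputable def phase (θ : ℝ) (n m : ℤ × ℤ) : ℂ :=
  Complex.exp (2 * Real.pi * Complex.I * θ * (n.2 * m.1))

theorem norm_phase (θ : ℝ) (n m : ℤ × ℤ) : ‖phase θ n m‖ = 1 := by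
  have : (2 * Real.pi * Complex.I * θ * (n.2 * m.1) : ℂ)
      = ((2 * Real.pi * θ * (n.2 * m.1) : ℝ) : ℂ) * Complex.I := by push_cast; ring
  rw [phase, this, Complex.norm_exp_ofReal_mul_I]

theorem phase_add_left (θ : ℝ) (n n' m : ℤ × ℤ) :
    phase θ (n + n') m = phase θ n m * phase θ n' m := by
  rw [phase, phase, phase, ← Complex.exp_add]; congr 1; push_cast [Prod.snd_add]; ring

theorem phase_add_right (θ : ℝ) (n m m' : ℤ × ℤ) :
    phase θ n (m + m') = phase θ n m * phase θ n m' := by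
  rw [phase, phase, phase, ← Complex.exp_add]; congr 1; push_cast [Prod.fst_add]; ring

/-- The coefficients of a product in `A_θ`. -/
noncomputable def twistedConv (θ : ℝ) (a b : ℤ × ℤ → ℂ) (k : ℤ × ℤ) : ℂ :=
  ∑' n, a n * b (k - n) * phase θ n (k - n)

theorem summable_twistedConv_norm (θ : ℝ) {a b : ℤ × ℤ → ℂ} (ha : RapidlyDecreasing a)
    (hb : RapidlyDecreasing b) (k : ℤ × ℤ) :
    Summable fun n => ‖a n * b (k - n) * phase θ n (k - n)‖ := by
  obtain ⟨C, hC⟩ := hb.bounded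
  refine Summable.of_nonneg_of_le (fun n => norm_nonneg _) (fun n => ?_)
    (ha.summable_norm.mul_right C)
  rw [norm_mul, norm_mul, norm_phase, mul_one]
  gcongr
  exact hC _

theorem summable_twistedConv (θ : ℝ) {a b : ℤ × ℤ → ℂ} (ha : RapidlyDecreasing a)
    (hb : RapidlyDecreasing b) (k : ℤ × ℤ) :
    Summable fun n => a n * b (k - n) * phase θ n (k - n) :=
  (summable_twistedConv_norm θ ha hb k).of_norm

theorem RapidlyDecreasing.twistedConv (θ : ℝ) {a b : ℤ × ℤ → ℂ} (ha : RapidlyDecreasing a)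
    (hb : RapidlyDecreasing b) : RapidlyDecreasing (twistedConv θ a b) := by
  intro j
  obtain ⟨C, hC⟩ := hb j
  refine ⟨∑' n, weight n ^ j * ‖a n‖ * C, fun k => ?_⟩
  have hk := pow_pos (weight_pos k) j
  have hs := summable_twistedConv_norm θ ha hb k
  calc weight k ^ j * ‖NCT.twistedConv θ a b k‖
      ≤ weight k ^ j * ∑' n, ‖a n * b (k - n) * phase θ n (k - n)‖ := by
        gcongr; exact norm_tsum_le_tsum_norm hs
    _ = ∑' n, weight k ^ j * ‖a n * b (k - n) * phase θ n (k - n)‖ := (tsum_mul_left).symm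
    _ ≤ ∑' n, weight n ^ j * ‖a n‖ * C := by
        refine (hs.mul_left _).tsum_le_tsum (fun n => ?_) ((ha.summable j).mul_right C)
        rw [norm_mul, norm_mul, norm_phase, mul_one]
        have h1 := weight_pos n
        have h2 := weight_pos (k - n)
        have h3 := weight_pos k
        calc weight k ^ j * (‖a n‖ * ‖b (k - n)‖)
            ≤ (weight n * weight (k - n)) ^ j * (‖a n‖ * ‖b (k - n)‖) := by
              gcongr; exact weight_le_mul k n
          _ = weight n ^ j * ‖a n‖ * (weight (k - n) ^ j * ‖b (k - n)‖) := by ring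
          _ ≤ weight n ^ j * ‖a n‖ * C := by gcongr; exact hC _

theorem twistedConv_assoc (θ : ℝ) {a b d : ℤ × ℤ → ℂ} (ha : RapidlyDecreasing a)
    (hb : RapidlyDecreasing b) (hd : RapidlyDecreasing d) (k : ℤ × ℤ) :
    twistedConv θ (twistedConv θ a b) d k = twistedConv θ a (twistedConv θ b d) k := by
  let F : ℤ × ℤ → ℤ × ℤ → ℂ := fun m n =>
    a m * b (n - m) * phase θ m (n - m) * (d (k - n) * phase θ n (k - n))
  obtain ⟨C, hC⟩ := hd.bounded
  have hF : Summable (Function.uncurry F) := by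
    have h1 : Summable fun p : (ℤ × ℤ) × (ℤ × ℤ) => ‖a p.1‖ * ‖b p.2‖ * C :=
      (ha.summable_norm.mul_of_nonneg hb.summable_norm (fun _ => norm_nonneg _)
        (fun _ => norm_nonneg _)).mul_right C
    let e : (ℤ × ℤ) × (ℤ × ℤ) ≃ (ℤ × ℤ) × (ℤ × ℤ) :=
      { toFun := fun p => (p.1, p.2 - p.1)
        invFun := fun p => (p.1, p.2 + p.1)
        left_inv := fun p => by simp
        right_inv := fun p => by simp }
    have h2 := (e.summable_iff).mpr h1
    refine Summable.of_norm_bounded h2 (fun p => ?_)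
    simp only [Function.uncurry, F, norm_mul, norm_phase, mul_one, Function.comp, e,
      Equiv.coe_fn_mk]
    gcongr
    exact hC _
  calc twistedConv θ (twistedConv θ a b) d k
      = ∑' n, ∑' m, F m n := by
        unfold twistedConv
        refine tsum_congr fun n => ?_
        rw [mul_assoc, ← tsum_mul_right]
    _ = ∑' m, ∑' n, F m n := Summable.tsum_comm hF
    _ = twistedConv θ a (twistedConv θ b d) k := by
        unfold twistedConv
        refine tsum_congr fun m => ?_
        rw [← tsum_mul_left, ← tsum_mul_right, ← (Equiv.addRight m).tsum_eq]
        refine tsum_congr fun j => ?_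
        simp only [F, Equiv.coe_addRight, add_sub_cancel_right]
        have e1 : k - (j + m) = k - m - j := by abel
        have e2 : k - m = j + (k - m - j) := by abel
        rw [e1, phase_add_left]
        conv_rhs => rw [show phase θ m (k - m) = phase θ m j * phase θ m (k - m - j) by
          rw [← phase_add_right, ← e2]]
        ring

namespace NCTorus

variable {θ : ℝ}

noncomputable instance : Mul (NCTorus θ) :=
  ⟨fun a b => mk θ (twistedConv θ a.coeff b.coeff) (a.rapid.twistedConv θ b.rapid)⟩

theorem coeff_mul (a b : NCTorus θ) (k : ℤ × ℤ) :
    (a * b).coeff k = ∑' n, a.coeff n * b.coeff (k - n) * phase θ n (k - n) := rfl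

/-- The monomial `U₁ ^ n₁ U₂ ^ n₂`, for `n = (n₁, n₂)`. -/
noncomputable def U (θ : ℝ) (n : ℤ × ℤ) : NCTorus θ :=
  mk θ (Pi.single n 1) (fun k => ⟨weight n ^ k, fun m => by
    rcases eq_or_ne m n with rfl | h
    · simp
    · have := weight_pos n
      simp [Pi.single_eq_of_ne h]; positivity⟩)

theorem coeff_U (n : ℤ × ℤ) : (U θ n).coeff = Pi.single n 1 := rfl

noncomputable instance : One (NCTorus θ) := ⟨U θ 0⟩

theorem one_def : (1 : NCTorus θ) = U θ 0 := rfl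

theorem coeff_U_mul (m : ℤ × ℤ) (b : NCTorus θ) (k : ℤ × ℤ) :
    (U θ m * b).coeff k = b.coeff (k - m) * phase θ m (k - m) := by
  rw [coeff_mul, tsum_eq_single m, coeff_U]
  · simp
  · intro n hn; simp [coeff_U, Pi.single_eq_of_ne hn]

theorem coeff_mul_U (m : ℤ × ℤ) (a : NCTorus θ) (k : ℤ × ℤ) :
    (a * U θ m).coeff k = a.coeff (k - m) * phase θ (k - m) m := by
  rw [coeff_mul, tsum_eq_single (k - m), coeff_U]
  · simp
  · intro n hn
    have : k - n ≠ m := fun h => hn (by rw [← h]; abel)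
    simp [coeff_U, Pi.single_eq_of_ne this]

theorem phase_zero_left (m : ℤ × ℤ) : phase θ 0 m = 1 := by simp [phase]
theorem phase_zero_right (m : ℤ × ℤ) : phase θ m 0 = 1 := by simp [phase]

noncomputable instance : Ring (NCTorus θ) where
  __ := (inferInstance : AddCommGroup (NCTorus θ))
  mul := (· * ·)
  one := 1
  left_distrib a b c := by
    ext k
    change (a * (b + c)).coeff k = (a * b).coeff k + (a * c).coeff k
    simp only [coeff_mul]
    rw [← (summable_twistedConv θ a.rapid b.rapid k).tsum_add
      (summable_twistedConv θ a.rapid c.rapid k)]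
    refine tsum_congr fun n => ?_
    simp only [coeff_add, Pi.add_apply]; ring
  right_distrib a b c := by
    ext k
    change ((a + b) * c).coeff k = (a * c).coeff k + (b * c).coeff k
    simp only [coeff_mul]
    rw [← (summable_twistedConv θ a.rapid c.rapid k).tsum_add
      (summable_twistedConv θ b.rapid c.rapid k)]
    refine tsum_congr fun n => ?_
    simp only [coeff_add, Pi.add_apply]; ring
  zero_mul a := by
    ext k
    change (0 * a).coeff k = 0
    simp [coeff_mul]
  mul_zero a := by
    ext k
    change (a * 0).coeff k = 0
    simp [coeff_mul]
  mul_assoc a b c := by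
    ext k
    exact twistedConv_assoc θ a.rapid b.rapid c.rapid k
  one_mul a := by
    ext k
    change (U θ 0 * a).coeff k = a.coeff k
    rw [coeff_U_mul]; simp [phase_zero_left]
  mul_one a := by
    ext k
    change (a * U θ 0).coeff k = a.coeff k
    rw [coeff_mul_U]; simp [phase_zero_right]

noncomputable instance : Algebra ℂ (NCTorus θ) :=
  Algebra.ofModule
    (fun c a b => by
      ext k
      simp only [coeff_mul, coeff_smul, Pi.smul_apply, smul_eq_mul]
      rw [← tsum_mul_left]
      exact tsum_congr fun n => by ring)
    (fun c a b => by
      ext k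
      simp only [coeff_mul, coeff_smul, Pi.smul_apply, smul_eq_mul]
      rw [← tsum_mul_left]
      exact tsum_congr fun n => by ring)

theorem rapid_mul_of_le {a : ℤ × ℤ → ℂ} (ha : RapidlyDecreasing a) (c : ℤ × ℤ → ℂ) (C : ℝ)
    (hc : ∀ n, ‖c n‖ ≤ C * weight n) : RapidlyDecreasing fun n => c n * a n := by
  intro k
  obtain ⟨D, hD⟩ := ha (k + 1)
  have hC : 0 ≤ C := by
    have := (norm_nonneg _).trans (hc 0)
    exact nonneg_of_mul_nonneg_left this (weight_pos 0)
  refine ⟨C * D, fun n => ?_⟩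
  have h := weight_pos n
  calc weight n ^ k * ‖c n * a n‖ = weight n ^ k * (‖c n‖ * ‖a n‖) := by rw [norm_mul]
    _ ≤ weight n ^ k * ((C * weight n) * ‖a n‖) := by gcongr; exact hc n
    _ = C * (weight n ^ (k + 1) * ‖a n‖) := by ring
    _ ≤ C * D := by gcongr; exact hD n

/-- The basic derivation `δ₁`, with `δ₁ (U₁ ^ n₁ U₂ ^ n₂) = 2 π i n₁ U₁ ^ n₁ U₂ ^ n₂`. -/
noncomputable def delta1 (θ : ℝ) : NCTorus θ →ₗ[ℂ] NCTorus θ where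
  toFun a := mk θ (fun n => (2 * Real.pi * Complex.I * n.1) * a.coeff n)
    (rapid_mul_of_le a.rapid _ (2 * Real.pi) fun n => by
      have h : |(n.1 : ℝ)| ≤ weight n := by unfold weight; linarith [abs_nonneg (n.2 : ℝ)]
      have hp := Real.pi_pos
      simp [abs_of_pos hp]
      gcongr)
  map_add' a b := by ext n; simp [mul_add]
  map_smul' c a := by ext n; simp; ring

/-- The basic derivation `δ₂`, with `δ₂ (U₁ ^ n₁ U₂ ^ n₂) = 2 π i n₂ U₁ ^ n₁ U₂ ^ n₂`. -/
noncomputable def delta2 (θ : ℝ) : NCTorus θ →ₗ[ℂ] NCTorus θ where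
  toFun a := mk θ (fun n => (2 * Real.pi * Complex.I * n.2) * a.coeff n)
    (rapid_mul_of_le a.rapid _ (2 * Real.pi) fun n => by
      have h : |(n.2 : ℝ)| ≤ weight n := by unfold weight; linarith [abs_nonneg (n.1 : ℝ)]
      have hp := Real.pi_pos
      simp [abs_of_pos hp]
      gcongr)
  map_add' a b := by ext n; simp [mul_add]
  map_smul' c a := by ext n; simp; ring

/-- The complex structure `δ_τ = τ δ₁ + δ₂` on `A_θ`. -/
noncomputable def deltaTau (θ : ℝ) (τ : ℂ) : NCTorus θ →ₗ[ℂ] NCTorus θ :=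
  τ • delta1 θ + delta2 θ

theorem coeff_deltaTau (τ : ℂ) (a : NCTorus θ) (n : ℤ × ℤ) :
    (deltaTau θ τ a).coeff n = 2 * Real.pi * Complex.I * (τ * n.1 + n.2) * a.coeff n := by
  simp [deltaTau, delta1, delta2]; ring

theorem deltaTau_mul (τ : ℂ) (a b : NCTorus θ) :
    deltaTau θ τ (a * b) = deltaTau θ τ a * b + a * deltaTau θ τ b := by
  ext k
  rw [coeff_deltaTau, coeff_add, Pi.add_apply, coeff_mul, coeff_mul, coeff_mul, ← tsum_mul_left,
    ← (summable_twistedConv θ (deltaTau θ τ a).rapid b.rapid k).tsum_add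
      (summable_twistedConv θ a.rapid (deltaTau θ τ b).rapid k)]
  refine tsum_congr fun n => ?_
  rw [coeff_deltaTau, coeff_deltaTau]
  push_cast [Prod.fst_sub, Prod.snd_sub]
  ring

end NCTorus

/-! Holomorphic functions on the punctured plane. -/

/-- Extension of a function on `ℂ*` to `ℂ` by the value zero at the origin. -/
noncomputable def extendZero (f : ℂˣ → ℂ) (z : ℂ) : ℂ :=
  if h : z = 0 then 0 else f (Units.mk0 z h)

theorem extendZero_of_ne (f : ℂˣ → ℂ) {z : ℂ} (h : z ≠ 0) :
    extendZero f z = f (Units.mk0 z h) := dif_neg h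

@[simp] theorem extendZero_coe (f : ℂˣ → ℂ) (z : ℂˣ) : extendZero f z = f z := by
  rw [extendZero_of_ne f z.ne_zero]; simp

/-- The function `f` on `ℂ*` is holomorphic. -/
def IsHolomorphic (f : ℂˣ → ℂ) : Prop := DifferentiableOn ℂ (extendZero f) {0}ᶜ

theorem isHolomorphic_of {f : ℂˣ → ℂ} {g : ℂ → ℂ} (hg : DifferentiableOn ℂ g {0}ᶜ)
    (h : ∀ z : ℂˣ, f z = g z) : IsHolomorphic f :=
  hg.congr fun z hz => by rw [extendZero_of_ne f hz, h]; rfl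

/-- The algebra `O(ℂ*)` of holomorphic functions on the punctured plane, as a subalgebra of all
functions. -/
def holSubalgebra : Subalgebra ℂ (ℂˣ → ℂ) where
  carrier := {f | IsHolomorphic f}
  mul_mem' {f g} hf hg := isHolomorphic_of (DifferentiableOn.mul hf hg) fun z => by simp
  add_mem' {f g} hf hg := isHolomorphic_of (DifferentiableOn.add hf hg) fun z => by simp
  algebraMap_mem' c := isHolomorphic_of (g := fun _ => c) (differentiableOn_const c) fun z => rfl

/-- The algebra `O(ℂ*)`. -/
abbrev OCstar : Type := holSubalgebra

namespace OCstar

theorem differentiableAt (f : OCstar) {z : ℂ} (hz : z ≠ 0) :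
    DifferentiableAt ℂ (extendZero f.1) z :=
  DifferentiableOn.differentiableAt f.2 (isOpen_compl_singleton.mem_nhds hz)

theorem extendZero_mul (f g : OCstar) :
    extendZero (f * g).1 = extendZero f.1 * extendZero g.1 := by
  funext z
  by_cases h : z = 0
  · simp [extendZero, h]
  · simp [extendZero, h]

theorem extendZero_add (f g : OCstar) :
    extendZero (f + g).1 = extendZero f.1 + extendZero g.1 := by
  funext z
  by_cases h : z = 0
  · simp [extendZero, h]
  · simp [extendZero, h]

theorem extendZero_smul (c : ℂ) (f : OCstar) :
    extendZero (c • f).1 = c • extendZero f.1 := by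
  funext z
  by_cases h : z = 0
  · simp [extendZero, h]
  · simp [extendZero, h]

end OCstar

/-- The number `q = exp (2 π i θ)`, as an element of `ℂ*`. -/
noncomputable def q (θ : ℝ) : ℂˣ :=
  Units.mk0 (Complex.exp (2 * Real.pi * Complex.I * θ)) (Complex.exp_ne_zero _)

/-- The automorphism `α` of `O(ℂ*)`, namely `α f (z) = f (q z)`. It generates the action of
`θ ℤ`. -/
noncomputable def alpha (θ : ℝ) : OCstar →ₐ[ℂ] OCstar where
  toFun f := ⟨fun z => f.1 (q θ * z), isHolomorphic_of
    (g := fun z => extendZero f.1 ((q θ : ℂ) * z))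
    (fun z hz => (DifferentiableAt.comp z (f.differentiableAt (mul_ne_zero (q θ).ne_zero hz))
      (differentiableAt_id.const_mul _)).differentiableWithinAt)
    (fun z => by rw [← Units.val_mul, extendZero_coe])⟩
  map_one' := rfl
  map_mul' _ _ := rfl
  map_zero' := rfl
  map_add' _ _ := rfl
  commutes' _ := rfl

/-- The derivation `z d/dz` of `O(ℂ*)`. -/
noncomputable def eulerDer : Derivation ℂ OCstar OCstar where
  toFun f := ⟨fun z => z * deriv (extendZero f.1) z, isHolomorphic_of
    (g := fun z => z * deriv (extendZero f.1) z)
    (differentiableOn_id.mul (DifferentiableOn.deriv f.2 isOpen_compl_singleton))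
    (fun _ => rfl)⟩
  map_add' f g := by
    ext z
    simp only [OCstar.extendZero_add]
    rw [deriv_add (f.differentiableAt z.ne_zero) (g.differentiableAt z.ne_zero)]
    simp [mul_add]
  map_smul' c f := by
    ext z
    simp only [OCstar.extendZero_smul]
    rw [deriv_const_smul _ (f.differentiableAt z.ne_zero)]
    simp; ring
  map_one_eq_zero' := by
    ext z
    have : extendZero (1 : OCstar).1 =ᶠ[nhds (z : ℂ)] fun _ => 1 := by
      filter_upwards [isOpen_compl_singleton.mem_nhds z.ne_zero] with w hw
      rw [extendZero_of_ne _ hw]; rfl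
    have h : deriv (extendZero (1 : OCstar).1) z = 0 := by rw [this.deriv_eq]; simp
    change (z : ℂ) * deriv (extendZero (1 : OCstar).1) z = 0
    rw [h, mul_zero]
  leibniz' f g := by
    ext z
    simp only [LinearMap.coe_mk, AddHom.coe_mk, OCstar.extendZero_mul]
    rw [deriv_mul (f.differentiableAt z.ne_zero) (g.differentiableAt z.ne_zero)]
    simp; ring

/-- The derivation `δ = τ z d/dz` of `O(ℂ*)`. -/
noncomputable def delta (τ : ℂ) : Derivation ℂ OCstar OCstar := τ • eulerDer

/-- The coefficient of `z ^ n` in the Laurent series of `f`. -/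
noncomputable def laurentCoeff (f : OCstar) (n : ℤ) : ℂ :=
  (2 * Real.pi * Complex.I)⁻¹ * ∮ z in C(0, 1), extendZero f.1 z * z ^ (-n - 1)

theorem circleIntegrable_laurent (f : OCstar) (n : ℤ) {r : ℝ} (hr : 0 < r) :
    CircleIntegrable (fun z => extendZero f.1 z * z ^ n) 0 r := by
  refine ContinuousOn.circleIntegrable hr.le fun z hz => ?_
  have hz0 : z ≠ 0 := by
    rintro rfl; simp at hz; exact hr.ne hz
  exact ((f.differentiableAt hz0).continuousAt.mul
    (continuousAt_zpow₀ z n (Or.inl hz0))).continuousWithinAt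

theorem laurentCoeff_radius (f : OCstar) (n : ℤ) {r : ℝ} (hr : 0 < r) :
    laurentCoeff f n
      = (2 * Real.pi * Complex.I)⁻¹ * ∮ z in C(0, r), extendZero f.1 z * z ^ (-n - 1) := by
  have key : ∀ {r R : ℝ}, 0 < r → r ≤ R →
      (∮ z in C(0, R), extendZero f.1 z * z ^ (-n - 1))
        = ∮ z in C(0, r), extendZero f.1 z * z ^ (-n - 1) := by
    intro r R hr hrR
    have hd : ∀ z : ℂ, z ∉ Metric.ball (0 : ℂ) r →
        DifferentiableAt ℂ (fun z => extendZero f.1 z * z ^ (-n - 1)) z := by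
      intro z hz
      have hz0 : z ≠ 0 := by
        rintro rfl; simp at hz; linarith
      exact (f.differentiableAt hz0).mul (differentiableAt_zpow.mpr (Or.inl hz0))
    refine Complex.circleIntegral_eq_of_differentiable_on_annulus_off_countable hr hrR
      Set.countable_empty (fun z hz => (hd z hz.2).continuousAt.continuousWithinAt)
      (fun z hz => hd z fun h => hz.1.2 (Metric.ball_subset_closedBall h))
  unfold laurentCoeff
  congr 1
  rcases le_total r 1 with h | h
  · exact key hr h
  · exact (key one_pos h).symm

theorem exists_laurentCoeff_le (f : OCstar) {r : ℝ} (hr : 0 < r) :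
    ∃ C : ℝ, 0 ≤ C ∧ ∀ n : ℤ, ‖laurentCoeff f n‖ ≤ C * r ^ (-n) := by
  have hc : ContinuousOn (extendZero f.1) (Metric.sphere 0 r) := fun z hz => by
    have hz0 : z ≠ 0 := by
      rintro rfl; simp at hz; exact hr.ne hz
    exact (f.differentiableAt hz0).continuousAt.continuousWithinAt
  obtain ⟨C, hC⟩ := (isCompact_sphere (0 : ℂ) r).exists_bound_of_continuousOn hc
  have hC0 : 0 ≤ C := (norm_nonneg _).trans (hC (r : ℂ) (by simp [abs_of_pos hr]))
  refine ⟨C, hC0, fun n => ?_⟩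
  rw [laurentCoeff_radius f n hr]
  have h := circleIntegral.norm_two_pi_i_inv_smul_integral_le_of_norm_le_const (c := 0) hr.le
    (f := fun z => extendZero f.1 z * z ^ (-n - 1)) (C := C * r ^ (-n - 1)) (fun z hz => by
      have hz' : ‖z‖ = r := by simpa using hz
      rw [norm_mul, norm_zpow, hz']
      gcongr
      exact hC z hz)
  rw [smul_eq_mul] at h
  refine h.trans (le_of_eq ?_)
  rw [zpow_sub_one₀ hr.ne']
  field_simp

/-- The coefficients `f_n` of `ψ f = ∑ f_n U₁ ^ n`. -/
noncomputable def psiCoeff (f : OCstar) (n : ℤ × ℤ) : ℂ :=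
  if n.2 = 0 then laurentCoeff f n.1 else 0

theorem rapidlyDecreasing_psiCoeff (f : OCstar) : RapidlyDecreasing (psiCoeff f) := by
  intro k
  obtain ⟨C, hC0, hC⟩ := exists_laurentCoeff_le f (r := 2) (by norm_num)
  obtain ⟨D, hD0, hD⟩ := exists_laurentCoeff_le f (r := 1 / 2) (by norm_num)
  have hb : ∀ n : ℤ, ‖laurentCoeff f n‖ ≤ (C + D) * (1 / 2 : ℝ) ^ n.natAbs := by
    intro n
    rcases Int.eq_nat_or_neg n with ⟨m, rfl | rfl⟩
    · refine (hC m).trans ?_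
      have : (2 : ℝ) ^ (-(m : ℤ)) = (1 / 2) ^ m := by simp
      rw [this, Int.natAbs_natCast]
      gcongr
      linarith
    · refine (hD _).trans ?_
      rw [neg_neg, zpow_natCast, Int.natAbs_neg, Int.natAbs_natCast]
      gcongr
      linarith
  have hlim : Filter.Tendsto (fun m : ℕ => ((m + 1 : ℕ) : ℝ) ^ k * (1 / 2 : ℝ) ^ (m + 1))
      Filter.atTop (nhds 0) :=
    (tendsto_pow_const_mul_const_pow_of_lt_one k (by norm_num : (0 : ℝ) ≤ 1 / 2)
      (by norm_num)).comp (Filter.tendsto_add_atTop_nat 1)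
  obtain ⟨B, hB⟩ := hlim.bddAbove_range
  have hB' : ∀ m : ℕ, (1 + m : ℝ) ^ k * (1 / 2 : ℝ) ^ m ≤ 2 * B := by
    intro m
    have := hB ⟨m, rfl⟩
    simp only [pow_succ] at this
    push_cast at this
    rw [add_comm (1 : ℝ)]
    linarith
  have hB0 : 0 ≤ 2 * B := le_trans (by positivity) (hB' 0)
  refine ⟨(C + D) * (2 * B), fun n => ?_⟩
  unfold psiCoeff
  split_ifs with h
  · have hw : weight n = 1 + (n.1.natAbs : ℝ) := by
      simp [weight, h, Nat.cast_natAbs]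
    rw [hw]
    calc (1 + (n.1.natAbs : ℝ)) ^ k * ‖laurentCoeff f n.1‖
        ≤ (1 + (n.1.natAbs : ℝ)) ^ k * ((C + D) * (1 / 2 : ℝ) ^ n.1.natAbs) := by
          gcongr; exact hb _
      _ = (C + D) * ((1 + (n.1.natAbs : ℝ)) ^ k * (1 / 2 : ℝ) ^ n.1.natAbs) := by ring
      _ ≤ (C + D) * (2 * B) := mul_le_mul_of_nonneg_left (hB' _) (by positivity)
  · simp; positivity

theorem laurentCoeff_add (f g : OCstar) (n : ℤ) :
    laurentCoeff (f + g) n = laurentCoeff f n + laurentCoeff g n := by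
  unfold laurentCoeff
  rw [← mul_add, ← circleIntegral.integral_add (circleIntegrable_laurent f _ one_pos)
    (circleIntegrable_laurent g _ one_pos)]
  simp only [OCstar.extendZero_add, Pi.add_apply, add_mul]

theorem laurentCoeff_const (c : ℂ) (n : ℤ) :
    laurentCoeff (algebraMap ℂ OCstar c) n = if n = 0 then c else 0 := by
  have h : laurentCoeff (algebraMap ℂ OCstar c) n
      = (2 * Real.pi * Complex.I)⁻¹ * ∮ z in C(0, 1), c * (z - 0) ^ (-n - 1) := by
    unfold laurentCoeff
    congr 1
    refine circleIntegral.integral_congr zero_le_one fun z hz => ?_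
    have hz0 : z ≠ 0 := by
      rintro rfl; simp at hz
    simp only [sub_zero]
    rw [extendZero_of_ne _ hz0]; rfl
  have h2 : (2 * Real.pi * Complex.I : ℂ) ≠ 0 := Complex.two_pi_I_ne_zero
  rw [h, circleIntegral.integral_const_mul]
  split_ifs with hn
  · subst hn
    have : (-0 - 1 : ℤ) = -1 := by norm_num
    simp only [this, zpow_neg_one]
    rw [circleIntegral.integral_sub_center_inv _ one_ne_zero]
    field_simp
  · rw [circleIntegral.integral_sub_zpow_of_ne (by omega)]
    simp

theorem laurentCoeff_eulerDer (f : OCstar) (n : ℤ) :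
    laurentCoeff (eulerDer f) n = n * laurentCoeff f n := by
  have h0 : (∮ z in C(0, 1), (deriv (extendZero f.1) z * z ^ (-n)
      + extendZero f.1 z * ((-n : ℤ) * z ^ (-n - 1)))) = 0 := by
    refine circleIntegral.integral_eq_zero_of_hasDerivWithinAt zero_le_one
      (f := fun z => extendZero f.1 z * z ^ (-n)) fun z hz => ?_
    have hz0 : z ≠ 0 := by
      rintro rfl; simp at hz
    exact ((f.differentiableAt hz0).hasDerivAt.mul
      (hasDerivAt_zpow (-n) z (Or.inl hz0))).hasDerivWithinAt
  have h1 : (∮ z in C(0, 1), extendZero (eulerDer f).1 z * z ^ (-n - 1))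
      = ∮ z in C(0, 1), ((deriv (extendZero f.1) z * z ^ (-n)
      + extendZero f.1 z * ((-n : ℤ) * z ^ (-n - 1)))
      + n * (extendZero f.1 z * z ^ (-n - 1))) := by
    refine circleIntegral.integral_congr zero_le_one fun z hz => ?_
    have hz0 : z ≠ 0 := by
      rintro rfl; simp at hz
    have e : extendZero (eulerDer f).1 z = z * deriv (extendZero f.1) z := by
      rw [extendZero_of_ne _ hz0]; rfl
    simp only [e, zpow_sub_one₀ hz0]
    push_cast
    field_simp
    ring
  unfold laurentCoeff
  rw [h1, circleIntegral.integral_add, h0, circleIntegral.integral_const_mul]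
  · ring
  · refine ContinuousOn.circleIntegrable zero_le_one fun z hz => ?_
    have hz0 : z ≠ 0 := by
      rintro rfl; simp at hz
    have hd : ContinuousAt (deriv (extendZero f.1)) z :=
      ((DifferentiableOn.deriv f.2 isOpen_compl_singleton).differentiableAt
        (isOpen_compl_singleton.mem_nhds hz0)).continuousAt
    exact ((hd.mul (continuousAt_zpow₀ z _ (Or.inl hz0))).add
      ((f.differentiableAt hz0).continuousAt.mul
        (continuousAt_const.mul (continuousAt_zpow₀ z _ (Or.inl hz0))))).continuousWithinAt
  · exact (circleIntegrable_laurent f _ one_pos).const_fun_smul (a := (n : ℂ))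

/-- The restriction of `f` to the unit circle, as a function of the angle. -/
noncomputable def circleRestrict (f : OCstar) : C(AddCircle (2 * Real.pi), ℂ) where
  toFun x := extendZero f.1 (AddCircle.toCircle x : ℂ)
  continuous_toFun := by
    have h : Continuous fun x : AddCircle (2 * Real.pi) => ((AddCircle.toCircle x : Circle) : ℂ) :=
      continuous_subtype_val.comp AddCircle.continuous_toCircle
    refine continuous_iff_continuousAt.mpr fun x => ?_
    exact ContinuousAt.comp (f := fun x : AddCircle (2 * Real.pi) => (AddCircle.toCircle x : ℂ))
      (f.differentiableAt (Circle.coe_ne_zero _)).continuousAt h.continuousAt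

instance : Fact (0 < 2 * Real.pi) := ⟨Real.two_pi_pos⟩

theorem laurentCoeff_eq_fourierCoeff (f : OCstar) (n : ℤ) :
    laurentCoeff f n = fourierCoeff (circleRestrict f) n := by
  rw [fourierCoeff_eq_intervalIntegral _ n 0, laurentCoeff, circleIntegral, zero_add,
    Complex.real_smul]
  have h : ∀ x : ℝ, deriv (circleMap 0 1) x •
      (extendZero f.1 (circleMap 0 1 x) * circleMap 0 1 x ^ (-n - 1))
      = Complex.I * (fourier (-n) (x : AddCircle (2 * Real.pi)) •
        circleRestrict f (x : AddCircle (2 * Real.pi))) := by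
    intro x
    have hx : circleMap 0 1 x = ((AddCircle.toCircle (x : AddCircle (2 * Real.pi)) : Circle) : ℂ) := by
      rw [AddCircle.toCircle_apply_mk, circleMap, Circle.coe_exp]
      have : (2 * Real.pi / (2 * Real.pi) : ℝ) = 1 := div_self Real.two_pi_pos.ne'
      simp
    have h0 : circleMap 0 1 x ≠ 0 := by rw [hx]; exact Circle.coe_ne_zero _
    have hf : fourier (-n) (x : AddCircle (2 * Real.pi)) = circleMap 0 1 x ^ (-n) := by
      rw [fourier_apply, hx, AddCircle.toCircle_zsmul, Circle.coe_zpow]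
    rw [hf, deriv_circleMap, zpow_sub_one₀ h0]
    have : circleRestrict f (x : AddCircle (2 * Real.pi)) = extendZero f.1 (circleMap 0 1 x) := by
      rw [hx]; rfl
    rw [this]
    simp only [smul_eq_mul]
    field_simp
  simp_rw [h]
  rw [intervalIntegral.integral_const_mul]
  have hp : (Real.pi : ℂ) ≠ 0 := by exact_mod_cast Real.pi_ne_zero
  push_cast
  field_simp

theorem summable_laurentCoeff (f : OCstar) : Summable (laurentCoeff f) := by
  have h := (rapidlyDecreasing_psiCoeff f).summable_norm.of_norm
  have hi : Function.Injective fun n : ℤ => ((n, 0) : ℤ × ℤ) := fun a b h => by simpa using h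
  have := h.comp_injective hi
  simpa [Function.comp_def, psiCoeff] using this

theorem laurentCoeff_mul (f g : OCstar) (k : ℤ) :
    HasSum (fun n => laurentCoeff f n * laurentCoeff g (k - n)) (laurentCoeff (f * g) k) := by
  have hs := summable_laurentCoeff f
  have hs' : Summable (fourierCoeff (circleRestrict f)) := by
    convert hs using 1
    funext n
    exact (laurentCoeff_eq_fourierCoeff f n).symm
  let F : ℤ → AddCircle (2 * Real.pi) → ℂ := fun n x =>
    laurentCoeff f n * (fourier (-(k - n)) x • circleRestrict g x)
  have hcont : ∀ n, Continuous (F n) := fun n =>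
    continuous_const.mul ((fourier _).continuous.smul (circleRestrict g).continuous)
  have hint : ∀ n, MeasureTheory.Integrable (F n) AddCircle.haarAddCircle := fun n =>
    (hcont n).integrable_of_hasCompactSupport (HasCompactSupport.of_compactSpace _)
  have hnorm : ∀ n x, ‖F n x‖ ≤ ‖laurentCoeff f n‖ * ‖circleRestrict g‖ := by
    intro n x
    simp only [F, norm_mul, smul_eq_mul]
    rw [show ‖fourier (-(k - n)) x‖ = 1 from Circle.norm_coe _, one_mul]
    gcongr
    exact (circleRestrict g).norm_coe_le_norm x
  have hsum : Summable fun n => ∫ x, ‖F n x‖ ∂AddCircle.haarAddCircle := by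
    refine Summable.of_nonneg_of_le (fun n => MeasureTheory.integral_nonneg fun x => norm_nonneg _)
      (fun n => ?_) (hs.norm.mul_right ‖circleRestrict g‖)
    have := MeasureTheory.integral_mono (μ := AddCircle.haarAddCircle (T := 2 * Real.pi))
      (hint n).norm (MeasureTheory.integrable_const _) (hnorm n)
    simpa using this
  have key := MeasureTheory.hasSum_integral_of_summable_integral_norm hint hsum
  have e1 : ∀ n, ∫ x, F n x ∂AddCircle.haarAddCircle = laurentCoeff f n * laurentCoeff g (k - n) := by
    intro n
    rw [MeasureTheory.integral_const_mul, laurentCoeff_eq_fourierCoeff g]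
    rfl
  have e2 : ∫ x, ∑' n, F n x ∂AddCircle.haarAddCircle = laurentCoeff (f * g) k := by
    rw [laurentCoeff_eq_fourierCoeff, fourierCoeff]
    refine MeasureTheory.integral_congr_ae (Filter.Eventually.of_forall fun x => ?_)
    have hx := (has_pointwise_sum_fourier_series_of_summable hs' x).mul_right
      (fourier (-k) x * circleRestrict g x)
    have : ∀ n, fourierCoeff (circleRestrict f) n • fourier n x
        * (fourier (-k) x * circleRestrict g x) = F n x := by
      intro n
      simp only [F, smul_eq_mul]
      rw [← laurentCoeff_eq_fourierCoeff, show -(k - n) = n + -k by ring, fourier_add]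
      ring
    simp only [this] at hx
    change ∑' n, F n x = _
    rw [hx.tsum_eq]
    have : circleRestrict (f * g) x = circleRestrict f x * circleRestrict g x := by
      change extendZero (f * g).1 _ = extendZero f.1 _ * extendZero g.1 _
      rw [OCstar.extendZero_mul]; rfl
    change _ = fourier (-k) x * circleRestrict (f * g) x
    rw [this]
    ring
  simpa only [e1, e2] using key

theorem laurentCoeff_smul (c : ℂ) (f : OCstar) (n : ℤ) :
    laurentCoeff (c • f) n = c * laurentCoeff f n := by
  unfold laurentCoeff
  simp only [OCstar.extendZero_smul, Pi.smul_apply, smul_eq_mul, mul_assoc c]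
  rw [circleIntegral.integral_const_mul]
  ring

/-- The homomorphism `ψ : O(ℂ*) → A_θ`, `∑ f_n z ^ n ↦ ∑ f_n U₁ ^ n`. -/
noncomputable def psi (θ : ℝ) : OCstar →ₐ[ℂ] NCTorus θ :=
  AlgHom.ofLinearMap
    { toFun := fun f => NCTorus.mk θ (psiCoeff f) (rapidlyDecreasing_psiCoeff f)
      map_add' := fun f g => by
        ext n
        by_cases h : n.2 = 0 <;> simp [psiCoeff, h, laurentCoeff_add]
      map_smul' := fun c f => by
        ext n
        by_cases h : n.2 = 0 <;> simp [psiCoeff, h, laurentCoeff_smul] }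
    (by
      ext n
      rw [← map_one (algebraMap ℂ OCstar)]
      change psiCoeff _ n = (Pi.single 0 1 : ℤ × ℤ → ℂ) n
      rw [psiCoeff, laurentCoeff_const, Pi.single_apply]
      rcases n with ⟨n₁, n₂⟩
      by_cases h : n₁ = 0 <;> by_cases h' : n₂ = 0 <;> simp [h, h'])
    (fun f g => by
      ext k
      change psiCoeff (f * g) k = ∑' n, psiCoeff f n * psiCoeff g (k - n) * phase θ n (k - n)
      by_cases h : k.2 = 0
      · have hi : Function.Injective fun n : ℤ => ((n, 0) : ℤ × ℤ) := fun a b h => by simpa using h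
        rw [← hi.tsum_eq]
        · have := (laurentCoeff_mul f g k.1).tsum_eq
          simp [psiCoeff, h, phase, this]
        · intro n hn
          refine ⟨n.1, Prod.ext rfl ?_⟩
          by_contra h0
          refine hn ?_
          have : n.2 ≠ 0 := fun h => h0 h.symm
          simp [psiCoeff, this]
      · have : ∀ n, psiCoeff f n * psiCoeff g (k - n) * phase θ n (k - n) = 0 := by
          intro n
          by_cases h1 : n.2 = 0
          · simp [psiCoeff, h1, h]
          · simp [psiCoeff, h1]
        rw [tsum_congr this]
        simp [psiCoeff, h])

@[simp] theorem coeff_psi (θ : ℝ) (f : OCstar) : (psi θ f).coeff = psiCoeff f := rfl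

/-- The compatibility `ψ (2 π i δ f) = δ_τ (ψ f)` of the derivations. -/
theorem psi_delta (θ : ℝ) (τ : ℂ) (f : OCstar) :
    (2 * Real.pi * Complex.I : ℂ) • psi θ (delta τ f) = NCTorus.deltaTau θ τ (psi θ f) := by
  ext n
  rw [NCTorus.coeff_deltaTau, NCTorus.coeff_smul, Pi.smul_apply, coeff_psi, coeff_psi]
  have : delta τ f = τ • eulerDer f := rfl
  rw [this]
  by_cases h : n.2 = 0
  · simp [psiCoeff, h, laurentCoeff_smul, laurentCoeff_eulerDer]; ring
  · simp [psiCoeff, h]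

/-! The category `B_q^τ`. -/

/-- The function `z⁻¹ f (z)` has at most a simple pole at the origin. -/
def HasLogPole (f : OCstar) : Prop :=
  MeromorphicAt (fun z : ℂ => z⁻¹ * extendZero f.1 z) 0 ∧
    -1 ≤ meromorphicOrderAt (fun z : ℂ => z⁻¹ * extendZero f.1 z) 0

/-- An object `(M, σ, ∇)` of `B_q^τ`, where `q = exp (2 π i θ)`. The representation of the infinite
cyclic group `θ ℤ` is given by the automorphism `σ` by which its generator `θ` acts. -/
structure BqTau (θ : ℝ) (τ : ℂ) : Type (u + 1) where
  /-- The underlying module over `O(ℂ*)`. -/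
  carrier : Type u
  [addCommGroup : AddCommGroup carrier]
  [module : Module OCstar carrier]
  finitePresentation : Module.FinitePresentation OCstar carrier
  /-- The action of the generator of `θ ℤ`. -/
  sigma : carrier ≃+ carrier
  sigma_smul : ∀ (f : OCstar) (m : carrier), sigma (f • m) = alpha θ f • sigma m
  /-- The connection. -/
  nabla : carrier →+ carrier
  nabla_smul : ∀ (f : OCstar) (m : carrier), nabla (f • m) = f • nabla m + delta τ f • m
  nabla_sigma : ∀ m : carrier, nabla (sigma m) = sigma (nabla m)
  /-- The connection is regular singular: for some module basis `e`, the matrix `A` given by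
  `∇ e_i = ∑ A_ij e_j` is such that all `z⁻¹ A_ij` have at most simple poles at the origin. -/
  regularSingular : ∃ (n : ℕ) (e : Module.Basis (Fin n) OCstar carrier),
    ∀ i j, HasLogPole (e.repr (nabla (e i)) j)

attribute [instance] BqTau.addCommGroup BqTau.module

namespace BqTau

variable {θ : ℝ} {τ : ℂ}

/-- A morphism of `B_q^τ`: an equivariant module map compatible with the connections. -/
@[ext]
structure Hom (X Y : BqTau.{u} θ τ) : Type u where
  /-- The underlying map of modules. -/
  lin : X.carrier →ₗ[OCstar] Y.carrier
  map_sigma : ∀ m, lin (X.sigma m) = Y.sigma (lin m)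
  map_nabla : ∀ m, lin (X.nabla m) = Y.nabla (lin m)

instance : Category.{u} (BqTau.{u} θ τ) where
  Hom := Hom
  id X := ⟨LinearMap.id, fun _ => rfl, fun _ => rfl⟩
  comp f g := ⟨g.lin ∘ₗ f.lin, fun m => by simp [f.map_sigma, g.map_sigma],
    fun m => by simp [f.map_nabla, g.map_nabla]⟩

end BqTau

/-! The category `Vect (T_θ^τ)`. -/

/-- A holomorphic bundle on the noncommutative torus: a finitely generated projective right
`A_θ`-module with a connection that lifts `δ_τ`. -/
structure HolBundle (θ : ℝ) (τ : ℂ) : Type (u + 1) where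
  /-- The underlying right `A_θ`-module. -/
  carrier : Type u
  [addCommGroup : AddCommGroup carrier]
  [module : Module (NCTorus θ)ᵐᵒᵖ carrier]
  finite : Module.Finite (NCTorus θ)ᵐᵒᵖ carrier
  projective : Module.Projective (NCTorus θ)ᵐᵒᵖ carrier
  /-- The connection. Its `ℂ`-linearity follows from additivity and the Leibniz rule, as `δ_τ`
  kills the constants. -/
  nabla : carrier →+ carrier
  leibniz : ∀ (e : carrier) (a : NCTorus θ),
    nabla (MulOpposite.op a • e)
      = MulOpposite.op a • nabla e + MulOpposite.op (NCTorus.deltaTau θ τ a) • e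

attribute [instance] HolBundle.addCommGroup HolBundle.module

namespace HolBundle

variable {θ : ℝ} {τ : ℂ}

/-- A holomorphic map: a module map that commutes with the connections. -/
@[ext]
structure Hom (E F : HolBundle.{u} θ τ) : Type u where
  /-- The underlying map of right modules. -/
  lin : E.carrier →ₗ[(NCTorus θ)ᵐᵒᵖ] F.carrier
  map_nabla : ∀ e, lin (E.nabla e) = F.nabla (lin e)

noncomputable instance : Category.{u} (HolBundle.{u} θ τ) where
  Hom := Hom
  id E := ⟨LinearMap.id, fun _ => rfl⟩
  comp f g := ⟨g.lin ∘ₗ f.lin, fun m => by simp [f.map_nabla, g.map_nabla]⟩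

end HolBundle

/-! The base change functor. -/

/-- `A_θ` as a module over `O(ℂ*)` through `ψ` and left multiplication, `f • a = ψ f * a`. -/
noncomputable instance psiLeftModule (θ : ℝ) : Module OCstar (NCTorus θ) :=
  Module.compHom (NCTorus θ) (psi θ).toRingHom

/-- `A_θ` as a module over `O(ℂ*)` through `ψ` and right multiplication, `f • a = a * ψ f`. -/
noncomputable abbrev psiRightModule (θ : ℝ) : Module OCstar (NCTorus θ) :=
  Module.compHom (NCTorus θ) ((psi θ).toRingHom.toOpposite
    fun f g => by
      change psi θ f * psi θ g = psi θ g * psi θ f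
      rw [← map_mul, ← map_mul, mul_comm])

theorem psi_smul_def {θ : ℝ} (f : OCstar) (a : NCTorus θ) : f • a = psi θ f * a := rfl

instance (θ : ℝ) : SMulCommClass OCstar (NCTorus θ)ᵐᵒᵖ (NCTorus θ) :=
  ⟨fun f b a => by
    simp only [psi_smul_def, MulOpposite.smul_eq_mul_unop, mul_assoc]⟩

/-- The right `A_θ`-module `M ⊗ A_θ` over `O(ℂ*)`, with the factors written in the other order. -/
abbrev BaseChange (θ : ℝ) (M : Type u) [AddCommGroup M] [Module OCstar M] : Type u :=
  NCTorus θ ⊗[OCstar] M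

section

variable {θ : ℝ} {τ : ℂ} {M N : Type u} [AddCommGroup M] [Module OCstar M]
  [AddCommGroup N] [Module OCstar N]

theorem op_smul_tmul (a b : NCTorus θ) (m : M) :
    MulOpposite.op b • (a ⊗ₜ[OCstar] m : BaseChange θ M) = (a * b) ⊗ₜ[OCstar] m := rfl

/-- The map of right `A_θ`-modules induced by a map of `O(ℂ*)`-modules. -/
noncomputable def baseChangeMap (θ : ℝ) (f : M →ₗ[OCstar] N) :
    BaseChange θ M →ₗ[(NCTorus θ)ᵐᵒᵖ] BaseChange θ N where
  toFun := f.lTensor (NCTorus θ)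
  map_add' := map_add _
  map_smul' b x := by
    induction x using TensorProduct.induction_on with
    | zero => simp
    | tmul a m =>
      obtain ⟨b, rfl⟩ := MulOpposite.op_surjective b
      simp [op_smul_tmul]
    | add x y hx hy => rw [smul_add, map_add, hx, hy, map_add, smul_add]

@[simp] theorem baseChangeMap_tmul (f : M →ₗ[OCstar] N) (a : NCTorus θ) (m : M) :
    baseChangeMap θ f (a ⊗ₜ[OCstar] m) = a ⊗ₜ[OCstar] f m := rfl

/-- The connection `2 π i ∇ ⊗ 1 + 1 ⊗ δ_τ` on `M ⊗ A_θ`. -/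
noncomputable def baseChangeNabla (θ : ℝ) (τ : ℂ) (nabla : M →+ M)
    (h : ∀ (f : OCstar) (m : M), nabla (f • m) = f • nabla m + delta τ f • m) :
    BaseChange θ M →+ BaseChange θ M :=
  TensorProduct.liftAddHom
    { toFun := fun a =>
        { toFun := fun m => ((2 * Real.pi * Complex.I : ℂ) • a) ⊗ₜ[OCstar] nabla m
            + NCTorus.deltaTau θ τ a ⊗ₜ[OCstar] m
          map_zero' := by simp
          map_add' := fun m m' => by
            simp only [map_add, TensorProduct.tmul_add]; abel }
      map_zero' := by ext; simp
      map_add' := fun a a' => by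
        ext m
        simp only [smul_add, map_add, TensorProduct.add_tmul, AddMonoidHom.coe_mk,
          ZeroHom.coe_mk, AddMonoidHom.add_apply]
        abel }
    (fun f a m => by
      simp only [AddMonoidHom.coe_mk, ZeroHom.coe_mk, h, psi_smul_def, NCTorus.deltaTau_mul,
        ← psi_delta, TensorProduct.tmul_add, ← TensorProduct.smul_tmul, TensorProduct.add_tmul,
        smul_mul_assoc, mul_smul_comm]
      abel)

theorem baseChangeNabla_tmul (nabla : M →+ M)
    (h : ∀ (f : OCstar) (m : M), nabla (f • m) = f • nabla m + delta τ f • m)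
    (a : NCTorus θ) (m : M) :
    baseChangeNabla θ τ nabla h (a ⊗ₜ[OCstar] m)
      = ((2 * Real.pi * Complex.I : ℂ) • a) ⊗ₜ[OCstar] nabla m
        + NCTorus.deltaTau θ τ a ⊗ₜ[OCstar] m := rfl

theorem baseChangeNabla_leibniz (nabla : M →+ M)
    (h : ∀ (f : OCstar) (m : M), nabla (f • m) = f • nabla m + delta τ f • m)
    (e : BaseChange θ M) (b : NCTorus θ) :
    baseChangeNabla θ τ nabla h (MulOpposite.op b • e)
      = MulOpposite.op b • baseChangeNabla θ τ nabla h e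
        + MulOpposite.op (NCTorus.deltaTau θ τ b) • e := by
  induction e using TensorProduct.induction_on with
  | zero => simp
  | tmul a m =>
    simp only [op_smul_tmul, baseChangeNabla_tmul, smul_add, NCTorus.deltaTau_mul,
      TensorProduct.add_tmul, smul_mul_assoc]
    abel
  | add x y hx hy =>
    rw [smul_add, map_add, hx, hy, map_add, smul_add, smul_add]; abel

/-- The base change of a free module of rank `n` is free of rank `n`. -/
noncomputable def baseChangeFree (θ : ℝ) {n : ℕ} (e : Module.Basis (Fin n) OCstar M) :
    BaseChange θ M ≃ₗ[(NCTorus θ)ᵐᵒᵖ] (Fin n → NCTorus θ) :=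
  let E : BaseChange θ M ≃ₗ[OCstar] (Fin n → NCTorus θ) :=
    (TensorProduct.congr (LinearEquiv.refl OCstar (NCTorus θ)) e.equivFun).trans
      (TensorProduct.piScalarRight OCstar OCstar (NCTorus θ) (Fin n))
  E.toAddEquiv.toLinearEquiv fun b x => by
    change E (b • x) = b • E x
    induction x using TensorProduct.induction_on with
    | zero => simp
    | tmul a m =>
      obtain ⟨b, rfl⟩ := MulOpposite.op_surjective b
      ext1 i
      simp [E, op_smul_tmul, psi_smul_def, mul_assoc]
    | add x y hx hy => rw [smul_add, map_add, hx, hy, map_add, smul_add]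

end

variable (θ : ℝ) (τ : ℂ)

/-- The functor `ψ_*` on objects. -/
noncomputable def psiStarObj (X : BqTau.{u} θ τ) : HolBundle.{u} θ τ where
  carrier := BaseChange θ X.carrier
  finite := by
    obtain ⟨n, e, _⟩ := X.regularSingular
    have : Module.Finite (NCTorus θ)ᵐᵒᵖ (NCTorus θ) :=
      Module.Finite.equiv (MulOpposite.opLinearEquiv (NCTorus θ)ᵐᵒᵖ).symm
    exact Module.Finite.equiv (baseChangeFree θ e).symm
  projective := by
    obtain ⟨n, e, _⟩ := X.regularSingular
    have : Module.Free (NCTorus θ)ᵐᵒᵖ (NCTorus θ) :=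
      Module.Free.of_equiv (MulOpposite.opLinearEquiv (NCTorus θ)ᵐᵒᵖ).symm
    exact Module.Projective.of_equiv (baseChangeFree θ e).symm
  nabla := baseChangeNabla θ τ X.nabla X.nabla_smul
  leibniz := baseChangeNabla_leibniz X.nabla X.nabla_smul

/-- The base change functor `ψ_* : B_q^τ ⥤ Vect (T_θ^τ)`, which sends `(M, σ, ∇)` to
`(M ⊗ A_θ, 2 π i ∇ ⊗ 1 + 1 ⊗ δ_τ)`. -/
noncomputable def psiStar : BqTau.{u} θ τ ⥤ HolBundle.{u} θ τ where
  obj X := psiStarObj θ τ X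
  map {X Y} f :=
    { lin := baseChangeMap θ f.lin
      map_nabla := fun e => by
        change baseChangeMap θ f.lin (baseChangeNabla θ τ X.nabla X.nabla_smul e)
          = baseChangeNabla θ τ Y.nabla Y.nabla_smul (baseChangeMap θ f.lin e)
        induction e using TensorProduct.induction_on with
        | zero => simp
        | tmul a m => simp [baseChangeNabla_tmul, f.map_nabla]
        | add x y hx hy => rw [map_add, map_add, hx, hy, map_add, map_add] }
  map_id X := HolBundle.Hom.ext (LinearMap.ext fun x => by
    change LinearMap.lTensor _ LinearMap.id x = x
    rw [LinearMap.lTensor_id]; rfl)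
  map_comp {X Y Z} f g := HolBundle.Hom.ext (LinearMap.ext fun x => by
    change LinearMap.lTensor _ (g.lin ∘ₗ f.lin) x
      = LinearMap.lTensor _ g.lin (LinearMap.lTensor _ f.lin x)
    rw [LinearMap.lTensor_comp]; rfl)

end NCT

/-! Flatness comes from the equational criterion: every relation `∑ f i • x i = 0` over O(ℂ*) must
be trivial. A nonzero holomorphic function has finitely many zeros on the unit circle, so a nonzero
finite family can be written f = p g, where p is a product of factors z - c with |c| = 1 and g has
no common zero on the circle. The factor p acts injectively on A_θ: if U₁ a = c a with |c| = 1, the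
moduli of the coefficients of a are constant along the first axis, and rapid decrease forces a = 0.
The family g becomes unimodular in A_θ: the function ∑ g_i g_i^*, with g^*(z) = conj (g (1 / conj
z)), is holomorphic on ℂ* and equals ∑ |g_i|² > 0 on the circle; its reciprocal is holomorphic near
the circle, hence has rapidly decreasing Fourier coefficients and inverts it in A_θ. A unimodular
family has only Koszul relations, and these are trivial (`Module.Flat.of_unimodular_factorization`,
`isUnit_psi`).

Flatness settles the statements about modules. For finite limits and colimits, kernels and cokernels
in B_q^τ must be those of the underlying modules, which is not formal because they need a basis with
a regular singular connection. Pulled back along x ↦ exp (2πix), the connection becomes a linear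
differential equation of period 1. Floquet theory gives a basis with a constant connection matrix,
up to a scalar a logarithm K of the inverse monodromy. For a morphism, take the logarithms K, K' of
source and target in one common open strip of height 2π. The Laurent coefficients F_k of the matrix
of the morphism then satisfy K F_k = F_k (K' + 2πik), a Sylvester equation with disjoint spectra
when k ≠ 0, so the matrix is constant (`exists_constant_matrix`). Linear algebra over ℂ now gives
bases of the kernel and the cokernel in which the connections are still constant, and constants have
logarithmic poles.

Faithfulness holds because the objects are free and ψ is injective by uniqueness of Laurent series:
m ↦ 1 ⊗ m is injective on the target of a morphism. -/

/-! ### A flatness criterion. -/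

/-- Once p is cancelled, the operators v contract the Koszul complex of g on M in the degree where
relations live. The v i are endomorphisms of M rather than scalars because the inverse needed below
exists in A_θ but not in O(ℂ*). -/
theorem Module.Flat.of_unimodular_factorization {R M : Type*} [CommRing R] [AddCommGroup M]
    [Module R M]
    (h : ∀ (l : ℕ) (f : Fin l → R), f ≠ 0 → ∃ (p : R) (g : Fin l → R) (v : Fin l → M →ₗ[R] M),
      (∀ i, f i = p * g i) ∧ (∀ x : M, p • x = 0 → x = 0) ∧ ∀ x, ∑ i, g i • v i x = x) :
    Module.Flat R M := by
  refine Module.Flat.of_forall_isTrivialRelation fun {l f x} hfx => ?_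
  by_cases hf : f = 0
  · refine ⟨l, fun i j => if i = j then 1 else 0, x, fun i => by simp, fun j => by simp [hf]⟩
  obtain ⟨p, g, v, hpg, hp, hv⟩ := h l f hf
  have hgx : ∑ i, g i • x i = 0 := hp _ (by simpa [Finset.smul_sum, smul_smul, ← hpg] using hfx)
  let e := (finProdFinEquiv (m := l) (n := l)).symm
  -- The pair (a, b) carries the Koszul vector g_b e_a - g_a e_b and the element v_b (x_a). Summing
  -- over pairs returns x_i - v_i (∑ g_a x_a) = x_i, and f = p g annihilates each Koszul vector.
  refine ⟨l * l, fun i j => g (e j).2 * (if i = (e j).1 then 1 else 0)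
      - g (e j).1 * (if i = (e j).2 then 1 else 0), fun j => v (e j).2 (x (e j).1),
      fun i => ?_, fun j => ?_⟩
  · rw [e.sum_comp (fun q : Fin l × Fin l => (g q.2 * (if i = q.1 then 1 else 0)
      - g q.1 * (if i = q.2 then 1 else 0)) • v q.2 (x q.1))]
    have h1 : v i (∑ j, g j • x j) = 0 := by rw [hgx, map_zero]
    simp only [map_sum, map_smul] at h1
    simp [Fintype.sum_prod_type, sub_smul, Finset.sum_sub_distrib, ite_smul, h1, hv]
  · simp [hpg, mul_sub, Finset.sum_sub_distrib]
    ring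

/-! ### Removing common zeros on the unit circle. -/

namespace NCT

namespace OCstar

/-- The function `z ↦ z - c` on `ℂ*`. -/
noncomputable def linear (c : ℂ) : OCstar :=
  ⟨fun z => z - c, isHolomorphic_of (g := fun z => z - c)
    (differentiableOn_id.sub_const c) fun _ => rfl⟩

theorem linear_apply (c : ℂ) (z : ℂˣ) : (linear c).1 z = z - c := rfl

theorem analyticOnNhd (f : OCstar) : AnalyticOnNhd ℂ (extendZero f.1) {0}ᶜ :=
  DifferentiableOn.analyticOnNhd f.2 isOpen_compl_singleton

theorem isPreconnected_compl_zero : IsPreconnected ({0}ᶜ : Set ℂ) :=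
  (isConnected_compl_singleton_of_one_lt_rank (by simp) 0).isPreconnected

theorem eq_zero_of_frequently (f : OCstar) {z : ℂ} (hz : z ≠ 0)
    (h : ∃ᶠ w in nhdsWithin z {z}ᶜ, extendZero f.1 w = 0) : f = 0 := by
  have := f.analyticOnNhd.eqOn_zero_of_preconnected_of_frequently_eq_zero
    isPreconnected_compl_zero hz h
  ext w
  simpa using this (show (w : ℂ) ∈ ({0}ᶜ : Set ℂ) from w.ne_zero)

theorem analyticOrderAt_ne_top {f : OCstar} (hf : f ≠ 0) (z : ℂˣ) :
    analyticOrderAt (extendZero f.1) z ≠ ⊤ := by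
  intro h
  rw [analyticOrderAt_eq_top] at h
  exact hf (f.eq_zero_of_frequently z.ne_zero (h.filter_mono nhdsWithin_le_nhds).frequently)

/-- The quotient is the slope of f at c, completed by the derivative; the singularity at c is
removable. -/
theorem exists_eq_linear_mul {f : OCstar} {c : ℂˣ} (h : f.1 c = 0) :
    ∃ g : OCstar, f = linear c * g := by
  have hs : ({0}ᶜ : Set ℂ) ∈ nhds (c : ℂ) := isOpen_compl_singleton.mem_nhds c.ne_zero
  refine ⟨⟨fun z => dslope (extendZero f.1) c z, isHolomorphic_of
    ((Complex.differentiableOn_dslope hs).mpr f.2) fun _ => rfl⟩, ?_⟩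
  ext z
  have := sub_smul_dslope (extendZero f.1) c z
  simp only [extendZero_coe, h, sub_zero] at this
  exact this.symm

theorem analyticOrderAt_linear_pow_mul (c : ℂˣ) (m : ℕ) (g : OCstar) :
    (m : ℕ∞) ≤ analyticOrderAt (extendZero (linear c ^ m * g).1) c := by
  induction m with
  | zero => simp
  | succ m ih =>
    have h1 : AnalyticAt ℂ (extendZero (linear c).1) c := (linear c).analyticOnNhd _ c.ne_zero
    have h2 : 1 ≤ analyticOrderAt (extendZero (linear c).1) c := by
      rw [Order.one_le_iff_ne_zero]
      exact h1.analyticOrderAt_ne_zero.mpr (by simp [linear_apply])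
    rw [pow_succ', mul_assoc, extendZero_mul, analyticOrderAt_mul h1
      ((linear c ^ m * g).analyticOnNhd _ c.ne_zero)]
    push_cast
    rw [add_comm]
    exact add_le_add h2 ih

/-- The finite order of vanishing of the nonzero member f i at c bounds the powers of z - c that
divide the whole family, so a maximal power exists. -/
theorem exists_common_factor_at {ι : Type*} {f : ι → OCstar} {i : ι} (hi : f i ≠ 0) (c : ℂˣ) :
    ∃ (m : ℕ) (g : ι → OCstar), (∀ j, f j = linear c ^ m * g j) ∧ ∃ j, (g j).1 c ≠ 0 := by
  let P : ℕ → Prop := fun m => ∃ g : ι → OCstar, ∀ j, f j = linear c ^ m * g j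
  obtain ⟨N, hN⟩ := ENat.ne_top_iff_exists.mp (analyticOrderAt_ne_top hi c)
  have hb : ∀ m, P m → m ≤ N := by
    rintro m ⟨g, hg⟩
    have := analyticOrderAt_linear_pow_mul c m (g i)
    rw [← hg i, ← hN] at this
    exact_mod_cast this
  have h0 : P 0 := ⟨f, fun j => by simp⟩
  classical
  have hm := Nat.findGreatest_spec (P := P) (Nat.zero_le N) h0
  obtain ⟨g, hg⟩ := hm
  refine ⟨_, g, hg, ?_⟩
  -- A remaining common zero at c would allow one more factor z - c, against maximality.
  by_contra! hc
  choose g' hg' using fun j => exists_eq_linear_mul (hc j)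
  have : P (Nat.findGreatest P N + 1) := ⟨g', fun j => by rw [hg j, pow_succ, mul_assoc, ← hg' j]⟩
  have := Nat.le_findGreatest (hb _ this) this
  omega

/-- The products of functions `z - c` with `c` on the unit circle. -/
def circlePolynomials : Submonoid OCstar :=
  Submonoid.closure {f | ∃ c : ℂˣ, ‖(c : ℂ)‖ = 1 ∧ f = linear c}

theorem exists_common_factor_on {ι : Type*} {f : ι → OCstar} {i : ι} (hi : f i ≠ 0)
    (Z : Finset ℂˣ) (hZ : ∀ z ∈ Z, ‖(z : ℂ)‖ = 1) :
    ∃ p ∈ circlePolynomials, ∃ g : ι → OCstar, (∀ j, f j = p * g j) ∧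
      ∀ z ∈ Z, ∃ j, (g j).1 z ≠ 0 := by
  classical
  induction Z using Finset.induction_on with
  | empty => exact ⟨1, one_mem _, f, by simp, by simp⟩
  | insert c Z _ ih =>
    obtain ⟨p, hp, g, hg, hz⟩ := ih fun z hz => hZ z (Finset.mem_insert_of_mem hz)
    have hgi : g i ≠ 0 := fun h => hi (by rw [hg i, h, mul_zero])
    obtain ⟨m, g', hg', hc⟩ := exists_common_factor_at hgi c
    have hl : linear c ∈ circlePolynomials :=
      Submonoid.subset_closure ⟨c, hZ c (Finset.mem_insert_self _ _), rfl⟩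
    refine ⟨p * linear c ^ m, mul_mem hp (pow_mem hl m), g', fun j => by
        rw [hg j, hg' j, mul_assoc], fun z hz' => ?_⟩
    rcases Finset.mem_insert.mp hz' with rfl | h
    · exact hc
    -- Dividing at c creates no common zero at the points treated before: a zero of g' j at z is
    -- also one of g j.
    · obtain ⟨j, hj⟩ := hz z h
      refine ⟨j, fun h0 => hj ?_⟩
      rw [hg' j]
      change (linear c ^ m).1 z * (g' j).1 z = 0
      rw [h0, mul_zero]

/-- Infinitely many zeros would accumulate on the compact circle, and the identity theorem on the
connected set ℂ* would give f = 0. -/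
theorem finite_zeros_circle {f : OCstar} (hf : f ≠ 0) :
    {z : ℂˣ | ‖(z : ℂ)‖ = 1 ∧ f.1 z = 0}.Finite := by
  have h : ({z : ℂ | ‖z‖ = 1 ∧ extendZero f.1 z = 0}).Finite := by
    by_contra hinf
    obtain ⟨z, hz, hacc⟩ := Set.Infinite.exists_accPt_of_subset_isCompact hinf
      (isCompact_sphere (0 : ℂ) 1) (fun z hz => by simpa using hz.1)
    have hz0 : z ≠ 0 := by
      rintro rfl; simp at hz
    rw [accPt_iff_frequently_nhdsNE] at hacc
    exact hf (f.eq_zero_of_frequently hz0 (hacc.mono fun w hw => hw.2))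
  refine (h.preimage Units.val_injective.injOn).subset fun z hz => ?_
  simpa using hz

theorem exists_unimodular_factorization {ι : Type*} {f : ι → OCstar} (hf : f ≠ 0) :
    ∃ p ∈ circlePolynomials, ∃ g : ι → OCstar, (∀ j, f j = p * g j) ∧
      ∀ z : ℂˣ, ‖(z : ℂ)‖ = 1 → ∃ j, (g j).1 z ≠ 0 := by
  obtain ⟨i, hi⟩ := Function.ne_iff.mp hf
  have hfin := finite_zeros_circle hi
  obtain ⟨p, hp, g, hg, hz⟩ := exists_common_factor_on hi hfin.toFinset
    fun z hz => (hfin.mem_toFinset.mp hz).1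
  refine ⟨p, hp, g, hg, fun z h1 => ?_⟩
  by_cases h0 : (f i).1 z = 0
  · exact hz z (hfin.mem_toFinset.mpr ⟨h1, h0⟩)
  · refine ⟨i, fun h => h0 ?_⟩
    rw [hg i]
    change p.1 z * (g i).1 z = 0
    rw [h, mul_zero]

/-- The function `z ↦ conj (f (1 / conj z))`, which is the conjugate of `f` on the unit circle. -/
noncomputable def circleConj (f : OCstar) : OCstar :=
  ⟨fun z => star (f.1 (star z)⁻¹), isHolomorphic_of
    (g := fun z => (starRingEnd ℂ ∘ extendZero f.1 ∘ starRingEnd ℂ) z⁻¹)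
    (fun z hz => by
      have hz' : z ≠ 0 := hz
      have h1 : DifferentiableAt ℂ (starRingEnd ℂ ∘ extendZero f.1 ∘ starRingEnd ℂ) z⁻¹ := by
        have := (f.differentiableAt (z := starRingEnd ℂ z⁻¹) (by simpa using hz')).conj_conj
        simpa using this
      exact (h1.comp z (differentiableAt_inv hz')).differentiableWithinAt)
    (fun z => by
      simp only [Function.comp]
      have : (starRingEnd ℂ) (z : ℂ)⁻¹ = ((star z)⁻¹ : ℂˣ) := by simp
      rw [this, extendZero_coe]; rfl)⟩

theorem circleConj_apply (f : OCstar) {z : ℂˣ} (hz : ‖(z : ℂ)‖ = 1) :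
    (circleConj f).1 z = star (f.1 z) := by
  have : (star z)⁻¹ = z := by
    rw [inv_eq_iff_mul_eq_one]
    ext
    change starRingEnd ℂ (z : ℂ) * z = 1
    rw [Complex.conj_mul', hz]; simp
  change star (f.1 (star z)⁻¹) = _
  rw [this]

/-- On the circle the sum is ∑ |g_i|². This makes a family without common zeros there unimodular as
soon as functions without zeros on the circle become invertible. -/
theorem sum_circleConj_mul_ne_zero {ι : Type*} [Fintype ι] {g : ι → OCstar} {z : ℂˣ}
    (hz : ‖(z : ℂ)‖ = 1) (hg : ∃ j, (g j).1 z ≠ 0) :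
    (∑ i, g i * circleConj (g i)).1 z ≠ 0 := by
  have h : (∑ i, g i * circleConj (g i)).1 z = ((∑ i, ‖(g i).1 z‖ ^ 2 : ℝ) : ℂ) := by
    rw [AddSubmonoidClass.coe_finsetSum, Finset.sum_apply]
    push_cast
    refine Finset.sum_congr rfl fun i _ => ?_
    change (g i).1 z * (circleConj (g i)).1 z = _
    rw [circleConj_apply _ hz]
    exact Complex.mul_conj' _
  obtain ⟨j, hj⟩ := hg
  rw [h, Complex.ofReal_ne_zero]
  refine (Finset.sum_pos' (fun i _ => by positivity) ⟨j, Finset.mem_univ _, ?_⟩).ne'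
  have := norm_pos_iff.mpr hj
  positivity

end OCstar

/-! ### Injectivity of the factors U₁ - c with |c| = 1. -/

namespace NCTorus

variable {θ : ℝ}

/-- A nonzero coefficient would reappear with the same modulus along a whole line parallel to the
first axis, where the weight is unbounded. -/
theorem eq_zero_of_norm_invariant (a : NCTorus θ)
    (h : ∀ k, ‖a.coeff (k - (1, 0))‖ = ‖a.coeff k‖) : a = 0 := by
  have h' : ∀ (m : ℕ) (k : ℤ × ℤ), ‖a.coeff (k + ((m : ℤ), 0))‖ = ‖a.coeff k‖ := by
    intro m
    induction m with
    | zero => intro k; congr 2; ext <;> simp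
    | succ m ih =>
      intro k
      rw [← ih k, ← h (k + _)]
      congr 2
      ext <;> simp; ring
  obtain ⟨C, hC⟩ := a.rapid 1
  ext k
  by_contra hk
  have hpos : 0 < ‖a.coeff k‖ := norm_pos_iff.mpr hk
  obtain ⟨N, hN⟩ := exists_nat_gt (C / ‖a.coeff k‖)
  rw [div_lt_iff₀ hpos] at hN
  -- The shift by N + |k₁| makes the first coordinate at least N, even when k₁ is negative, so the
  -- weight exceeds C / |a_k|.
  have := hC (k + (((N + k.1.natAbs : ℕ) : ℤ), 0))
  rw [h', pow_one] at this
  have hw : (N : ℝ) ≤ weight (k + (((N + k.1.natAbs : ℕ) : ℤ), 0)) := by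
    unfold weight
    have h1 : (N : ℝ) ≤ ((k.1 + ((N + k.1.natAbs : ℕ) : ℤ) : ℤ) : ℝ) := by
      have : (N : ℤ) ≤ k.1 + ((N + k.1.natAbs : ℕ) : ℤ) := by omega
      exact_mod_cast this
    have h2 := le_abs_self ((k.1 + ((N + k.1.natAbs : ℕ) : ℤ) : ℤ) : ℝ)
    have h3 := abs_nonneg (((k + (((N + k.1.natAbs : ℕ) : ℤ), 0)).2 : ℤ) : ℝ)
    simp only [Prod.fst_add] at *
    linarith
  nlinarith

end NCTorus

theorem laurentCoeff_linear (c : ℂ) (n : ℤ) :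
    laurentCoeff (OCstar.linear c) n = (if n = 1 then 1 else 0) - if n = 0 then c else 0 := by
  have h : OCstar.linear c = OCstar.linear 0 + (-1 : ℂ) • algebraMap ℂ OCstar c := by
    ext z
    change (z : ℂ) - c = (z - 0) + (-1 : ℂ) * c
    ring
  have h0 : laurentCoeff (OCstar.linear 0) n = if n = 1 then 1 else 0 := by
    have h1 : laurentCoeff (OCstar.linear 0) n
        = (2 * Real.pi * Complex.I)⁻¹ * ∮ z in C(0, 1), (z - 0) ^ (-n) := by
      unfold laurentCoeff
      congr 1
      refine circleIntegral.integral_congr zero_le_one fun z hz => ?_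
      have hz0 : z ≠ 0 := by
        rintro rfl; simp at hz
      simp only [extendZero_of_ne _ hz0, OCstar.linear_apply, sub_zero, Units.val_mk0]
      rw [zpow_sub_one₀ hz0]
      field_simp
    have h2 : (2 * Real.pi * Complex.I : ℂ) ≠ 0 := Complex.two_pi_I_ne_zero
    rw [h1]
    split_ifs with hn
    · subst hn
      simp only [zpow_neg_one]
      rw [circleIntegral.integral_sub_center_inv _ one_ne_zero]
      field_simp
    · rw [circleIntegral.integral_sub_zpow_of_ne (by omega)]
      simp
  rw [h, laurentCoeff_add, laurentCoeff_smul, laurentCoeff_const, h0]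
  ring

theorem psi_linear (θ : ℝ) (c : ℂ) :
    psi θ (OCstar.linear c) = NCTorus.U θ (1, 0) - c • (1 : NCTorus θ) := by
  rw [sub_eq_add_neg, ← neg_smul]
  ext n
  change psiCoeff _ n = (Pi.single (1, 0) 1 : ℤ × ℤ → ℂ) n + (-c) * (Pi.single 0 1 : ℤ × ℤ → ℂ) n
  rcases n with ⟨n₁, n₂⟩
  rw [psiCoeff, laurentCoeff_linear, Pi.single_apply, Pi.single_apply]
  by_cases h2 : n₂ = 0 <;> by_cases h1 : n₁ = 1 <;> by_cases h0 : n₁ = 0 <;> simp [h0, h1, h2]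

/-- For a linear factor the equation reads U₁ a = c a. Multiplication by U₁ shifts coefficients up
to phases of modulus one, and |c| = 1, so the moduli are invariant under the shift. Injective
factors multiply. -/
theorem eq_zero_of_psi_mul_eq_zero {θ : ℝ} {p : OCstar} (hp : p ∈ OCstar.circlePolynomials) :
    ∀ a : NCTorus θ, psi θ p * a = 0 → a = 0 := by
  induction hp using Submonoid.closure_induction with
  | mem f hf =>
    obtain ⟨c, hc, rfl⟩ := hf
    intro a ha
    refine a.eq_zero_of_norm_invariant fun k => ?_
    rw [psi_linear, sub_mul, smul_mul_assoc, one_mul, sub_eq_zero] at ha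
    have := congrArg (fun b => ‖b.coeff k‖) ha
    simpa [NCTorus.coeff_U_mul, norm_phase, hc] using this
  | one => intro a ha; simpa using ha
  | mul f g _ _ hf hg => intro a ha; rw [map_mul, mul_assoc] at ha; exact hg _ (hf _ ha)

theorem eq_zero_of_mul_psi_eq_zero {θ : ℝ} {p : OCstar} (hp : p ∈ OCstar.circlePolynomials) :
    ∀ a : NCTorus θ, a * psi θ p = 0 → a = 0 := by
  induction hp using Submonoid.closure_induction with
  | mem f hf =>
    obtain ⟨c, hc, rfl⟩ := hf
    intro a ha
    refine a.eq_zero_of_norm_invariant fun k => ?_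
    rw [psi_linear, mul_sub, mul_smul_comm, mul_one, sub_eq_zero] at ha
    have := congrArg (fun b => ‖b.coeff k‖) ha
    simpa [NCTorus.coeff_mul_U, norm_phase, hc] using this
  | one => intro a ha; simpa using ha
  | mul f g _ _ hf hg => intro a ha; rw [map_mul, ← mul_assoc] at ha; exact hf _ (hg _ ha)

end NCT

/-! ### Functions without zeros on the circle become invertible; flatness of A_θ. -/

namespace NCT

/-- The Laurent coefficient on the unit circle of a function near the circle. -/
noncomputable def circleCoeff (h : ℂ → ℂ) (n : ℤ) : ℂ :=
  (2 * Real.pi * Complex.I)⁻¹ * ∮ z in C(0, 1), h z * z ^ (-n - 1)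

theorem ne_zero_of_mem_unit_sphere {z : ℂ} (hz : z ∈ Metric.sphere (0 : ℂ) 1) : z ≠ 0 := by
  rintro rfl; simp at hz

theorem circleIntegrable_mul_zpow {h : ℂ → ℂ} (hh : ∀ z ∈ Metric.sphere (0 : ℂ) 1, ContinuousAt h z)
    (n : ℤ) : CircleIntegrable (fun z => h z * z ^ n) 0 1 :=
  ContinuousOn.circleIntegrable zero_le_one fun z hz => ((hh z hz).mul
    (continuousAt_zpow₀ z n (Or.inl (ne_zero_of_mem_unit_sphere hz)))).continuousWithinAt

/-- Integration by parts: the derivative of h z⁻ⁿ integrates to zero over the circle. Here h is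
holomorphic only near the circle, as is the reciprocal of a function with zeros elsewhere. -/
theorem circleCoeff_euler {U : Set ℂ} (hU : IsOpen U) (hs : Metric.sphere (0 : ℂ) 1 ⊆ U)
    {h : ℂ → ℂ} (hh : DifferentiableOn ℂ h U) (n : ℤ) :
    circleCoeff (fun z => z * deriv h z) n = n * circleCoeff h n := by
  have hd : ∀ z ∈ Metric.sphere (0 : ℂ) 1, DifferentiableAt ℂ h z := fun z hz =>
    hh.differentiableAt (hU.mem_nhds (hs hz))
  have hd' : ∀ z ∈ Metric.sphere (0 : ℂ) 1, ContinuousAt (deriv h) z := fun z hz =>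
    ((hh.deriv hU).differentiableAt (hU.mem_nhds (hs hz))).continuousAt
  have h0 : (∮ z in C(0, 1), (deriv h z * z ^ (-n) + h z * ((-n : ℤ) * z ^ (-n - 1)))) = 0 :=
    circleIntegral.integral_eq_zero_of_hasDerivWithinAt zero_le_one
      (f := fun z => h z * z ^ (-n)) fun z hz => ((hd z hz).hasDerivAt.mul
        (hasDerivAt_zpow (-n) z (Or.inl (ne_zero_of_mem_unit_sphere hz)))).hasDerivWithinAt
  have h1 : (∮ z in C(0, 1), (z * deriv h z) * z ^ (-n - 1))
      = ∮ z in C(0, 1), ((deriv h z * z ^ (-n) + h z * ((-n : ℤ) * z ^ (-n - 1)))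
      + n * (h z * z ^ (-n - 1))) := by
    refine circleIntegral.integral_congr zero_le_one fun z hz => ?_
    have hz0 := ne_zero_of_mem_unit_sphere hz
    simp only [zpow_sub_one₀ hz0]
    push_cast
    field_simp
    ring
  unfold circleCoeff
  rw [h1, circleIntegral.integral_add, h0, circleIntegral.integral_const_mul]
  · ring
  · refine ContinuousOn.circleIntegrable zero_le_one fun z hz => ?_
    have hz0 := ne_zero_of_mem_unit_sphere hz
    exact (((hd' z hz).mul (continuousAt_zpow₀ z _ (Or.inl hz0))).add
      ((hd z hz).continuousAt.mul
        (continuousAt_const.mul (continuousAt_zpow₀ z _ (Or.inl hz0))))).continuousWithinAt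
  · exact (circleIntegrable_mul_zpow (fun z hz => (hd z hz).continuousAt) _).const_fun_smul
      (a := (n : ℂ))

theorem exists_circleCoeff_le {h : ℂ → ℂ} (hh : ContinuousOn h (Metric.sphere (0 : ℂ) 1)) :
    ∃ C : ℝ, ∀ n, ‖circleCoeff h n‖ ≤ C := by
  obtain ⟨C, hC⟩ := (isCompact_sphere (0 : ℂ) 1).exists_bound_of_continuousOn hh
  refine ⟨C, fun n => ?_⟩
  have := circleIntegral.norm_two_pi_i_inv_smul_integral_le_of_norm_le_const (c := 0) zero_le_one
    (f := fun z => h z * z ^ (-n - 1)) (C := C) (fun z hz => by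
      have hz' : ‖z‖ = 1 := by simpa using hz
      rw [norm_mul, norm_zpow, hz', one_zpow, mul_one]
      exact hC z hz)
  simpa [circleCoeff] using this

/-- Each application of z d/dz multiplies the nth coefficient by n and keeps h holomorphic near the
circle, where coefficients are bounded. -/
theorem exists_pow_mul_circleCoeff_le {U : Set ℂ} (hU : IsOpen U)
    (hs : Metric.sphere (0 : ℂ) 1 ⊆ U) (k : ℕ) {h : ℂ → ℂ} (hh : DifferentiableOn ℂ h U) :
    ∃ C : ℝ, ∀ n : ℤ, |(n : ℝ)| ^ k * ‖circleCoeff h n‖ ≤ C := by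
  induction k generalizing h with
  | zero => simpa using exists_circleCoeff_le (hh.continuousOn.mono hs)
  | succ k ih =>
    obtain ⟨C, hC⟩ := ih (h := fun z => z * deriv h z)
      (differentiableOn_id.mul (hh.deriv hU))
    refine ⟨C, fun n => ?_⟩
    have := hC n
    rw [circleCoeff_euler hU hs hh, norm_mul, Complex.norm_intCast] at this
    rw [pow_succ, mul_assoc]
    exact this

/-- A sequence on `ℤ`, viewed as the coefficients of a series in `U₁`. -/
def firstAxis (c : ℤ → ℂ) (n : ℤ × ℤ) : ℂ := if n.2 = 0 then c n.1 else 0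

theorem rapidlyDecreasing_firstAxis {c : ℤ → ℂ}
    (h : ∀ k : ℕ, ∃ C : ℝ, ∀ n : ℤ, |(n : ℝ)| ^ k * ‖c n‖ ≤ C) :
    RapidlyDecreasing (firstAxis c) := by
  intro k
  obtain ⟨C, hC⟩ := h 0
  obtain ⟨D, hD⟩ := h k
  have hC0 : 0 ≤ C := le_trans (by positivity) (hC 0)
  have hD0 : 0 ≤ D := le_trans (by positivity) (hD 0)
  refine ⟨2 ^ k * (C + D), fun n => ?_⟩
  unfold firstAxis
  split_ifs with hn
  · have hw : weight n = 1 + |(n.1 : ℝ)| := by simp [weight, hn]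
    -- This bounds powers of the weight by the two available estimates, for exponents 0 and k.
    have h1 : (1 + |(n.1 : ℝ)|) ^ k ≤ 2 ^ k * (1 + |(n.1 : ℝ)| ^ k) := by
      rcases le_total (|(n.1 : ℝ)|) 1 with h | h
      · calc (1 + |(n.1 : ℝ)|) ^ k ≤ 2 ^ k := by gcongr; linarith
          _ ≤ 2 ^ k * (1 + |(n.1 : ℝ)| ^ k) :=
            le_mul_of_one_le_right (by positivity) (by linarith [pow_nonneg (abs_nonneg (n.1 : ℝ)) k])
      · calc (1 + |(n.1 : ℝ)|) ^ k ≤ (2 * |(n.1 : ℝ)|) ^ k := by gcongr; linarith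
          _ = 2 ^ k * |(n.1 : ℝ)| ^ k := mul_pow _ _ _
          _ ≤ _ := by gcongr; linarith
    have h2 := hC n.1
    have h3 := hD n.1
    rw [pow_zero, one_mul] at h2
    rw [hw]
    calc (1 + |(n.1 : ℝ)|) ^ k * ‖c n.1‖ ≤ 2 ^ k * (1 + |(n.1 : ℝ)| ^ k) * ‖c n.1‖ := by gcongr
      _ = 2 ^ k * (‖c n.1‖ + |(n.1 : ℝ)| ^ k * ‖c n.1‖) := by ring
      _ ≤ _ := by gcongr
  · simp; positivity

theorem NCTorus.mul_comm_of_firstAxis {θ : ℝ} {a b : NCTorus θ} {c d : ℤ → ℂ}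
    (ha : a.coeff = firstAxis c) (hb : b.coeff = firstAxis d) : a * b = b * a := by
  ext k
  rw [coeff_mul, coeff_mul, ← (Equiv.subLeft k).tsum_eq]
  refine tsum_congr fun n => ?_
  simp only [Equiv.subLeft_apply, sub_sub_cancel, ha, hb, firstAxis]
  split_ifs with h1 h2
  · simp [phase, h1, h2]; ring
  all_goals simp

theorem NCTorus.coeff_mul_of_firstAxis {θ : ℝ} {a b : NCTorus θ} {c d : ℤ → ℂ}
    (ha : a.coeff = firstAxis c) (hb : b.coeff = firstAxis d) :
    (a * b).coeff = firstAxis fun k => ∑' n, c n * d (k - n) := by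
  funext k
  rw [coeff_mul, ha, hb]
  unfold firstAxis
  split_ifs with h
  · have hi : Function.Injective fun n : ℤ => ((n, 0) : ℤ × ℤ) := fun a b h => by simpa using h
    rw [← hi.tsum_eq]
    · simp [h, phase]
    · intro n hn
      refine ⟨n.1, Prod.ext rfl ?_⟩
      by_contra h0
      exact hn (by simp [Ne.symm h0])
  · refine (tsum_congr fun n => ?_).trans tsum_zero
    by_cases h1 : n.2 = 0 <;> simp [h1, h]

theorem circleCoeff_eq_fourierCoeff (h : ℂ → ℂ) (n : ℤ) :
    circleCoeff h n
      = fourierCoeff (fun x : AddCircle (2 * Real.pi) => h (AddCircle.toCircle x)) n := by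
  rw [fourierCoeff_eq_intervalIntegral _ n 0, circleCoeff, circleIntegral, zero_add,
    Complex.real_smul]
  have h' : ∀ x : ℝ, deriv (circleMap 0 1) x • (h (circleMap 0 1 x) * circleMap 0 1 x ^ (-n - 1))
      = Complex.I * (fourier (-n) (x : AddCircle (2 * Real.pi)) •
        h (AddCircle.toCircle (x : AddCircle (2 * Real.pi)))) := by
    intro x
    have hx : circleMap 0 1 x
        = ((AddCircle.toCircle (x : AddCircle (2 * Real.pi)) : Circle) : ℂ) := by
      rw [AddCircle.toCircle_apply_mk, circleMap, Circle.coe_exp]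
      have : (2 * Real.pi / (2 * Real.pi) : ℝ) = 1 := div_self Real.two_pi_pos.ne'
      simp
    have h0 : circleMap 0 1 x ≠ 0 := by rw [hx]; exact Circle.coe_ne_zero _
    have hf : fourier (-n) (x : AddCircle (2 * Real.pi)) = circleMap 0 1 x ^ (-n) := by
      rw [fourier_apply, hx, AddCircle.toCircle_zsmul, Circle.coe_zpow]
    rw [hf, deriv_circleMap, zpow_sub_one₀ h0, ← hx]
    simp only [smul_eq_mul]
    field_simp
  simp_rw [h']
  rw [intervalIntegral.integral_const_mul]
  have hp : (Real.pi : ℂ) ≠ 0 := by exact_mod_cast Real.pi_ne_zero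
  push_cast
  field_simp

theorem hasSum_fourier_circleRestrict (f : OCstar) (x : AddCircle (2 * Real.pi)) :
    HasSum (fun n => laurentCoeff f n * fourier n x) (circleRestrict f x) := by
  have hs' : Summable (fourierCoeff (circleRestrict f)) := by
    convert summable_laurentCoeff f using 1
    funext n
    exact (laurentCoeff_eq_fourierCoeff f n).symm
  simpa only [← laurentCoeff_eq_fourierCoeff, smul_eq_mul] using
    has_pointwise_sum_fourier_series_of_summable hs' x

/-- The Fourier series of f converges absolutely, so it may be integrated term by term against the
bounded function G. Continuity of G suffices, which allows G = 1/f on the circle. -/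
theorem hasSum_laurentCoeff_mul_fourierCoeff (f : OCstar) (G : C(AddCircle (2 * Real.pi), ℂ))
    (k : ℤ) : HasSum (fun n => laurentCoeff f n * fourierCoeff G (k - n))
      (fourierCoeff (circleRestrict f * G) k) := by
  have hs := summable_laurentCoeff f
  let F : ℤ → AddCircle (2 * Real.pi) → ℂ := fun n x =>
    laurentCoeff f n * (fourier (-(k - n)) x • G x)
  have hcont : ∀ n, Continuous (F n) := fun n =>
    continuous_const.mul ((fourier _).continuous.smul G.continuous)
  have hint : ∀ n, MeasureTheory.Integrable (F n) AddCircle.haarAddCircle := fun n =>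
    (hcont n).integrable_of_hasCompactSupport (HasCompactSupport.of_compactSpace _)
  have hnorm : ∀ n x, ‖F n x‖ ≤ ‖laurentCoeff f n‖ * ‖G‖ := by
    intro n x
    simp only [F, norm_mul, smul_eq_mul]
    rw [show ‖fourier (-(k - n)) x‖ = 1 from Circle.norm_coe _, one_mul]
    gcongr
    exact G.norm_coe_le_norm x
  have hsum : Summable fun n => ∫ x, ‖F n x‖ ∂AddCircle.haarAddCircle := by
    refine Summable.of_nonneg_of_le (fun n => MeasureTheory.integral_nonneg fun x => norm_nonneg _)
      (fun n => ?_) (hs.norm.mul_right ‖G‖)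
    have := MeasureTheory.integral_mono (μ := AddCircle.haarAddCircle (T := 2 * Real.pi))
      (hint n).norm (MeasureTheory.integrable_const _) (hnorm n)
    simpa using this
  have key := MeasureTheory.hasSum_integral_of_summable_integral_norm hint hsum
  have e1 : ∀ n, ∫ x, F n x ∂AddCircle.haarAddCircle = laurentCoeff f n * fourierCoeff G (k - n) := by
    intro n
    rw [MeasureTheory.integral_const_mul]
    rfl
  have e2 : ∫ x, ∑' n, F n x ∂AddCircle.haarAddCircle = fourierCoeff (circleRestrict f * G) k := by
    rw [fourierCoeff]
    refine MeasureTheory.integral_congr_ae (Filter.Eventually.of_forall fun x => ?_)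
    have hx := (hasSum_fourier_circleRestrict f x).mul_right (fourier (-k) x * G x)
    have : ∀ n, laurentCoeff f n * fourier n x * (fourier (-k) x * G x) = F n x := by
      intro n
      simp only [F, smul_eq_mul]
      rw [show -(k - n) = n + -k by ring, fourier_add]
      ring
    simp only [this] at hx
    change ∑' n, F n x = fourier (-k) x * (circleRestrict f x * G x)
    rw [hx.tsum_eq]
    ring
  simpa only [e1, e2] using key

/-- The circle is infinite, whereas a nonzero f has only finitely many zeros on it. -/
theorem OCstar.eq_zero_of_circleRestrict {f : OCstar} (h : circleRestrict f = 0) : f = 0 := by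
  have hz : ∀ z ∈ Metric.sphere (0 : ℂ) 1, extendZero f.1 z = 0 := by
    intro z hz
    have h1 : z = AddCircle.toCircle ((Complex.arg z : ℝ) : AddCircle (2 * Real.pi)) := by
      rw [AddCircle.toCircle_apply_mk, Circle.coe_exp]
      have : (2 * Real.pi / (2 * Real.pi) : ℝ) = 1 := div_self Real.two_pi_pos.ne'
      rw [this, one_mul]
      have hz' : ‖z‖ = 1 := by simpa using hz
      simpa [hz'] using (Complex.norm_mul_exp_arg_mul_I z).symm
    rw [h1]
    exact congrArg (fun g : C(AddCircle (2 * Real.pi), ℂ) => g _) h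
  have hinf : (Metric.sphere (0 : ℂ) 1).Infinite := by
    have := (isPreconnected_sphere (E := ℂ) (by simp [Complex.rank_real_complex]) 0 1)
    refine this.infinite_of_nontrivial ⟨1, by simp, -1, by simp, ?_⟩
    norm_num
  by_contra hf
  refine hinf (((finite_zeros_circle hf).image Units.val).subset fun z hz' => ?_)
  refine ⟨Units.mk0 z (ne_zero_of_mem_unit_sphere hz'), ⟨by simpa using hz', ?_⟩, rfl⟩
  simpa [extendZero_of_ne _ (ne_zero_of_mem_unit_sphere hz')] using hz z hz'

theorem OCstar.eq_zero_of_laurentCoeff {f : OCstar} (h : ∀ n, laurentCoeff f n = 0) : f = 0 := by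
  refine eq_zero_of_circleRestrict (ContinuousMap.ext fun x => ?_)
  have := hasSum_fourier_circleRestrict f x
  simp only [h, zero_mul] at this
  exact this.unique hasSum_zero

theorem psi_injective (θ : ℝ) : Function.Injective (psi θ) := by
  rw [injective_iff_map_eq_zero]
  refine fun f hf => OCstar.eq_zero_of_laurentCoeff fun n => ?_
  have := congrArg (fun a => NCTorus.coeff a (n, 0)) hf
  simpa [psiCoeff] using this

/-- The reciprocal may have poles in ℂ* away from the circle, so it need not lie in O(ℂ*). It is
holomorphic near the circle, and its Fourier coefficients there define an inverse in A_θ. -/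
theorem isUnit_psi (θ : ℝ) {f : OCstar} (hf : ∀ z : ℂˣ, ‖(z : ℂ)‖ = 1 → f.1 z ≠ 0) :
    IsUnit (psi θ f) := by
  let U : Set ℂ := {0}ᶜ ∩ extendZero f.1 ⁻¹' {0}ᶜ
  have hU : IsOpen U := f.2.continuousOn.isOpen_inter_preimage isOpen_compl_singleton
    isOpen_compl_singleton
  have hs : Metric.sphere (0 : ℂ) 1 ⊆ U := fun z hz => by
    have hz0 := ne_zero_of_mem_unit_sphere hz
    refine ⟨hz0, ?_⟩
    change extendZero f.1 z ≠ 0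
    rw [extendZero_of_ne _ hz0]
    exact hf _ (by simpa using hz)
  let h : ℂ → ℂ := fun z => (extendZero f.1 z)⁻¹
  have hh : DifferentiableOn ℂ h U :=
    DifferentiableOn.inv (f.2.mono Set.inter_subset_left) fun z hz => hz.2
  have hne : ∀ x, circleRestrict f x ≠ 0 := fun x =>
    (hs (by simp [Circle.norm_coe] : ((AddCircle.toCircle x : Circle) : ℂ) ∈ Metric.sphere (0 : ℂ) 1)).2
  let G : C(AddCircle (2 * Real.pi), ℂ) :=
    ⟨fun x => (circleRestrict f x)⁻¹, (circleRestrict f).continuous.inv₀ hne⟩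
  have hG : ∀ n, circleCoeff h n = fourierCoeff G n := fun n => circleCoeff_eq_fourierCoeff h n
  let w : NCTorus θ := NCTorus.mk θ (firstAxis (fourierCoeff G)) (rapidlyDecreasing_firstAxis
    fun k => by simpa only [hG] using exists_pow_mul_circleCoeff_le hU hs k hh)
  have h1 : psi θ f * w = 1 := by
    ext k
    rw [NCTorus.coeff_mul_of_firstAxis (c := laurentCoeff f) (d := fourierCoeff G) rfl rfl]
    have hfG : circleRestrict f * G = circleRestrict 1 := by
      ext x
      change circleRestrict f x * (circleRestrict f x)⁻¹ = extendZero (1 : OCstar).1 _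
      rw [mul_inv_cancel₀ (hne x), extendZero_of_ne _ (Circle.coe_ne_zero _)]
      rfl
    have h2 : ∀ k, ∑' n, laurentCoeff f n * fourierCoeff G (k - n) = laurentCoeff 1 k := fun k => by
      rw [(hasSum_laurentCoeff_mul_fourierCoeff f G k).tsum_eq, hfG, ← laurentCoeff_eq_fourierCoeff]
    simp only [h2]
    change psiCoeff 1 k = _
    rw [← coeff_psi θ, map_one]
  -- Series in U₁ alone commute, so the right inverse is also a left inverse.
  exact ⟨⟨_, w, h1, by
    rw [← NCTorus.mul_comm_of_firstAxis (c := laurentCoeff f) (d := fourierCoeff G) rfl rfl, h1]⟩,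
    rfl⟩

theorem psi_commute (θ : ℝ) (f g : OCstar) : Commute (psi θ f) (psi θ g) := by
  rw [commute_iff_eq, ← map_mul, ← map_mul, mul_comm]

/-- The elements are v_i = ψ(g_i^*) w⁻¹ with w the image of ∑ g_i g_i^*. That they commute with the
image of ψ is what makes multiplication by v_i linear over O(ℂ*), on either side. -/
theorem exists_sum_psi_mul_eq_one (θ : ℝ) {ι : Type*} [Fintype ι] {g : ι → OCstar}
    (hg : ∀ z : ℂˣ, ‖(z : ℂ)‖ = 1 → ∃ j, (g j).1 z ≠ 0) :
    ∃ v : ι → NCTorus θ, (∀ f i, Commute (psi θ f) (v i)) ∧ ∑ i, psi θ (g i) * v i = 1 := by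
  obtain ⟨w, hw⟩ := isUnit_psi θ fun z hz => OCstar.sum_circleConj_mul_ne_zero hz (hg z hz)
  refine ⟨fun i => psi θ (OCstar.circleConj (g i)) * ↑w⁻¹, fun f i => ?_, ?_⟩
  · refine (psi_commute θ f _).mul_right (Commute.units_inv_right ?_)
    rw [hw]
    exact psi_commute θ f _
  · simp only [← mul_assoc, ← Finset.sum_mul, ← map_mul, ← map_sum, ← hw, Units.mul_inv]

theorem flat_left (θ : ℝ) : Module.Flat OCstar (NCTorus θ) := by
  refine Module.Flat.of_unimodular_factorization fun l f hf => ?_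
  obtain ⟨p, hp, g, hfg, hg⟩ := OCstar.exists_unimodular_factorization hf
  obtain ⟨v, hv, hsum⟩ := exists_sum_psi_mul_eq_one θ hg
  refine ⟨p, g, fun i => { toFun := fun a => v i * a, map_add' := mul_add _, map_smul' := ?_ },
    hfg, eq_zero_of_psi_mul_eq_zero hp, fun a => ?_⟩
  · intro f a
    simp only [psi_smul_def, RingHom.id_apply, ← mul_assoc]
    rw [(hv f i).eq]
  · simp only [psi_smul_def, LinearMap.coe_mk, AddHom.coe_mk, ← mul_assoc, ← Finset.sum_mul]
    rw [hsum, one_mul]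

theorem flat_right (θ : ℝ) : @Module.Flat OCstar (NCTorus θ) _ _ (psiRightModule θ) := by
  let : Module OCstar (NCTorus θ) := psiRightModule θ
  have hsmul : ∀ (f : OCstar) (a : NCTorus θ), f • a = a * psi θ f := fun _ _ => rfl
  refine Module.Flat.of_unimodular_factorization fun l f hf => ?_
  obtain ⟨p, hp, g, hfg, hg⟩ := OCstar.exists_unimodular_factorization hf
  obtain ⟨v, hv, hsum⟩ := exists_sum_psi_mul_eq_one θ hg
  refine ⟨p, g, fun i =>
    { toFun := fun a => a * v i, map_add' := fun a b => add_mul a b (v i), map_smul' := ?_ }, hfg, eq_zero_of_mul_psi_eq_zero hp, fun a => ?_⟩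
  · intro f a
    simp only [hsmul, RingHom.id_apply, mul_assoc]
    rw [(hv f i).eq]
  · simp only [hsmul, LinearMap.coe_mk, AddHom.coe_mk, mul_assoc, ← Finset.mul_sum]
    simp only [← fun i => (hv (g i) i).eq, hsum, mul_one]

end NCT

/-! ### Linear differential equations with entire coefficients. -/

section LinearODE

variable {E : Type*} [NormedAddCommGroup E] [NormedSpace ℂ E]

/-- Integrate along the segment t ↦ t x and compare with the primitive of c ‖x‖ⁿ⁺¹ tⁿ. The gained
factor 1 / (n + 1) produces the factorials in the Picard estimates. -/
theorem norm_le_of_hasDerivAt_of_norm_le {y g : ℂ → E} (h0 : y 0 = 0)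
    (hy : ∀ x, HasDerivAt y (g x) x) {R c : ℝ} (n : ℕ)
    (hg : ∀ x, ‖x‖ ≤ R → ‖g x‖ ≤ c * ‖x‖ ^ n) {x : ℂ} (hx : ‖x‖ ≤ R) :
    ‖y x‖ ≤ c * ‖x‖ ^ (n + 1) / (n + 1) := by
  have hline : ∀ t : ℝ, HasDerivAt (fun t : ℝ => y (t * x)) (x • g (t * x)) t := by
    intro t
    have h1 : HasDerivAt (fun t : ℝ => (t : ℂ) * x) x t := by
      simpa using (Complex.ofRealCLM.hasDerivAt (x := t)).mul_const x
    exact (hy (t * x)).scomp t h1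
  have hB : ∀ t : ℝ, HasDerivAt (fun t : ℝ => c * ‖x‖ ^ (n + 1) / (n + 1) * t ^ (n + 1))
      (c * ‖x‖ ^ (n + 1) * t ^ n) t := by
    intro t
    have h1 := (hasDerivAt_pow (n + 1) t).const_mul (c * ‖x‖ ^ (n + 1) / (n + 1))
    refine h1.congr_deriv ?_
    have : (n + 1 : ℝ) ≠ 0 := by positivity
    push_cast
    field_simp
  have := image_norm_le_of_norm_deriv_right_le_deriv_boundary (a := 0) (b := 1)
    (f := fun t : ℝ => y (t * x)) (f' := fun t => x • g (t * x))
    (fun t _ => (hline t).continuousAt.continuousWithinAt)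
    (fun t _ => (hline t).hasDerivWithinAt)
    (B := fun t : ℝ => c * ‖x‖ ^ (n + 1) / (n + 1) * t ^ (n + 1))
    (B' := fun t => c * ‖x‖ ^ (n + 1) * t ^ n) (by simp [h0]) hB
    (fun t ht => by
      have ht' : ‖(t : ℂ) * x‖ = t * ‖x‖ := by
        rw [norm_mul, Complex.norm_real, Real.norm_of_nonneg ht.1]
      have h2 : ‖(t : ℂ) * x‖ ≤ R := by
        rw [ht']
        exact (mul_le_of_le_one_left (norm_nonneg _) ht.2.le).trans hx
      have h3 := hg _ h2
      rw [ht'] at h3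
      rw [norm_smul]
      calc ‖x‖ * ‖g (t * x)‖ ≤ ‖x‖ * (c * (t * ‖x‖) ^ n) := by gcongr
        _ = c * ‖x‖ ^ (n + 1) * t ^ n := by ring)
    (Set.right_mem_Icc.mpr zero_le_one)
  simpa using this

/-- A linear differential equation with entire coefficients has entire solutions. -/
theorem exists_entire_solution [CompleteSpace E] {B : ℂ → E →L[ℂ] E} (hB : Differentiable ℂ B) (y₀ : E) :
    ∃ y : ℂ → E, y 0 = y₀ ∧ ∀ x, HasDerivAt y (B x (y x)) x := by
  have hprim : ∀ g : {g : ℂ → E // Differentiable ℂ g}, ∃ G : {G : ℂ → E // Differentiable ℂ G},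
      G.1 0 = 0 ∧ ∀ x, HasDerivAt G.1 (B x (g.1 x)) x := by
    intro g
    obtain ⟨G, h0, hG⟩ := (hB.clm_apply g.2).isExactOn_univ.with_val_at 0 0
    exact ⟨⟨G, fun x => (hG x trivial).differentiableAt⟩, h0, fun x => hG x trivial⟩
  choose prim hprim0 hprim' using hprim
  -- The `Y n` are the terms of the Picard series: Y₀ is constant, Yₙ₊₁' = B Yₙ, and Yₙ₊₁(0) = 0.
  let Y : ℕ → {y : ℂ → E // Differentiable ℂ y} :=
    fun n => Nat.rec ⟨fun _ => y₀, differentiable_const _⟩ (fun _ y => prim y) n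
  have hbound : ∀ R M : ℝ, (∀ x, ‖x‖ ≤ R → ‖B x‖ ≤ M) → ∀ n x, ‖x‖ ≤ R →
      ‖(Y n).1 x‖ ≤ M ^ n / n.factorial * ‖y₀‖ * ‖x‖ ^ n := by
    intro R M hM n
    induction n with
    | zero => intro x _; simp [Y]
    | succ n ih =>
      intro x hx
      have hM0 : 0 ≤ M := (norm_nonneg _).trans (hM x hx)
      have := norm_le_of_hasDerivAt_of_norm_le (hprim0 (Y n)) (hprim' (Y n)) (R := R)
        (c := M ^ (n + 1) / n.factorial * ‖y₀‖) n (fun z hz => by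
          calc ‖B z ((Y n).1 z)‖ ≤ ‖B z‖ * ‖(Y n).1 z‖ := (B z).le_opNorm _
            _ ≤ M * (M ^ n / n.factorial * ‖y₀‖ * ‖z‖ ^ n) :=
              mul_le_mul (hM z hz) (ih z hz) (norm_nonneg _) hM0
            _ = _ := by ring) hx
      refine this.trans (le_of_eq ?_)
      rw [Nat.factorial_succ]
      push_cast
      have : (n + 1 : ℝ) ≠ 0 := by positivity
      field_simp
  have hM : ∀ R : ℝ, ∃ M : ℝ, ∀ x, ‖x‖ ≤ R → ‖B x‖ ≤ M := by
    intro R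
    obtain ⟨M, hM⟩ := (isCompact_closedBall (0 : ℂ) R).exists_bound_of_continuousOn
      hB.continuous.continuousOn
    exact ⟨M, fun x hx => hM x (by simpa using hx)⟩
  have hbound' : ∀ R M : ℝ, (∀ x, ‖x‖ ≤ R → ‖B x‖ ≤ M) → ∀ n, ∀ x ∈ Metric.ball (0 : ℂ) R,
      ‖(Y n).1 x‖ ≤ (M * R) ^ n / n.factorial * ‖y₀‖ := by
    intro R M hM n x hx
    have hx' : ‖x‖ ≤ R := by simpa using (Metric.mem_ball.mp hx).le
    have hM0 : 0 ≤ M := (norm_nonneg _).trans (hM x hx')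
    calc ‖(Y n).1 x‖ ≤ M ^ n / n.factorial * ‖y₀‖ * ‖x‖ ^ n := hbound R M hM n x hx'
      _ ≤ M ^ n / n.factorial * ‖y₀‖ * R ^ n := by gcongr
      _ = _ := by rw [mul_pow]; ring
  have hsumm : ∀ R M : ℝ, Summable fun n : ℕ => (M * R) ^ n / n.factorial * ‖y₀‖ :=
    fun R M => (Real.summable_pow_div_factorial (M * R)).mul_right _
  have hY0 : ∀ n x, HasDerivAt (Y (n + 1)).1 (B x ((Y n).1 x)) x := fun n x => hprim' (Y n) x
  refine ⟨fun x => ∑' n, (Y n).1 x, ?_, fun x => ?_⟩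
  · change ∑' n, (Y n).1 0 = y₀
    refine tsum_eq_single 0 fun n hn => ?_
    obtain ⟨m, rfl⟩ := Nat.exists_eq_succ_of_ne_zero hn
    exact hprim0 (Y m)
  · obtain ⟨M, hM⟩ := hM (‖x‖ + 1)
    have hx : x ∈ Metric.ball (0 : ℂ) (‖x‖ + 1) := by simp
    have hd : DifferentiableAt ℂ (fun x => ∑' n, (Y n).1 x) x :=
      (Complex.differentiableOn_tsum_of_summable_norm (hsumm (‖x‖ + 1) M)
        (fun n => (Y n).2.differentiableOn) Metric.isOpen_ball (hbound' _ M hM)).differentiableAt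
        (Metric.isOpen_ball.mem_nhds hx)
    have hs := Complex.hasSum_deriv_of_summable_norm (hsumm (‖x‖ + 1) M)
        (fun n => (Y n).2.differentiableOn) Metric.isOpen_ball (hbound' _ M hM) hx
    have hs1 : Summable fun n => (Y n).1 x :=
      Summable.of_norm_bounded (hsumm (‖x‖ + 1) M) fun n => hbound' _ M hM n x hx
    have hs2 := hs1.hasSum.mapL (B x)
    have h0 : deriv (Y 0).1 x = 0 := by
      change deriv (fun _ => y₀) x = 0
      simp
    -- The derivative of the constant term Y₀ vanishes; dropping it aligns Yₙ₊₁' with B Yₙ.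
    have hs3 : HasSum (fun n => deriv (Y (n + 1)).1 x) (deriv (fun x => ∑' n, (Y n).1 x) x) := by
      have := (hasSum_nat_add_iff' 1).mpr hs
      simpa [h0] using this
    simp only [(hY0 _ x).deriv] at hs3
    rw [← hs3.unique hs2]
    exact hd.hasDerivAt

end LinearODE

/-! ### Floquet theory and logarithms in a Banach algebra. -/

section BanachAlgebra

variable {𝔸 : Type*} [NormedRing 𝔸] [NormedAlgebra ℂ 𝔸] [CompleteSpace 𝔸]

theorem NormedSpace.exp_add_of_commute_complex {x y : 𝔸} (h : Commute x y) :
    exp (x + y) = exp x * exp y := by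
  let := NormedAlgebra.restrictScalars ℚ ℂ 𝔸
  exact exp_add_of_commute h

/-- A periodic linear differential equation becomes constant after a periodic gauge
transformation. -/
theorem exists_periodic_gauge [IsDedekindFiniteMonoid 𝔸] {A : ℂ → 𝔸} (hA : Differentiable ℂ A)
    (hper : Function.Periodic A 1) :
    ∃ T : 𝔸ˣ, ∀ K : 𝔸, NormedSpace.exp K * T = 1 → ∃ P Q : ℂ → 𝔸,
      Differentiable ℂ Q ∧ Function.Periodic P 1 ∧ Function.Periodic Q 1 ∧
      (∀ x, P x * Q x = 1) ∧ (∀ x, Q x * P x = 1) ∧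
      ∀ x, HasDerivAt P (K * P x - P x * A x) x := by
  obtain ⟨Φ, hΦ0, hΦ⟩ := exists_entire_solution (E := 𝔸)
    (B := fun x => -(ContinuousLinearMap.mul ℂ 𝔸).flip (A x))
    (((ContinuousLinearMap.mul ℂ 𝔸).flip.differentiable.comp hA).neg) 1
  obtain ⟨Ψ, hΨ0, hΨ⟩ := exists_entire_solution (E := 𝔸)
    (B := fun x => ContinuousLinearMap.mul ℂ 𝔸 (A x))
    ((ContinuousLinearMap.mul ℂ 𝔸).differentiable.comp hA) 1
  replace hΦ : ∀ x, HasDerivAt Φ (-(Φ x * A x)) x := fun x => by simpa using hΦ x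
  replace hΨ : ∀ x, HasDerivAt Ψ (A x * Ψ x) x := fun x => by simpa using hΨ x
  have hshift : ∀ x, HasDerivAt (fun x => Φ (x + 1)) (-(Φ (x + 1) * A x)) x := fun x => by
    have := (hΦ (x + 1)).comp_add_const x 1
    rwa [hper] at this
  -- The product with Ψ is constant for every solution of the equation of Φ. Applied to Φ it gives Φ
  -- Ψ = 1; applied to the shifted solution it gives the monodromy relation Φ(x + 1) = Φ(1) Φ(x).
  have hconst : ∀ F : ℂ → 𝔸, (∀ x, HasDerivAt F (-(F x * A x)) x) → ∀ x, F x * Ψ x = F 0 := by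
    intro F hF x
    have h1 : ∀ x, HasDerivAt (fun x => F x * Ψ x) 0 x := fun x => by
      refine ((hF x).mul (hΨ x)).congr_deriv ?_
      noncomm_ring
    have h2 := is_const_of_deriv_eq_zero (fun x => (h1 x).differentiableAt)
      (fun x => (h1 x).deriv) x 0
    simpa [hΨ0] using h2
  have hΦΨ : ∀ x, Φ x * Ψ x = 1 := fun x => by rw [hconst Φ hΦ, hΦ0]
  have hΨΦ : ∀ x, Ψ x * Φ x = 1 := fun x => mul_eq_one_symm (hΦΨ x)
  have hT : ∀ x, Φ (x + 1) = Φ 1 * Φ x := fun x => by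
    have := hconst _ hshift x
    rw [zero_add] at this
    rw [← this, mul_assoc, hΨΦ, mul_one]
  refine ⟨⟨Φ 1, Ψ 1, hΦΨ 1, hΨΦ 1⟩, fun K hK => ?_⟩
  have hexp : ∀ x : ℂ, NormedSpace.exp ((-x) • K) * NormedSpace.exp (x • K) = 1 := fun x => by
    rw [← NormedSpace.exp_add_of_commute_complex, neg_smul, neg_add_cancel, NormedSpace.exp_zero]
    exact ((Commute.refl K).smul_left _).smul_right _
  -- The factor exp(xK) cancels the monodromy because exp(K) Φ(1) = 1; this makes P periodic.
  let P : ℂ → 𝔸 := fun x => NormedSpace.exp (x • K) * Φ x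
  let Q : ℂ → 𝔸 := fun x => Ψ x * NormedSpace.exp ((-x) • K)
  have hQP : ∀ x, Q x * P x = 1 := fun x => by
    simp only [Q, P]
    rw [mul_assoc, ← mul_assoc _ _ (Φ x), hexp, one_mul, hΨΦ]
  have hPQ : ∀ x, P x * Q x = 1 := fun x => mul_eq_one_symm (hQP x)
  have hP : Function.Periodic P 1 := fun x => by
    simp only [P]
    rw [add_smul, one_smul, NormedSpace.exp_add_of_commute_complex
      ((Commute.refl K).smul_left _), hT, mul_assoc, ← mul_assoc (NormedSpace.exp K)]
    change _ * (NormedSpace.exp K * Φ 1 * Φ x) = _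
    rw [show NormedSpace.exp K * Φ 1 = 1 from hK, one_mul]
  refine ⟨P, Q, fun x => ?_, hP, fun x => ?_, hPQ, hQP, fun x => ?_⟩
  · refine (hΨ x).differentiableAt.mul ?_
    have h1 := (hasDerivAt_exp_smul_const (𝕂 := ℂ) (-K) x).differentiableAt
    simpa only [smul_neg, ← neg_smul] using h1
  · rw [← mul_one (Q (x + 1)), ← hPQ x, ← mul_assoc, ← hP x, hQP, one_mul]
  · refine ((hasDerivAt_exp_smul_const' (𝕂 := ℂ) K x).mul (hΦ x)).congr_deriv ?_
    simp only [P]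
    noncomm_ring

/-- The power series acts on w term by term. An element w of the algebra serves as eigenvector for
left multiplication. -/
theorem exp_mul_eq_smul {N w : 𝔸} {ν : ℂ} (h : N * w = ν • w) :
    NormedSpace.exp N * w = Complex.exp ν • w := by
  have h1 := (NormedSpace.exp_series_hasSum_exp' (𝕂 := ℂ) N).mul_right w
  have h2 := (NormedSpace.exp_series_hasSum_exp' (𝕂 := ℂ) ν).smul_const w
  have hp : ∀ n : ℕ, N ^ n * w = ν ^ n • w := by
    intro n
    induction n with
    | zero => simp
    | succ n ih => rw [pow_succ', mul_assoc, ih, mul_smul_comm, h, smul_smul, pow_succ]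
  rw [Complex.exp_eq_exp_ℂ]
  refine h1.unique ?_
  simpa only [smul_mul_assoc, hp, smul_smul, smul_eq_mul] using h2

/-- A logarithm of an element such that the segment from `1` to it consists of units. -/
theorem exists_exp_eq_of_segment {S : 𝔸} (hS : ∀ t ∈ Set.Icc (0 : ℝ) 1, IsUnit (1 + t • (S - 1))) :
    ∃ L : 𝔸, NormedSpace.exp L = S ∧ ∀ (w : 𝔸) (ν : ℂ), w ≠ 0 → L * w = ν • w → |ν.im| < Real.pi := by
  let γ : ℝ → 𝔸 := fun t => 1 + t • (S - 1)
  have hγ : Continuous γ := by fun_prop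
  let V : Set ℝ := {t | IsUnit (γ t)}
  have hV : IsOpen V := Units.isOpen.preimage hγ
  -- `D` is the logarithmic derivative of γ, so its integral `L` should be a logarithm of γ. The
  -- value 0 of `Ring.inverse` at non-units only occurs outside V, which contains [0, 1].
  let D : ℝ → 𝔸 := fun t => (S - 1) * Ring.inverse (γ t)
  have hDc : ContinuousOn D V := fun t ht => by
    obtain ⟨x, hx⟩ := id ht
    have h1 : ContinuousAt Ring.inverse (γ t) := by
      rw [← hx]; exact NormedRing.inverse_continuousAt x
    exact (continuousAt_const.mul (ContinuousAt.comp (f := γ) h1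
      hγ.continuousAt)).continuousWithinAt
  have hI : ∀ t ∈ Set.Icc (0 : ℝ) 1, Set.uIcc 0 t ⊆ V := fun t ht s hs => by
    rw [Set.uIcc_of_le ht.1] at hs
    exact hS s ⟨hs.1, hs.2.trans ht.2⟩
  have hint : ∀ t ∈ Set.Icc (0 : ℝ) 1, IntervalIntegrable D MeasureTheory.volume 0 t :=
    fun t ht => (hDc.mono (hI t ht)).intervalIntegrable
  let L : ℝ → 𝔸 := fun t => ∫ s in (0 : ℝ)..t, D s
  have hL : ∀ t ∈ Set.Icc (0 : ℝ) 1, HasDerivAt L (D t) t := fun t ht => by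
    have htV : t ∈ V := hI t ht Set.right_mem_uIcc
    exact intervalIntegral.integral_hasDerivAt_right (hint t ht)
      (hDc.stronglyMeasurableAtFilter hV t htV) (hDc.continuousAt (hV.mem_nhds htV))
  -- The values of L must commute with each other so that exp(-L s) factors as exp(-L t) exp(-(L s -
  -- L t)) and can be differentiated at t from the derivative of exp at 0.
  have hcomm_int : ∀ (a : 𝔸), (∀ s, Commute a (D s)) → ∀ t ∈ Set.Icc (0 : ℝ) 1,
      Commute a (L t) := fun a ha t ht => by
    have h1 := (ContinuousLinearMap.mul ℂ 𝔸 a).intervalIntegral_comp_comm (hint t ht)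
    have h2 := ((ContinuousLinearMap.mul ℂ 𝔸).flip a).intervalIntegral_comp_comm (hint t ht)
    simp only [ContinuousLinearMap.mul_apply', ContinuousLinearMap.flip_apply] at h1 h2
    change a * (∫ s in (0 : ℝ)..t, D s) = (∫ s in (0 : ℝ)..t, D s) * a
    rw [← h1, ← h2]
    exact intervalIntegral.integral_congr fun s _ => (ha s).eq
  have hcomm_D : ∀ a : 𝔸, Commute a S → ∀ s, Commute a (D s) := fun a ha s => by
    have h1 : Commute a (S - 1) := ha.sub_right (Commute.one_right a)
    refine h1.mul_right ?_
    have h2 : Commute a (γ s) := (Commute.one_right a).add_right (h1.smul_right s)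
    by_cases hu : IsUnit (γ s)
    · obtain ⟨x, hx⟩ := hu
      rw [← hx, Ring.inverse_unit]
      exact Commute.units_inv_right (hx ▸ h2)
    · rw [Ring.inverse_non_unit _ hu]
      exact Commute.zero_right a
  have hLS : ∀ t ∈ Set.Icc (0 : ℝ) 1, Commute (L t) S := fun t ht =>
    (hcomm_int S (hcomm_D S (Commute.refl S)) t ht).symm
  have hLL : ∀ t ∈ Set.Icc (0 : ℝ) 1, ∀ s ∈ Set.Icc (0 : ℝ) 1, Commute (L t) (L s) :=
    fun t ht s hs => hcomm_int (L t) (hcomm_D _ (hLS t ht)) s hs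
  have h0mem : (0 : ℝ) ∈ Set.Icc (0 : ℝ) 1 := Set.left_mem_Icc.mpr zero_le_one
  have h1mem : (1 : ℝ) ∈ Set.Icc (0 : ℝ) 1 := Set.right_mem_Icc.mpr zero_le_one
  have hγd : ∀ t, HasDerivAt γ (S - 1) t := fun t => by
    simpa [γ] using ((hasDerivAt_id t).smul_const (S - 1)).const_add 1
  -- This product has derivative zero on [0, 1] and equals 1 at t = 0, so exp(L t) = γ t there; at t
  -- = 1 this is S.
  let F : ℝ → 𝔸 := fun t => NormedSpace.exp (-L t) * γ t
  have hF : ∀ t ∈ Set.Icc (0 : ℝ) 1, HasDerivWithinAt F 0 (Set.Icc 0 1) t := fun t ht => by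
    have h1 : HasDerivAt (fun s => NormedSpace.exp (-(L s - L t))) (-D t) t := by
      have h2 : HasDerivAt (fun s => -(L s - L t)) (-D t) t := ((hL t ht).sub_const _).neg
      have := (hasFDerivAt_exp_zero (𝕂 := ℝ) (𝔸 := 𝔸)).comp_hasDerivAt_of_eq t h2 (by simp)
      refine this.congr_deriv ?_
      simp
    have h2 : HasDerivWithinAt (fun s => NormedSpace.exp (-L s))
        (NormedSpace.exp (-L t) * -D t) (Set.Icc 0 1) t := by
      refine (h1.const_mul (NormedSpace.exp (-L t))).hasDerivWithinAt.congr (fun s hs => ?_) ?_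
      · rw [← NormedSpace.exp_add_of_commute_complex]
        · congr 1; abel
        · exact (((hLL t ht s hs).sub_right (Commute.refl _)).neg_right).neg_left
      · simp
    refine (h2.mul (hγd t).hasDerivWithinAt).congr_deriv ?_
    have h3 : Ring.inverse (γ t) * γ t = 1 := Ring.inverse_mul_cancel _ (hS t ht)
    simp only [D]
    rw [mul_neg, neg_mul, mul_assoc, mul_assoc, h3, mul_one, neg_add_cancel]
  have hFconst : F 1 = F 0 := constant_of_has_deriv_right_zero
    (fun t ht => (hF t ht).continuousWithinAt)
    (fun t ht => (hF t ⟨ht.1, ht.2.le⟩).mono_of_mem_nhdsWithin (Icc_mem_nhdsGE_of_mem ht)) 1 h1mem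
  have hexp : NormedSpace.exp (L 1) = S := by
    have h1 : NormedSpace.exp (-L 1) * S = 1 := by simpa [F, γ, L] using hFconst
    have h2 : NormedSpace.exp (L 1) * NormedSpace.exp (-L 1) = 1 := by
      rw [← NormedSpace.exp_add_of_commute_complex (Commute.refl (L 1)).neg_right, add_neg_cancel,
        NormedSpace.exp_zero]
    calc _ = NormedSpace.exp (L 1) * (NormedSpace.exp (-L 1) * S) := by rw [h1, mul_one]
      _ = S := by rw [← mul_assoc, h2, one_mul]
  refine ⟨L 1, hexp, fun w ν hw hν => ?_⟩
  have hSw : S * w = Complex.exp ν • w := by rw [← hexp]; exact exp_mul_eq_smul hν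
  set κ := Complex.exp ν
  have hγw : ∀ t : ℝ, γ t * w = (1 + t • (κ - 1)) • w := fun t => by
    simp only [γ, add_mul, one_mul, smul_mul_assoc, sub_mul, hSw, add_smul, one_smul, sub_smul,
      smul_assoc]
  have hne : ∀ t ∈ Set.Icc (0 : ℝ) 1, 1 + t • (κ - 1) ≠ 0 := fun t ht h0 => by
    have := hγw t
    rw [h0, zero_smul] at this
    exact hw ((hS t ht).mul_right_eq_zero.mp this)
  -- If κ were a real r ≤ 0, the segment from 1 to κ would pass through 0 at t = 1 / (1 - r), and γ
  -- t would annihilate w.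
  have hκ : 1 + (κ - 1) ∈ Complex.slitPlane := by
    rw [add_sub_cancel, Complex.mem_slitPlane_iff_not_le_zero]
    intro hle
    obtain ⟨r, hr, hrκ⟩ : ∃ r : ℝ, r ≤ 0 ∧ κ = r := by
      rw [Complex.le_def] at hle
      exact ⟨κ.re, hle.1, Complex.ext rfl (by simpa using hle.2)⟩
    refine hne (1 - r)⁻¹ ⟨by rw [inv_nonneg]; linarith, inv_le_one_of_one_le₀ (by linarith)⟩ ?_
    have h1 : (1 - r : ℂ) ≠ 0 := by
      have : (1 - r : ℝ) ≠ 0 := by linarith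
      exact_mod_cast this
    rw [hrκ, Complex.real_smul]
    push_cast
    field_simp
    ring
  have hDw : ∀ t ∈ Set.Icc (0 : ℝ) 1, D t * w = ((κ - 1) * (1 + t • (κ - 1))⁻¹) • w :=
      fun t ht => by
    have h1 : Ring.inverse (γ t) * w = (1 + t • (κ - 1))⁻¹ • w := by
      have h2 : Ring.inverse (γ t) * (γ t * w) = w := by
        rw [← mul_assoc, Ring.inverse_mul_cancel _ (hS t ht), one_mul]
      rw [hγw, mul_smul_comm] at h2
      rw [eq_inv_smul_iff₀ (hne t ht), h2]
    simp only [D]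
    rw [mul_assoc, h1, mul_smul_comm, sub_mul, hSw, one_mul]
    nth_rewrite 2 [← one_smul ℂ w]
    rw [← sub_smul, smul_smul, mul_comm]
  -- On w the integral becomes the integral of the scalar logarithmic derivative, which is the
  -- principal logarithm. Hence ν is log κ itself, and not another branch.
  have hlog : L 1 * w = Complex.log κ • w := by
    have h1 := ((ContinuousLinearMap.mul ℂ 𝔸).flip w).intervalIntegral_comp_comm (hint 1 h1mem)
    simp only [ContinuousLinearMap.mul_apply', ContinuousLinearMap.flip_apply] at h1
    have h2 := Complex.log_eq_integral hκ
    rw [add_sub_cancel] at h2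
    change (∫ s in (0 : ℝ)..1, D s) * w = _
    rw [← h1, h2, ← intervalIntegral.integral_const_mul, ← intervalIntegral.integral_smul_const]
    refine intervalIntegral.integral_congr fun t ht => ?_
    rw [Set.uIcc_of_le zero_le_one] at ht
    exact hDw t ht
  have hνκ : ν = Complex.log κ := by
    have : (ν - Complex.log κ) • w = 0 := by rw [sub_smul, ← hν, hlog, sub_self]
    exact sub_eq_zero.mp ((smul_eq_zero.mp this).resolve_right hw)
  rw [add_sub_cancel, Complex.mem_slitPlane_iff_arg] at hκ
  rw [hνκ, Complex.log_im, abs_lt]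
  exact ⟨Complex.neg_pi_lt_arg κ, (Complex.arg_le_pi κ).lt_of_ne hκ.1⟩

/-- A logarithm of a unit whose spectrum does not meet a ray, together with the location of its
eigenvalues. -/
theorem exists_exp_eq_of_ray (T : 𝔸ˣ) (φ : ℝ)
    (hφ : ∀ r : ℝ, 0 < r → -(r * Complex.exp (φ * Complex.I)) ∉ spectrum ℂ (T : 𝔸)) :
    ∃ L : 𝔸, NormedSpace.exp L = T ∧
      ∀ (w : 𝔸) (ν : ℂ), w ≠ 0 → L * w = ν • w → |ν.im - φ| < Real.pi := by
  let e : ℂ := Complex.exp (φ * Complex.I)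
  have he : e ≠ 0 := Complex.exp_ne_zero _
  obtain ⟨L, hL, hL'⟩ := exists_exp_eq_of_segment (S := e⁻¹ • (T : 𝔸)) fun t ht => by
    rcases ht.1.eq_or_lt with rfl | h0
    · simp
    have h0' : (t : ℂ) ≠ 0 := by exact_mod_cast h0.ne'
    let r : ℝ := (1 - t) / t
    have hr : 0 ≤ r := div_nonneg (by linarith [ht.2]) h0.le
    -- After rotation by exp(-iφ), the segment point at t > 0 is a nonzero multiple of λ - T with λ
    -- = -r exp(iφ) and r = (1 - t) / t, a point of the excluded ray or 0.
    have key : (1 : 𝔸) + t • (e⁻¹ • (T : 𝔸) - 1)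
        = (-(t * e⁻¹ : ℂ)) • (algebraMap ℂ 𝔸 (-(r * e)) - T) := by
      have h1 : t • (e⁻¹ • (T : 𝔸) - 1) = (t : ℂ) • (e⁻¹ • (T : 𝔸) - 1) := (Complex.coe_smul t _).symm
      rw [h1, Algebra.algebraMap_eq_smul_one, smul_sub, smul_sub, smul_smul, smul_smul]
      have h2 : -(t * e⁻¹ : ℂ) * -(r * e) = 1 - t := by
        simp only [r]
        push_cast
        field_simp
      rw [h2]
      module
    rw [key]
    have hu : IsUnit (algebraMap ℂ 𝔸 (-(r * e)) - T) := by
      rcases hr.eq_or_lt with h | h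
      · simp [← h]
      · exact spectrum.notMem_iff.mp (hφ r h)
    exact hu.smul (Units.mk0 (-(t * e⁻¹ : ℂ)) (neg_ne_zero.mpr (mul_ne_zero h0' (inv_ne_zero he))))
  refine ⟨L + algebraMap ℂ 𝔸 (φ * Complex.I), ?_, fun w ν hw hν => ?_⟩
  · rw [NormedSpace.exp_add_of_commute_complex (Algebra.commutes _ _).symm, hL,
      ← NormedSpace.algebraMap_exp_comm, ← Complex.exp_eq_exp_ℂ, ← Algebra.commutes,
      ← Algebra.smul_def, smul_smul]
    change (e * e⁻¹) • (T : 𝔸) = T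
    rw [mul_inv_cancel₀ he, one_smul]
  · have := hL' w (ν - φ * Complex.I) hw (by
      rw [sub_smul, ← hν, add_mul, ← Algebra.smul_def, add_sub_cancel_right])
    simpa using this

end BanachAlgebra

/-! ### Choice of a ray, and the Sylvester equation. -/

theorem exists_ray_disjoint {Z : Set ℂ} (hZ : Z.Finite) :
    ∃ φ : ℝ, ∀ r : ℝ, 0 < r → -(r * Complex.exp (φ * Complex.I)) ∉ Z := by
  have hinf : (Set.Ioc (-Real.pi) Real.pi).Infinite :=
    Set.Ioc_infinite (by linarith [Real.pi_pos])
  obtain ⟨φ, hφ, hφZ⟩ := (hinf.sdiff (hZ.image fun z => Complex.arg (-z))).nonempty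
  refine ⟨φ, fun r hr hmem => hφZ ⟨_, hmem, ?_⟩⟩
  simp only [neg_neg]
  rw [Complex.exp_mul_I, Complex.arg_mul_cos_add_sin_mul_I hr hφ]

/-- F intertwines p(A) and p(B) for every polynomial p. For p the characteristic polynomial of B the
right side vanishes by Cayley–Hamilton, while p(A) is invertible since no eigenvalue of A is a root
of p. -/
theorem Matrix.eq_zero_of_mul_eq_mul {m n : Type*} [Fintype m] [DecidableEq m] [Fintype n]
    [DecidableEq n] {A : Matrix m m ℂ} {B : Matrix n n ℂ} {F : Matrix m n ℂ} (h : A * F = F * B)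
    (hAB : Disjoint (spectrum ℂ A) (spectrum ℂ B)) : F = 0 := by
  rcases isEmpty_or_nonempty m with hm | hm
  · ext i; exact hm.elim i
  have hp : ∀ p : Polynomial ℂ, Polynomial.aeval A p * F = F * Polynomial.aeval B p := by
    intro p
    induction p using Polynomial.induction_on' with
    | add p q hp hq => rw [map_add, map_add, Matrix.add_mul, Matrix.mul_add, hp, hq]
    | monomial k a =>
      have hk : A ^ k * F = F * B ^ k := by
        induction k with
        | zero => simp
        | succ k ih => rw [pow_succ, pow_succ, Matrix.mul_assoc, h, ← Matrix.mul_assoc, ih,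
            Matrix.mul_assoc]
      simp only [Polynomial.aeval_monomial, Algebra.algebraMap_eq_smul_one, smul_mul_assoc, one_mul,
        Matrix.smul_mul, Matrix.mul_smul, hk]
  have h0 := hp B.charpoly
  rw [Matrix.aeval_self_charpoly, Matrix.mul_zero] at h0
  have hu : IsUnit (Polynomial.aeval A B.charpoly) := by
    have hnot : (0 : ℂ) ∉ spectrum ℂ (Polynomial.aeval A B.charpoly) := by
      rw [spectrum.map_polynomial_aeval_of_nonempty _ _
        (spectrum.nonempty_of_isAlgClosed_of_finiteDimensional ℂ A)]
      rintro ⟨z, hz, hz0⟩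
      exact hAB.notMem_of_mem_left hz (Matrix.mem_spectrum_iff_isRoot_charpoly.mpr hz0)
    exact spectrum.zero_notMem_iff ℂ |>.mp hnot
  obtain ⟨x, hx⟩ := hu
  calc F = (↑x⁻¹ * (x : Matrix m m ℂ)) * F := by rw [Units.inv_mul, Matrix.one_mul]
    _ = 0 := by rw [hx, Matrix.mul_assoc, h0, Matrix.mul_zero]

/-! ### Constant connection matrices by Floquet theory on ℂ*. -/

namespace NCT

namespace OCstar

open Function.Periodic

/-- The pullback of `f` along `x ↦ exp (2 π i x)`. -/
noncomputable def pullback (f : OCstar) (x : ℂ) : ℂ := extendZero f.1 (qParam 1 x)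

theorem pullback_add (f g : OCstar) (x : ℂ) :
    pullback (f + g) x = pullback f x + pullback g x := by
  unfold pullback; rw [extendZero_add]; rfl

theorem pullback_mul (f g : OCstar) (x : ℂ) :
    pullback (f * g) x = pullback f x * pullback g x := by
  unfold pullback; rw [extendZero_mul]; rfl

theorem pullback_sub (f g : OCstar) (x : ℂ) :
    pullback (f - g) x = pullback f x - pullback g x := by
  rw [eq_sub_iff_add_eq, ← pullback_add, sub_add_cancel]

theorem pullback_algebraMap (c x : ℂ) : pullback (algebraMap ℂ OCstar c) x = c := by
  unfold pullback; rw [extendZero_of_ne _ (qParam_ne_zero x)]; rfl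

theorem pullback_sum {ι : Type*} (s : Finset ι) (f : ι → OCstar) (x : ℂ) :
    pullback (∑ i ∈ s, f i) x = ∑ i ∈ s, pullback (f i) x := by
  classical
  induction s using Finset.induction_on with
  | empty => simpa using pullback_algebraMap 0 x
  | insert i s hi ih => rw [Finset.sum_insert hi, Finset.sum_insert hi, pullback_add, ih]

theorem pullback_injective {f g : OCstar} (h : ∀ x, pullback f x = pullback g x) : f = g := by
  ext z
  have := h (invQParam 1 z)
  unfold pullback at this
  rwa [qParam_right_inv one_ne_zero z.ne_zero, extendZero_coe, extendZero_coe] at this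

theorem hasDerivAt_qParam (x : ℂ) :
    HasDerivAt (qParam 1) (2 * Real.pi * Complex.I * qParam 1 x) x := by
  have h1 : HasDerivAt (fun z : ℂ => 2 * Real.pi * Complex.I * z / (1 : ℝ))
      (2 * Real.pi * Complex.I) x := by
    simpa using (hasDerivAt_id x).const_mul (2 * Real.pi * Complex.I : ℂ)
  exact h1.cexp.congr_deriv (mul_comm _ _)

theorem hasDerivAt_pullback (f : OCstar) (x : ℂ) :
    HasDerivAt (pullback f) (2 * Real.pi * Complex.I * pullback (eulerDer f) x) x := by
  have hq := qParam_ne_zero (h := 1) x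
  refine ((f.differentiableAt hq).hasDerivAt.comp x (hasDerivAt_qParam x)).congr_deriv ?_
  unfold pullback
  rw [extendZero_of_ne (eulerDer f).1 hq]
  change _ = 2 * Real.pi * Complex.I * (qParam 1 x * deriv (extendZero f.1) (qParam 1 x))
  ring

theorem pullback_periodic (f : OCstar) : Function.Periodic (pullback f) 1 := by
  intro x
  unfold pullback
  congr 1
  unfold qParam
  rw [Complex.ofReal_one, div_one, div_one, mul_add, mul_one, Complex.exp_add,
    Complex.exp_two_pi_mul_I, mul_one]

/-- A periodic entire function descends along x ↦ exp(2πix). The value of `cuspFunction` at the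
origin plays no role, since only its restriction to ℂ* is kept. -/
theorem exists_pullback_eq {p : ℂ → ℂ} (hp : Differentiable ℂ p) (hper : Function.Periodic p 1) :
    ∃ f : OCstar, ∀ x, pullback f x = p x := by
  have hper' : Function.Periodic p ((1 : ℝ) : ℂ) := by simpa using hper
  have hd : DifferentiableOn ℂ (cuspFunction 1 p) {0}ᶜ := fun z hz => by
    rw [← qParam_right_inv one_ne_zero hz]
    exact (differentiableAt_cuspFunction one_ne_zero hper'
      (hp (invQParam 1 z))).differentiableWithinAt
  refine ⟨⟨fun z => cuspFunction 1 p z, isHolomorphic_of hd fun _ => rfl⟩, fun x => ?_⟩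
  unfold pullback
  rw [extendZero_of_ne _ (qParam_ne_zero x)]
  exact eq_cuspFunction one_ne_zero hper' x

end OCstar

/-- Under the pullback z d/dz corresponds to (2πi)⁻¹ d/dx, so δ corresponds to (τ / 2πi) d/dx. -/
theorem two_pi_I_mul_delta_eq {τ : ℂ} {f g : OCstar}
    (h : ∀ x, HasDerivAt f.pullback ((2 * Real.pi * Complex.I / τ) * g.pullback x) x) (hτ : τ ≠ 0) :
    delta τ f = g := by
  refine OCstar.pullback_injective fun x => ?_
  have h2 : (2 * Real.pi * Complex.I : ℂ) ≠ 0 := Complex.two_pi_I_ne_zero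
  have h1 := (f.hasDerivAt_pullback x).unique (h x)
  have h3 : delta τ f = algebraMap ℂ OCstar τ * eulerDer f := by
    change τ • eulerDer f = _
    rw [Algebra.smul_def]
  rw [h3, OCstar.pullback_mul, OCstar.pullback_algebraMap]
  field_simp at h1
  rw [mul_comm]
  exact h1

theorem delta_algebraMap (τ c : ℂ) : delta τ (algebraMap ℂ OCstar c) = 0 :=
  Derivation.map_algebraMap _ _

-- Floquet theory is applied to the pullback of (2πi / τ) A. Its equation P' = K P - P B, multiplied
-- by τ / 2πi, is the gauge identity, and the periodicity of P and its inverse lets both descend to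
-- matrices over O(ℂ*).
open scoped Matrix.Norms.Operator in
theorem exists_matrix_gauge {τ : ℂ} (hτ : τ ≠ 0) {n : ℕ} (A : Matrix (Fin n) (Fin n) OCstar) :
    ∃ T : (Matrix (Fin n) (Fin n) ℂ)ˣ, ∀ K : Matrix (Fin n) (Fin n) ℂ, NormedSpace.exp K * T = 1 →
      ∃ P : Matrix (Fin n) (Fin n) OCstar, IsUnit P ∧
        P.map (delta τ) + P * A
          = (algebraMap ℂ OCstar).mapMatrix ((τ / (2 * Real.pi * Complex.I)) • K) * P := by
  have h2 : (2 * Real.pi * Complex.I : ℂ) ≠ 0 := Complex.two_pi_I_ne_zero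
  let c : ℂ := 2 * Real.pi * Complex.I / τ
  have hc : c ≠ 0 := div_ne_zero h2 hτ
  -- Writing the matrix through elementary matrices reduces its differentiability to that of the
  -- entries.
  let B : ℂ → Matrix (Fin n) (Fin n) ℂ := fun x => ∑ i, ∑ j, Matrix.single i j (c * (A i j).pullback x)
  have hBapp : ∀ x i j, B x i j = c * (A i j).pullback x := fun x i j => by
    have := Matrix.matrix_eq_sum_single (Matrix.of fun i j => c * (A i j).pullback x)
    exact (congrFun (congrFun this i) j).symm
  have hB : Differentiable ℂ B := by
    refine Differentiable.fun_sum fun i _ => Differentiable.fun_sum fun j _ => ?_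
    exact (LinearMap.toContinuousLinearMap (Matrix.singleLinearMap ℂ i j)).differentiable.comp
      (Differentiable.const_mul (fun x => ((A i j).hasDerivAt_pullback x).differentiableAt) c)
  have hBper : Function.Periodic B 1 := fun x => by
    ext i j
    rw [hBapp, hBapp, (A i j).pullback_periodic]
  obtain ⟨T, hT⟩ := exists_periodic_gauge hB hBper
  refine ⟨T, fun K hK => ?_⟩
  obtain ⟨P, Q, hQ, hPper, hQper, hPQ, hQP, hP⟩ := hT K hK
  have hentry : ∀ i j, ∀ {F : ℂ → Matrix (Fin n) (Fin n) ℂ} {F' x}, HasDerivAt F F' x →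
      HasDerivAt (fun x => F x i j) (F' i j) x := fun i j F F' x h =>
    (LinearMap.toContinuousLinearMap (Matrix.entryLinearMap ℂ ℂ i j)).hasFDerivAt.comp_hasDerivAt x h
  choose P' hP' using fun i j => OCstar.exists_pullback_eq
    (p := fun x => P x i j) (fun x => (hentry i j (hP x)).differentiableAt)
    (fun x => congrFun (congrFun (hPper x) i) j)
  choose Q' hQ' using fun i j => OCstar.exists_pullback_eq
    (p := fun x => Q x i j) (fun x => (hentry i j (hQ x).hasDerivAt).differentiableAt)
    (fun x => congrFun (congrFun (hQper x) i) j)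
  have hmul : ∀ (F G : ℂ → Matrix (Fin n) (Fin n) ℂ) (F' G' : Fin n → Fin n → OCstar),
      (∀ i j x, (F' i j).pullback x = F x i j) → (∀ i j x, (G' i j).pullback x = G x i j) →
      (∀ x, F x * G x = 1) → Matrix.of F' * Matrix.of G' = 1 := by
    intro F G F' G' hF hG hFG
    ext1 i j
    refine OCstar.pullback_injective fun x => ?_
    have h1 : ((1 : Matrix (Fin n) (Fin n) OCstar) i j)
        = algebraMap ℂ OCstar ((1 : Matrix (Fin n) (Fin n) ℂ) i j) := by
      rw [Matrix.one_apply, Matrix.one_apply]; split_ifs <;> simp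
    rw [Matrix.mul_apply, OCstar.pullback_sum, h1, OCstar.pullback_algebraMap, ← hFG x,
      Matrix.mul_apply]
    simp only [OCstar.pullback_mul, Matrix.of_apply, hF, hG]
  refine ⟨Matrix.of P', ⟨⟨_, Matrix.of Q', hmul P Q P' Q' hP' hQ' hPQ,
    hmul Q P Q' P' hQ' hP' hQP⟩, rfl⟩, ?_⟩
  ext1 i j
  rw [Matrix.add_apply, Matrix.map_apply, Matrix.of_apply, ← eq_sub_iff_add_eq]
  refine two_pi_I_mul_delta_eq (fun x => ?_) hτ
  have hfun : (P' i j).pullback = fun x => P x i j := funext (hP' i j)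
  rw [hfun]
  refine (hentry i j (hP x)).congr_deriv ?_
  rw [OCstar.pullback_sub, Matrix.mul_apply, Matrix.mul_apply, OCstar.pullback_sum, OCstar.pullback_sum, Matrix.sub_apply,
    Matrix.mul_apply, Matrix.mul_apply]
  simp only [OCstar.pullback_mul, Matrix.of_apply, hP', hBapp, RingHom.mapMatrix_apply,
    Matrix.map_apply, OCstar.pullback_algebraMap, Matrix.smul_apply, smul_eq_mul]
  rw [mul_sub, Finset.mul_sum, Finset.mul_sum]
  congr 1
  · refine Finset.sum_congr rfl fun k _ => ?_
    field_simp
  · refine Finset.sum_congr rfl fun k _ => ?_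
    simp only [c]
    ring

/-- Repeating an eigenvector in every column turns it into an element of the matrix algebra, the
form of eigenvector used for the logarithm. -/
theorem exists_mul_eq_smul_of_mem_spectrum {n : ℕ} {K : Matrix (Fin n) (Fin n) ℂ} {ν : ℂ}
    (h : ν ∈ spectrum ℂ K) : ∃ w : Matrix (Fin n) (Fin n) ℂ, w ≠ 0 ∧ K * w = ν • w := by
  have hdet : (algebraMap ℂ (Matrix (Fin n) (Fin n) ℂ) ν - K).det = 0 := by
    by_contra h0
    exact h ((Matrix.isUnit_iff_isUnit_det _).mpr (isUnit_iff_ne_zero.mpr h0))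
  obtain ⟨v, hv, hv0⟩ := Matrix.exists_mulVec_eq_zero_iff.mpr hdet
  obtain ⟨i, hi⟩ := Function.ne_iff.mp hv
  refine ⟨Matrix.of fun a _ => v a, fun h0 => hi (congrFun (congrFun h0 i) i), ?_⟩
  have hKv : K.mulVec v = ν • v := by
    rw [Matrix.sub_mulVec, sub_eq_zero, Algebra.algebraMap_eq_smul_one, Matrix.smul_mulVec,
      Matrix.one_mulVec] at hv0
    exact hv0.symm
  ext a b
  exact congrFun hKv a

/-- The eigenvalues of `K` have imaginary part in the open strip of width `2 π` around `φ`. -/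
def SpectrumInStrip {n : ℕ} (φ : ℝ) (K : Matrix (Fin n) (Fin n) ℂ) : Prop :=
  ∀ ν ∈ spectrum ℂ K, |ν.im - φ| < Real.pi

-- The finite set Z is the spectrum of the inverse monodromy and is fixed before φ. Two objects can
-- therefore be treated with the same φ, by avoiding both sets.
open scoped Matrix.Norms.Operator in
theorem exists_matrix_gauge_strip {τ : ℂ} (hτ : τ ≠ 0) {n : ℕ}
    (A : Matrix (Fin n) (Fin n) OCstar) :
    ∃ Z : Set ℂ, Z.Finite ∧ ∀ φ : ℝ, (∀ r : ℝ, 0 < r → -(r * Complex.exp (φ * Complex.I)) ∉ Z) →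
      ∃ K : Matrix (Fin n) (Fin n) ℂ, SpectrumInStrip φ K ∧
      ∃ P : Matrix (Fin n) (Fin n) OCstar, IsUnit P ∧
        P.map (delta τ) + P * A
          = (algebraMap ℂ OCstar).mapMatrix ((τ / (2 * Real.pi * Complex.I)) • K) * P := by
  obtain ⟨T, hT⟩ := exists_matrix_gauge hτ A
  refine ⟨spectrum ℂ (T⁻¹ : (Matrix (Fin n) (Fin n) ℂ)ˣ).val, Matrix.finite_spectrum _,
    fun φ hφ => ?_⟩
  obtain ⟨K, hK, hK'⟩ := exists_exp_eq_of_ray T⁻¹ φ hφ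
  refine ⟨K, fun ν hν => ?_, hT K ((congrArg (· * T.val) hK).trans (Units.inv_mul T))⟩
  obtain ⟨w, hw, hw'⟩ := exists_mul_eq_smul_of_mem_spectrum hν
  exact hK' w ν hw hw'

/-- Every object has a basis with a constant connection matrix. -/
theorem BqTau.exists_constant_basis {θ : ℝ} {τ : ℂ} (hτ : τ ≠ 0) (X : BqTau.{u} θ τ) :
    ∃ (n : ℕ) (Z : Set ℂ), Z.Finite ∧
      ∀ φ : ℝ, (∀ r : ℝ, 0 < r → -(r * Complex.exp (φ * Complex.I)) ∉ Z) →
      ∃ K : Matrix (Fin n) (Fin n) ℂ, SpectrumInStrip φ K ∧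
      ∃ e : Module.Basis (Fin n) OCstar X.carrier, ∀ i, X.nabla (e i)
        = ∑ j, algebraMap ℂ OCstar (τ / (2 * Real.pi * Complex.I) * K i j) • e j := by
  obtain ⟨n, e, -⟩ := X.regularSingular
  obtain ⟨Z, hZ, hg⟩ := exists_matrix_gauge_strip hτ (Matrix.of fun i j => e.repr (X.nabla (e i)) j)
  refine ⟨n, Z, hZ, fun φ hφ => ?_⟩
  obtain ⟨K, hK, P, hP, hPK⟩ := hg φ hφ
  have hdet : IsUnit P.transpose.det := by
    rw [Matrix.det_transpose]; exact (Matrix.isUnit_iff_isUnit_det P).mp hP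
  have he' : ∀ i, (e.map (Matrix.toLinearEquiv e P.transpose hdet)) i = ∑ j, P i j • e j := by
    intro i
    rw [Module.Basis.map_apply, Matrix.toLinearEquiv_apply, Matrix.toLin_self]
    rfl
  refine ⟨K, hK, e.map (Matrix.toLinearEquiv e P.transpose hdet), fun i => ?_⟩
  simp only [he', map_sum, X.nabla_smul, Finset.smul_sum, smul_smul]
  have h1 : ∀ j, X.nabla (e j) = ∑ k, e.repr (X.nabla (e j)) k • e k :=
    fun j => (e.sum_repr _).symm
  -- In the basis P e the connection is ∇(P e) = (δP + P A) e, which the gauge identity turns into a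
  -- constant matrix times P e.
  have h2 : ∀ k, delta τ (P i k) + ∑ j, P i j * e.repr (X.nabla (e j)) k
      = ∑ j, algebraMap ℂ OCstar (τ / (2 * Real.pi * Complex.I) * K i j) * P j k := by
    intro k
    have := congrFun (congrFun hPK i) k
    simpa [Matrix.add_apply, Matrix.mul_apply] using this
  rw [Finset.sum_comm (s := Finset.univ (α := Fin n))]
  simp only [← Finset.sum_smul, ← h2, add_smul, Finset.sum_add_distrib]
  rw [add_comm]
  congr 1
  simp_rw [Finset.sum_smul]
  rw [Finset.sum_comm]
  refine Finset.sum_congr rfl fun j _ => ?_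
  conv_lhs => rw [h1 j, Finset.smul_sum]
  simp only [smul_smul]

end NCT

/-! ### Morphisms have constant matrices; adapted bases. -/

/-- A complement of the kernel maps isomorphically onto the range, so one of its bases serves on
both sides. -/
theorem LinearMap.exists_adapted_bases {V W : Type*} [AddCommGroup V] [Module ℂ V]
    [FiniteDimensional ℂ V] [AddCommGroup W] [Module ℂ W] [FiniteDimensional ℂ W] (F : V →ₗ[ℂ] W) :
    ∃ (k r g : ℕ) (b : Module.Basis (Fin k ⊕ Fin r) ℂ V) (b' : Module.Basis (Fin r ⊕ Fin g) ℂ W),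
      (∀ i, F (b (Sum.inl i)) = 0) ∧ ∀ i, F (b (Sum.inr i)) = b' (Sum.inl i) := by
  obtain ⟨C, hC⟩ := Submodule.exists_isCompl (LinearMap.ker F)
  obtain ⟨D, hD⟩ := Submodule.exists_isCompl (LinearMap.range F)
  refine ⟨_, _, _, ((Module.finBasis ℂ (LinearMap.ker F)).prod (Module.finBasis ℂ C)).map
      (Submodule.prodEquivOfIsCompl _ _ hC),
    (((Module.finBasis ℂ C).map (F.kerComplementEquivRange hC.symm)).prod
      (Module.finBasis ℂ D)).map (Submodule.prodEquivOfIsCompl _ _ hD), fun i => ?_, fun i => ?_⟩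
  · simp
  · simp

namespace NCT

theorem laurentCoeff_sum {ι : Type*} (s : Finset ι) (f : ι → OCstar) (n : ℤ) :
    laurentCoeff (∑ i ∈ s, f i) n = ∑ i ∈ s, laurentCoeff (f i) n := by
  classical
  induction s using Finset.induction_on with
  | empty => simpa using laurentCoeff_const 0 n
  | insert i s hi ih => rw [Finset.sum_insert hi, Finset.sum_insert hi, laurentCoeff_add, ih]

theorem laurentCoeff_algebraMap_mul (c : ℂ) (f : OCstar) (n : ℤ) :
    laurentCoeff (algebraMap ℂ OCstar c * f) n = c * laurentCoeff f n := by
  rw [← Algebra.smul_def, laurentCoeff_smul]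

theorem laurentCoeff_delta (τ : ℂ) (f : OCstar) (n : ℤ) :
    laurentCoeff (delta τ f) n = τ * n * laurentCoeff f n := by
  change laurentCoeff (τ • eulerDer f) n = _
  rw [laurentCoeff_smul, laurentCoeff_eulerDer, mul_assoc]

theorem OCstar.eq_algebraMap_of_laurentCoeff {f : OCstar} (h : ∀ n ≠ 0, laurentCoeff f n = 0) :
    f = algebraMap ℂ OCstar (laurentCoeff f 0) := by
  have : f + algebraMap ℂ OCstar (-laurentCoeff f 0) = 0 := by
    refine eq_zero_of_laurentCoeff fun n => ?_
    rw [laurentCoeff_add, laurentCoeff_const]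
    by_cases hn : n = 0
    · simp [hn]
    · simp [hn, h n hn]
  rw [map_neg, ← sub_eq_add_neg] at this
  exact sub_eq_zero.mp this

section ConstSection

variable {M N : Type*} [AddCommGroup M] [Module OCstar M] [AddCommGroup N] [Module OCstar N]
  {n m : ℕ}

/-- The combination of the basis `e` with constant coefficients `v`. -/
noncomputable def constSection (e : Module.Basis (Fin n) OCstar M) (v : Fin n → ℂ) : M :=
  ∑ i, algebraMap ℂ OCstar (v i) • e i

/-- A basis identifies M with O(ℂ*) ⊗ ℂⁿ, and bases of ℂⁿ extend by scalars. The expansion of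
constant sections shows that a change to such a basis keeps constant matrices constant. -/
theorem exists_basis_constSection (e : Module.Basis (Fin n) OCstar M) {κ : Type*} [Fintype κ]
    (b : Module.Basis κ ℂ (Fin n → ℂ)) :
    ∃ b' : Module.Basis κ OCstar M, (∀ k, b' k = constSection e (b k)) ∧
      ∀ v, constSection e v = ∑ k, algebraMap ℂ OCstar (b.repr v k) • b' k := by
  let E := ((Pi.basisFun ℂ (Fin n)).baseChange OCstar).equiv e (Equiv.refl _)
  have hE : ∀ v, E (1 ⊗ₜ v) = constSection e v := by
    intro v
    conv_lhs => rw [← (Pi.basisFun ℂ (Fin n)).sum_repr v]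
    rw [TensorProduct.tmul_sum, map_sum]
    refine Finset.sum_congr rfl fun i _ => ?_
    rw [← TensorProduct.smul_tmul, Algebra.smul_def, mul_one, ← mul_one (algebraMap _ _ _),
      ← smul_eq_mul, ← TensorProduct.smul_tmul', map_smul, ← Module.Basis.baseChange_apply,
      Module.Basis.equiv_apply]
    simp
  have hb : ∀ k, ((b.baseChange OCstar).map E) k = constSection e (b k) := fun k => by
    rw [Module.Basis.map_apply, Module.Basis.baseChange_apply, hE]
  refine ⟨(b.baseChange OCstar).map E, hb, fun v => ?_⟩
  conv_lhs => rw [← b.sum_repr v]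
  simp only [hb, constSection, Finset.sum_apply, Pi.smul_apply, smul_eq_mul, map_sum, map_mul,
    Finset.smul_sum, Finset.sum_smul, smul_smul]
  exact Finset.sum_comm

/-- T is only required to commute with constants, so that the lemma covers both morphisms and
connections. Coefficients are row vectors, in accordance with ∇ e_i = ∑ A_ij e_j. -/
theorem map_constSection {e : Module.Basis (Fin n) OCstar M} {e' : Module.Basis (Fin m) OCstar N}
    (T : M →+ N) (hT : ∀ (c : ℂ) x, T (algebraMap ℂ OCstar c • x) = algebraMap ℂ OCstar c • T x)
    {F : Matrix (Fin n) (Fin m) ℂ} (hF : ∀ i, T (e i) = ∑ j, algebraMap ℂ OCstar (F i j) • e' j)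
    (v : Fin n → ℂ) : T (constSection e v) = constSection e' (F.vecMulLinear v) := by
  simp only [constSection, map_sum, hT, hF, Finset.smul_sum, smul_smul, Matrix.vecMulLinear_apply,
    Matrix.vecMul, dotProduct, Finset.sum_smul, map_mul]
  exact Finset.sum_comm

end ConstSection

namespace BqTau

variable {θ : ℝ} {τ : ℂ}

theorem nabla_algebraMap_smul (X : BqTau.{u} θ τ) (c : ℂ) (m : X.carrier) :
    X.nabla (algebraMap ℂ OCstar c • m) = algebraMap ℂ OCstar c • X.nabla m := by
  rw [X.nabla_smul, delta_algebraMap, zero_smul, add_zero]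

/-- Comparing Laurent coefficients in f ∇ = ∇ f gives K G_k = G_k (K' + 2πik). The common strip
makes the spectra disjoint for k ≠ 0, which leaves only the coefficient G_0. -/
theorem exists_constant_matrix (hτ : τ ≠ 0) {X Y : BqTau.{u} θ τ} (f : X ⟶ Y) {n m : ℕ} {φ : ℝ}
    {K : Matrix (Fin n) (Fin n) ℂ} {K' : Matrix (Fin m) (Fin m) ℂ} (hK : SpectrumInStrip φ K)
    (hK' : SpectrumInStrip φ K') (e : Module.Basis (Fin n) OCstar X.carrier)
    (e' : Module.Basis (Fin m) OCstar Y.carrier)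
    (he : ∀ i, X.nabla (e i)
      = ∑ j, algebraMap ℂ OCstar (τ / (2 * Real.pi * Complex.I) * K i j) • e j)
    (he' : ∀ i, Y.nabla (e' i)
      = ∑ j, algebraMap ℂ OCstar (τ / (2 * Real.pi * Complex.I) * K' i j) • e' j) :
    ∃ F : Matrix (Fin n) (Fin m) ℂ, ∀ i,
      Hom.lin f (e i) = ∑ j, algebraMap ℂ OCstar (F i j) • e' j := by
  have h2 : (2 * Real.pi * Complex.I : ℂ) ≠ 0 := Complex.two_pi_I_ne_zero
  let c : ℂ := τ / (2 * Real.pi * Complex.I)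
  have hc : c ≠ 0 := div_ne_zero hτ h2
  let G : Fin n → Fin m → OCstar := fun i j => e'.repr (Hom.lin f (e i)) j
  have hG : ∀ i, Hom.lin f (e i) = ∑ j, G i j • e' j := fun i => (e'.sum_repr _).symm
  have heq : ∀ i j, ∑ k, algebraMap ℂ OCstar (c * K i k) * G k j
      = delta τ (G i j) + ∑ k, algebraMap ℂ OCstar (c * K' k j) * G i k := by
    intro i j
    have h1 := f.map_nabla (e i)
    rw [he, hG, map_sum, map_sum] at h1
    simp only [map_smul, hG, Y.nabla_smul, he'] at h1
    have h3 := congrArg (fun y => e'.repr y j) h1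
    simp [Finsupp.single_apply] at h3
    rw [Finset.sum_add_distrib] at h3
    simp only [c, map_mul]
    rw [h3, add_comm]
    congr 1
    · simp
    · exact Finset.sum_congr rfl fun k _ => by ring
  have hzero : ∀ k : ℤ, k ≠ 0 → ∀ i j, laurentCoeff (G i j) k = 0 := by
    intro k hk i j
    let μ : ℂ := 2 * Real.pi * Complex.I * k
    have hsyl : K * (Matrix.of fun i j => laurentCoeff (G i j) k)
        = (Matrix.of fun i j => laurentCoeff (G i j) k) * (K' + algebraMap ℂ _ μ) := by
      rw [Matrix.mul_add, Algebra.algebraMap_eq_smul_one, Matrix.mul_smul, Matrix.mul_one]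
      ext i j
      have h1 := congrArg (fun g => laurentCoeff g k) (heq i j)
      simp only [laurentCoeff_sum, laurentCoeff_add, laurentCoeff_delta,
        laurentCoeff_algebraMap_mul, mul_assoc c, ← Finset.mul_sum] at h1
      have h3 : τ = c * (2 * Real.pi * Complex.I) := by simp only [c]; field_simp
      rw [h3, mul_assoc, mul_assoc, ← mul_add] at h1
      have h4 := mul_left_cancel₀ hc h1
      rw [Matrix.add_apply, Matrix.mul_apply, Matrix.mul_apply, Matrix.smul_apply]
      simp only [Matrix.of_apply, smul_eq_mul]
      rw [h4, add_comm]
      congr 1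
      · exact Finset.sum_congr rfl fun k _ => mul_comm _ _
      · simp only [μ]; ring
    -- A common eigenvalue ν would put both ν and ν - 2πik in an open strip of height 2π, so |k| <
    -- 1.
    have hdis : Disjoint (spectrum ℂ K) (spectrum ℂ (K' + algebraMap ℂ _ μ)) := by
      rw [Set.disjoint_left]
      intro ν hν hν'
      have h1 : ν - μ ∈ spectrum ℂ K' := by
        rw [spectrum.mem_iff] at hν' ⊢
        rwa [map_sub, sub_sub, add_comm (algebraMap ℂ _ μ)]
      have h3 := abs_lt.mp (hK ν hν)
      have h4 := abs_lt.mp (hK' _ h1)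
      have h5 : (ν - μ).im = ν.im - 2 * Real.pi * k := by simp [μ]
      rw [h5] at h4
      have hp := Real.pi_pos
      have h6 : |(k : ℝ)| < 1 := by
        rw [abs_lt]
        constructor <;> nlinarith
      have h7 : |k| < 1 := by exact_mod_cast h6
      exact hk (Int.abs_lt_one_iff.mp h7)
    exact congrFun (congrFun (Matrix.eq_zero_of_mul_eq_mul hsyl hdis) i) j
  refine ⟨Matrix.of fun i j => laurentCoeff (G i j) 0, fun i => ?_⟩
  rw [hG]
  refine Finset.sum_congr rfl fun j _ => ?_
  rw [Matrix.of_apply, ← OCstar.eq_algebraMap_of_laurentCoeff fun k hk => hzero k hk i j]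

/-- Bases in which a morphism is a partial identity matrix and the connections are constant. -/
theorem exists_adapted_bases (hτ : τ ≠ 0) {X Y : BqTau.{u} θ τ} (f : X ⟶ Y) :
    ∃ (k r g : ℕ) (b : Module.Basis (Fin k ⊕ Fin r) OCstar X.carrier)
      (b' : Module.Basis (Fin r ⊕ Fin g) OCstar Y.carrier),
      (∀ i, Hom.lin f (b (Sum.inl i)) = 0) ∧
      (∀ i, Hom.lin f (b (Sum.inr i)) = b' (Sum.inl i)) ∧
      (∀ i j, ∃ c, b.repr (X.nabla (b i)) j = algebraMap ℂ OCstar c) ∧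
      ∀ i j, ∃ c, b'.repr (Y.nabla (b' i)) j = algebraMap ℂ OCstar c := by
  obtain ⟨n, Z, hZ, hX⟩ := X.exists_constant_basis hτ
  obtain ⟨m, Z', hZ', hY⟩ := Y.exists_constant_basis hτ
  -- A single φ for both objects places their logarithms in the same strip.
  obtain ⟨φ, hφ⟩ := exists_ray_disjoint (hZ.union hZ')
  obtain ⟨K, hK, e, he⟩ := hX φ fun r hr h => hφ r hr (Or.inl h)
  obtain ⟨K', hK', e', he'⟩ := hY φ fun r hr h => hφ r hr (Or.inr h)
  obtain ⟨F, hF⟩ := exists_constant_matrix hτ f hK hK' e e' he he'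
  obtain ⟨k, r, g, b, b', hb, hb'⟩ := F.vecMulLinear.exists_adapted_bases
  obtain ⟨B, hB, hBs⟩ := exists_basis_constSection e b
  obtain ⟨B', hB', hBs'⟩ := exists_basis_constSection e' b'
  have hf : ∀ v, Hom.lin f (constSection e v) = constSection e' (F.vecMulLinear v) :=
    map_constSection (Hom.lin f).toAddMonoidHom (fun c x => (Hom.lin f).map_smul _ x) hF
  refine ⟨k, r, g, B, B', fun i => ?_, fun i => ?_, fun i j => ?_, fun i j => ?_⟩
  · rw [hB, hf, hb]; simp [constSection]
  · rw [hB, hf, hb', hB']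
  · rw [hB, map_constSection (F := Matrix.of fun i j => τ / (2 * Real.pi * Complex.I) * K i j)
      X.nabla X.nabla_algebraMap_smul he, hBs]
    exact ⟨_, congrFun (B.repr_sum_self _) j⟩
  · rw [hB', map_constSection (F := Matrix.of fun i j => τ / (2 * Real.pi * Complex.I) * K' i j)
      Y.nabla Y.nabla_algebraMap_smul he', hBs']
    exact ⟨_, congrFun (B'.repr_sum_self _) j⟩

end BqTau

/-- The order of c / z is that of 1 / z, namely -1, plus the order of the constant c, which is
nonnegative (and infinite for c = 0). -/
theorem hasLogPole_algebraMap (c : ℂ) : HasLogPole (algebraMap ℂ OCstar c) := by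
  have h : (fun z : ℂ => z⁻¹ * extendZero (algebraMap ℂ OCstar c).1 z)
      =ᶠ[nhdsWithin 0 {0}ᶜ] (id : ℂ → ℂ)⁻¹ * fun _ => c := by
    filter_upwards [self_mem_nhdsWithin] with z hz
    rw [extendZero_of_ne _ hz]
    rfl
  have h1 : MeromorphicAt (id : ℂ → ℂ)⁻¹ 0 := (MeromorphicAt.id 0).inv
  have h2 : AnalyticAt ℂ (fun _ : ℂ => c) 0 := analyticAt_const
  refine ⟨(h1.mul h2.meromorphicAt).congr h.symm, ?_⟩
  rw [meromorphicOrderAt_congr h, meromorphicOrderAt_mul h1 h2.meromorphicAt,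
    meromorphicOrderAt_inv, meromorphicOrderAt_id]
  exact le_add_of_nonneg_right h2.meromorphicOrderAt_nonneg

end NCT

/-! ### Kernels and cokernels of maps in adapted bases. -/

section Module

variable {R M N P : Type*} [Ring R] [AddCommGroup M] [Module R M] [AddCommGroup N] [Module R N]
  [AddCommGroup P] [Module R P]

theorem LinearMap.exists_lift_of_exact {f : M →ₗ[R] N} {g : N →ₗ[R] P}
    (hf : Function.Injective f) (h : Function.Exact f g) {A : Type*} [AddCommGroup A] [Module R A]
    (k : A →ₗ[R] N) (hk : ∀ a, g (k a) = 0) : ∃ l : A →ₗ[R] M, ∀ a, f (l a) = k a := by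
  refine ⟨(LinearEquiv.ofInjective f hf).symm.toLinearMap ∘ₗ
    k.codRestrict (LinearMap.range f) fun a => (h _).mp (hk a), fun a => ?_⟩
  exact congrArg Subtype.val ((LinearEquiv.ofInjective f hf).apply_symm_apply
    ⟨k a, (h _).mp (hk a)⟩)

theorem LinearMap.exists_desc_of_exact {f : M →ₗ[R] N} {g : N →ₗ[R] P}
    (hg : Function.Surjective g) (h : Function.Exact f g) {A : Type*} [AddCommGroup A] [Module R A]
    (k : N →ₗ[R] A) (hk : ∀ m, k (f m) = 0) : ∃ l : P →ₗ[R] A, ∀ n, l (g n) = k n := by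
  have hker : LinearMap.ker g ≤ LinearMap.ker k := fun n hn => by
    obtain ⟨m, rfl⟩ := (h n).mp hn
    exact hk m
  refine ⟨(LinearMap.ker g).liftQ k hker ∘ₗ (g.quotKerEquivOfSurjective hg).symm.toLinearMap,
    fun n => ?_⟩
  have : (g.quotKerEquivOfSurjective hg).symm (g n) = Submodule.Quotient.mk n := by
    rw [LinearEquiv.symm_apply_eq]; rfl
  simp [this]

theorem AddMonoidHom.exists_desc {f : N →+ P} (hf : Function.Surjective f) (T : N →+ P)
    (hT : ∀ n, f n = 0 → T n = 0) : ∃ T' : P →+ P, ∀ n, T' (f n) = T n := by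
  refine ⟨f.liftOfSurjective hf ⟨T, fun n hn => hT n hn⟩, fun n => ?_⟩
  exact f.liftOfRightInverse_comp_apply _ _ ⟨T, fun n hn => hT n hn⟩ n

variable {κ ρ γ : Type*} [Fintype κ] [Fintype ρ]

/-- An element of the kernel has no coordinates along `Sum.inr`, as f sends these basis vectors to
independent ones. The formula for coordinates is what exhibits the restricted connection as a block
of the original matrix. -/
theorem Module.Basis.exists_basis_ker (f : M →ₗ[R] N) (b : Module.Basis (κ ⊕ ρ) R M)
    (b' : Module.Basis (ρ ⊕ γ) R N) (h0 : ∀ i, f (b (Sum.inl i)) = 0)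
    (h1 : ∀ i, f (b (Sum.inr i)) = b' (Sum.inl i)) :
    ∃ B : Module.Basis κ R (LinearMap.ker f), (∀ i, (B i : M) = b (Sum.inl i)) ∧
      ∀ m i, B.repr m i = b.repr m (Sum.inl i) := by
  have hmem : ∀ i, b (Sum.inl i) ∈ LinearMap.ker f := h0
  have hli : LinearIndependent R fun i => (⟨b (Sum.inl i), hmem i⟩ : LinearMap.ker f) :=
    LinearIndependent.of_comp (LinearMap.ker f).subtype
      (b.linearIndependent.comp Sum.inl Sum.inl_injective)
  have hker : ∀ m ∈ LinearMap.ker f, ∀ i, b.repr m (Sum.inr i) = 0 := by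
    intro m hm i
    have hm' : f m = 0 := hm
    rw [← b.sum_repr m, map_sum] at hm'
    simp only [map_smul, Fintype.sum_sum_type, h0, h1, smul_zero, Finset.sum_const_zero,
      zero_add] at hm'
    have := Fintype.linearIndependent_iff.mp
      (b'.linearIndependent.comp Sum.inl Sum.inl_injective) (fun i => b.repr m (Sum.inr i)) hm'
    exact this i
  have hspan : ∀ m : LinearMap.ker f,
      m = ∑ i, b.repr m (Sum.inl i) • (⟨b (Sum.inl i), hmem i⟩ : LinearMap.ker f) := by
    intro m
    ext
    conv_lhs => rw [← b.sum_repr m.1, Fintype.sum_sum_type]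
    simp only [hker m.1 m.2, zero_smul, Finset.sum_const_zero, add_zero]
    simp
  refine ⟨Module.Basis.mk hli fun m _ => ?_, fun i => by simp, fun m i => ?_⟩
  · rw [hspan m]
    exact Submodule.sum_mem _ fun i _ => Submodule.smul_mem _ _ (Submodule.subset_span ⟨i, rfl⟩)
  · have h := Module.Basis.repr_sum_self (Module.Basis.mk hli fun m _ => by
      rw [hspan m]
      exact Submodule.sum_mem _ fun i _ => Submodule.smul_mem _ _ (Submodule.subset_span ⟨i, rfl⟩))
        fun i => b.repr m (Sum.inl i)
    simp only [Module.Basis.mk_apply, ← hspan m] at h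
    exact congrFun h i

/-- The range is spanned by the `Sum.inl` part of the target basis, so the remaining vectors descend
to a basis of the quotient. -/
theorem Module.Basis.exists_basis_coker [Fintype γ] {f : M →ₗ[R] N} (b : Module.Basis (κ ⊕ ρ) R M)
    (b' : Module.Basis (ρ ⊕ γ) R N) (h0 : ∀ i, f (b (Sum.inl i)) = 0)
    (h1 : ∀ i, f (b (Sum.inr i)) = b' (Sum.inl i)) {g : N →ₗ[R] P} (hg : Function.Surjective g)
    (h : Function.Exact f g) :
    ∃ B : Module.Basis γ R P, (∀ i, B i = g (b' (Sum.inr i))) ∧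
      ∀ n i, B.repr (g n) i = b'.repr n (Sum.inr i) := by
  classical
  have hran : ∀ m i, b'.repr (f m) (Sum.inr i) = 0 := by
    intro m i
    rw [← b.sum_repr m, map_sum]
    simp [Fintype.sum_sum_type, h0, h1]
  have hli : LinearIndependent R fun i => g (b' (Sum.inr i)) := by
    rw [Fintype.linearIndependent_iff]
    intro c hc i
    simp only [← map_smul, ← map_sum] at hc
    obtain ⟨m, hm⟩ := (h _).mp hc
    have := hran m i
    rw [hm] at this
    simpa [Finsupp.single_apply] using this
  have hspan : ∀ n, g n = ∑ i, b'.repr n (Sum.inr i) • g (b' (Sum.inr i)) := by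
    intro n
    have : ∀ i, g (b' (Sum.inl i)) = 0 := fun i => by rw [← h1]; exact h.apply_apply_eq_zero _
    conv_lhs => rw [← b'.sum_repr n, Fintype.sum_sum_type, map_add, map_sum, map_sum]
    simp only [map_smul, this, smul_zero, Finset.sum_const_zero, zero_add]
  have htop : ⊤ ≤ Submodule.span R (Set.range fun i => g (b' (Sum.inr i))) := by
    intro p _
    obtain ⟨n, rfl⟩ := hg p
    rw [hspan n]
    exact Submodule.sum_mem _ fun i _ => Submodule.smul_mem _ _ (Submodule.subset_span ⟨i, rfl⟩)
  refine ⟨Module.Basis.mk hli htop, fun i => by simp, fun n i => ?_⟩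
  have h := Module.Basis.repr_sum_self (Module.Basis.mk hli htop) fun i => b'.repr n (Sum.inr i)
  simp only [Module.Basis.mk_apply, ← hspan n] at h
  exact congrFun h i

theorem Module.Basis.finitePresentation {R M ι : Type*} [CommRing R] [AddCommGroup M] [Module R M]
    [Finite ι] (b : Module.Basis ι R M) : Module.FinitePresentation R M := by
  have := Module.Free.of_basis b
  have := Module.Finite.of_basis b
  exact Module.finitePresentation_of_projective R M

end Module

/-! ### Additive structure, kernels and cokernels of B_q^τ. -/

namespace NCT

namespace BqTau

variable {θ : ℝ} {τ : ℂ}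

theorem hom_ext {X Y : BqTau.{u} θ τ} {f g : X ⟶ Y} (h : ∀ m, Hom.lin f m = Hom.lin g m) : f = g :=
  Hom.ext (LinearMap.ext h)

noncomputable instance (X Y : BqTau.{u} θ τ) : Add (X ⟶ Y) where
  add f g := ⟨Hom.lin f + Hom.lin g, fun m => by simp [f.map_sigma, g.map_sigma],
    fun m => by simp [f.map_nabla, g.map_nabla]⟩

noncomputable instance (X Y : BqTau.{u} θ τ) : Zero (X ⟶ Y) where
  zero := ⟨0, fun m => by simp, fun m => by simp⟩

noncomputable instance (X Y : BqTau.{u} θ τ) : Neg (X ⟶ Y) where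
  neg f := ⟨-Hom.lin f, fun m => by simp [f.map_sigma], fun m => by simp [f.map_nabla]⟩

noncomputable instance (X Y : BqTau.{u} θ τ) : AddCommGroup (X ⟶ Y) where
  add_assoc f g h := Hom.ext (add_assoc (Hom.lin f) (Hom.lin g) (Hom.lin h))
  zero_add f := Hom.ext (zero_add (Hom.lin f))
  add_zero f := Hom.ext (add_zero (Hom.lin f))
  add_comm f g := Hom.ext (add_comm (Hom.lin f) (Hom.lin g))
  neg_add_cancel f := Hom.ext (neg_add_cancel (Hom.lin f))
  nsmul := nsmulRec
  zsmul := zsmulRec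

noncomputable instance : Preadditive (BqTau.{u} θ τ) where
  add_comp _ _ _ f f' g := hom_ext fun m => map_add (Hom.lin g) (Hom.lin f m) (Hom.lin f' m)
  comp_add _ _ _ _ _ _ := rfl

/-- The zero object. -/
noncomputable def zeroObj (θ : ℝ) (τ : ℂ) : BqTau.{u} θ τ where
  carrier := PUnit
  finitePresentation := (Module.Basis.empty (R := OCstar) (ι := Fin 0) PUnit.{u + 1}).finitePresentation
  sigma := AddEquiv.refl _
  sigma_smul _ _ := rfl
  nabla := 0
  nabla_smul _ _ := rfl
  nabla_sigma _ := rfl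
  regularSingular := ⟨0, Module.Basis.empty _, fun i => i.elim0⟩

instance : HasZeroObject (BqTau.{u} θ τ) :=
  ⟨zeroObj θ τ, (IsZero.iff_id_eq_zero _).mpr (hom_ext fun _ => rfl)⟩

/-- The direct sum of two objects. -/
noncomputable def prodObj (X Y : BqTau.{u} θ τ) : BqTau.{u} θ τ where
  carrier := X.carrier × Y.carrier
  finitePresentation := by
    obtain ⟨n, e, _⟩ := X.regularSingular
    obtain ⟨m, e', _⟩ := Y.regularSingular
    exact (e.prod e').finitePresentation
  sigma := X.sigma.prodCongr Y.sigma
  sigma_smul f m := Prod.ext (X.sigma_smul f m.1) (Y.sigma_smul f m.2)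
  nabla := X.nabla.prodMap Y.nabla
  nabla_smul f m := Prod.ext (X.nabla_smul f m.1) (Y.nabla_smul f m.2)
  nabla_sigma m := Prod.ext (X.nabla_sigma m.1) (Y.nabla_sigma m.2)
  regularSingular := by
    obtain ⟨n, e, he⟩ := X.regularSingular
    obtain ⟨m, e', he'⟩ := Y.regularSingular
    have h0 : HasLogPole 0 := by simpa using hasLogPole_algebraMap 0
    refine ⟨n + m, (e.prod e').reindex finSumFinEquiv, fun i j => ?_⟩
    obtain ⟨i, rfl⟩ := finSumFinEquiv.surjective i
    obtain ⟨j, rfl⟩ := finSumFinEquiv.surjective j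
    rw [Module.Basis.repr_reindex_apply, Module.Basis.reindex_apply]
    simp only [Equiv.symm_apply_apply]
    rcases i with i | i <;> rcases j with j | j
    · simpa using he i j
    · simpa using h0
    · simpa using h0
    · simpa using he' i j

/-- The direct sum as a bicone. -/
noncomputable def prodBicone (X Y : BqTau.{u} θ τ) : BinaryBicone X Y where
  pt := prodObj X Y
  fst := ⟨LinearMap.fst OCstar X.carrier Y.carrier, fun _ => rfl, fun _ => rfl⟩
  snd := ⟨LinearMap.snd OCstar X.carrier Y.carrier, fun _ => rfl, fun _ => rfl⟩
  inl := ⟨LinearMap.inl OCstar X.carrier Y.carrier,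
    fun _ => Prod.ext rfl (map_zero Y.sigma).symm, fun _ => Prod.ext rfl (map_zero Y.nabla).symm⟩
  inr := ⟨LinearMap.inr OCstar X.carrier Y.carrier,
    fun _ => Prod.ext (map_zero X.sigma).symm rfl, fun _ => Prod.ext (map_zero X.nabla).symm rfl⟩
  inl_fst := rfl
  inl_snd := rfl
  inr_fst := rfl
  inr_snd := rfl

instance : HasBinaryBiproducts (BqTau.{u} θ τ) :=
  ⟨fun X Y => hasBinaryBiproduct_of_total (prodBicone X Y) (hom_ext fun m => by
    change ((m.1, 0) + (0, m.2) : X.carrier × Y.carrier) = m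
    exact Prod.ext (add_zero m.1) (zero_add m.2))⟩

instance : HasFiniteProducts (BqTau.{u} θ τ) := hasFiniteProducts_of_has_binary_and_terminal

instance : HasFiniteCoproducts (BqTau.{u} θ τ) := hasFiniteCoproducts_of_has_binary_and_initial

/-- The module kernel is stable under σ, σ⁻¹ and ∇ by equivariance. In an adapted basis its
connection matrix is a block of a constant matrix, hence regular singular. -/
theorem exists_kernel (hτ : τ ≠ 0) {X Y : BqTau.{u} θ τ} (f : X ⟶ Y) :
    ∃ (K : BqTau.{u} θ τ) (i : K ⟶ X), Function.Injective (Hom.lin i) ∧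
      Function.Exact (Hom.lin i) (Hom.lin f) := by
  obtain ⟨k, r, g, b, b', h0, h1, hb, -⟩ := exists_adapted_bases hτ f
  obtain ⟨B, hB, hBr⟩ := b.exists_basis_ker (Hom.lin f) b' h0 h1
  have hs : ∀ m ∈ LinearMap.ker (Hom.lin f), X.sigma m ∈ LinearMap.ker (Hom.lin f) :=
    fun m hm => by
      have hm' : Hom.lin f m = 0 := hm
      change Hom.lin f (X.sigma m) = 0
      rw [f.map_sigma, hm', map_zero]
  have hs' : ∀ m ∈ LinearMap.ker (Hom.lin f), X.sigma.symm m ∈ LinearMap.ker (Hom.lin f) :=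
    fun m hm => by
      have hm' : Hom.lin f m = 0 := hm
      refine Y.sigma.injective ?_
      rw [← f.map_sigma, X.sigma.apply_symm_apply, hm', map_zero]
  have hn : ∀ m ∈ LinearMap.ker (Hom.lin f), X.nabla m ∈ LinearMap.ker (Hom.lin f) :=
    fun m hm => by
      have hm' : Hom.lin f m = 0 := hm
      change Hom.lin f (X.nabla m) = 0
      rw [f.map_nabla, hm', map_zero]
  refine ⟨{
    carrier := LinearMap.ker (Hom.lin f)
    finitePresentation := B.finitePresentation
    sigma :=
      { toFun := fun m => ⟨X.sigma m, hs m m.2⟩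
        invFun := fun m => ⟨X.sigma.symm m, hs' m m.2⟩
        left_inv := fun m => Subtype.ext (X.sigma.symm_apply_apply m)
        right_inv := fun m => Subtype.ext (X.sigma.apply_symm_apply m)
        map_add' := fun m m' => Subtype.ext (map_add X.sigma m.1 m'.1) }
    sigma_smul := fun a m => Subtype.ext (X.sigma_smul a m)
    nabla :=
      { toFun := fun m => ⟨X.nabla m, hn m m.2⟩
        map_zero' := Subtype.ext (map_zero X.nabla)
        map_add' := fun m m' => Subtype.ext (map_add X.nabla m.1 m'.1) }
    nabla_smul := fun a m => Subtype.ext (X.nabla_smul a m)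
    nabla_sigma := fun m => Subtype.ext (X.nabla_sigma m)
    regularSingular := ⟨k, B, fun i j => ?_⟩ },
    ⟨(LinearMap.ker (Hom.lin f)).subtype, fun _ => rfl, fun _ => rfl⟩,
    Subtype.val_injective, fun m => ?_⟩
  · rw [hBr]
    obtain ⟨c, hc⟩ := hb (Sum.inl i) (Sum.inl j)
    change HasLogPole (b.repr (X.nabla (B i : X.carrier)) (Sum.inl j))
    rw [hB, hc]
    exact hasLogPole_algebraMap c
  · exact ⟨fun hm => ⟨⟨m, hm⟩, rfl⟩, by rintro ⟨m', rfl⟩; exact m'.2⟩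

/-- σ, σ⁻¹ and ∇ preserve the range, so they descend to the quotient. The adapted basis again gives
a block of a constant connection matrix. -/
theorem exists_cokernel (hτ : τ ≠ 0) {X Y : BqTau.{u} θ τ} (f : X ⟶ Y) :
    ∃ (Q : BqTau.{u} θ τ) (p : Y ⟶ Q), Function.Surjective (Hom.lin p) ∧
      Function.Exact (Hom.lin f) (Hom.lin p) := by
  obtain ⟨k, r, g, b, b', h0, h1, -, hb'⟩ := exists_adapted_bases hτ f
  let p := (LinearMap.range (Hom.lin f)).mkQ
  have hp : Function.Surjective p := Submodule.mkQ_surjective _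
  have hex : Function.Exact (Hom.lin f) p := LinearMap.exact_map_mkQ_range _
  obtain ⟨B, hB, hBr⟩ := b.exists_basis_coker b' h0 h1 hp hex
  have hdesc : ∀ T : Y.carrier →+ Y.carrier, (∀ m, ∃ m', T (Hom.lin f m) = Hom.lin f m') →
      ∃ T' : (Y.carrier ⧸ LinearMap.range (Hom.lin f)) →+ (Y.carrier ⧸ LinearMap.range (Hom.lin f)),
        ∀ y, T' (p y) = p (T y) := fun T hT => by
    refine AddMonoidHom.exists_desc (f := p.toAddMonoidHom) hp (p.toAddMonoidHom.comp T)
      fun y hy => ?_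
    obtain ⟨m, rfl⟩ := (hex y).mp hy
    obtain ⟨m', hm'⟩ := hT m
    change p (T (Hom.lin f m)) = 0
    rw [hm']
    exact hex.apply_apply_eq_zero m'
  obtain ⟨s, hs⟩ := hdesc Y.sigma.toAddMonoidHom fun m => ⟨X.sigma m, (f.map_sigma m).symm⟩
  obtain ⟨s', hs'⟩ := hdesc Y.sigma.symm.toAddMonoidHom fun m => ⟨X.sigma.symm m, by
    refine Y.sigma.injective ?_
    rw [← f.map_sigma, X.sigma.apply_symm_apply]
    exact Y.sigma.apply_symm_apply _⟩
  obtain ⟨d, hd⟩ := hdesc Y.nabla fun m => ⟨X.nabla m, (f.map_nabla m).symm⟩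
  replace hs : ∀ y, s (p y) = p (Y.sigma y) := hs
  replace hs' : ∀ y, s' (p y) = p (Y.sigma.symm y) := hs'
  refine ⟨{
    carrier := Y.carrier ⧸ LinearMap.range (Hom.lin f)
    finitePresentation := B.finitePresentation
    sigma :=
      { s with
        invFun := s'
        left_inv := fun x => by
          obtain ⟨y, rfl⟩ := hp x
          change s' (s (p y)) = p y
          rw [hs, hs', AddEquiv.symm_apply_apply]
        right_inv := fun x => by
          obtain ⟨y, rfl⟩ := hp x
          change s (s' (p y)) = p y
          rw [hs', hs, AddEquiv.apply_symm_apply] }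
    sigma_smul := fun a x => by
      obtain ⟨y, rfl⟩ := hp x
      change s (a • p y) = alpha θ a • s (p y)
      rw [← map_smul, hs, hs, Y.sigma_smul, map_smul]
    nabla := d
    nabla_smul := fun a x => by
      obtain ⟨y, rfl⟩ := hp x
      rw [← map_smul, hd, hd, Y.nabla_smul, map_add, map_smul, map_smul]
    nabla_sigma := fun x => by
      obtain ⟨y, rfl⟩ := hp x
      change d (s (p y)) = s (d (p y))
      rw [hs, hd, hd, hs, Y.nabla_sigma]
    regularSingular := ⟨g, B, fun i j => ?_⟩ },
    ⟨p, fun y => (hs y).symm, fun y => (hd y).symm⟩, hp, hex⟩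
  rw [hB, hd, hBr]
  obtain ⟨c, hc⟩ := hb' (Sum.inr i) (Sum.inr j)
  rw [hc]
  exact hasLogPole_algebraMap c

/-- An injective map onto the kernel of the underlying module map is a kernel. -/
theorem nonempty_isLimit_of_exact {K X Y : BqTau.{u} θ τ} {i : K ⟶ X} {f : X ⟶ Y}
    (hi : Function.Injective (Hom.lin i)) (h : Function.Exact (Hom.lin i) (Hom.lin f))
    (w : i ≫ f = 0) : Nonempty (IsLimit (KernelFork.ofι i w)) := by
  have key : ∀ {W : BqTau.{u} θ τ} (k : W ⟶ X), k ≫ f = 0 → ∃ l : W ⟶ K, l ≫ i = k := by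
    intro W k hk
    obtain ⟨l, hl⟩ := LinearMap.exists_lift_of_exact hi h (Hom.lin k)
      fun a => LinearMap.congr_fun (congrArg Hom.lin hk) a
    -- Compatibility of the lift with σ and ∇ may be tested after the injective map i, where it
    -- holds for k.
    exact ⟨⟨l, fun m => hi (by rw [hl, k.map_sigma, i.map_sigma, hl]),
      fun m => hi (by rw [hl, k.map_nabla, i.map_nabla, hl])⟩, hom_ext hl⟩
  choose l hl using @key
  refine ⟨KernelFork.IsLimit.ofι i w (fun k hk => l k hk) (fun k hk => hl k hk)
    fun k hk m hm => hom_ext fun a => hi ?_⟩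
  have := hm.trans (hl k hk).symm
  exact LinearMap.congr_fun (congrArg Hom.lin this) a

theorem nonempty_isColimit_of_exact {X Y Q : BqTau.{u} θ τ} {f : X ⟶ Y} {p : Y ⟶ Q}
    (hp : Function.Surjective (Hom.lin p)) (h : Function.Exact (Hom.lin f) (Hom.lin p))
    (w : f ≫ p = 0) : Nonempty (IsColimit (CokernelCofork.ofπ p w)) := by
  have key : ∀ {W : BqTau.{u} θ τ} (k : Y ⟶ W), f ≫ k = 0 → ∃ l : Q ⟶ W, p ≫ l = k := by
    intro W k hk
    obtain ⟨l, hl⟩ := LinearMap.exists_desc_of_exact hp h (Hom.lin k)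
      fun a => LinearMap.congr_fun (congrArg Hom.lin hk) a
    refine ⟨⟨l, fun m => ?_, fun m => ?_⟩, hom_ext hl⟩
    · obtain ⟨y, rfl⟩ := hp m
      rw [← p.map_sigma, hl, hl, k.map_sigma]
    · obtain ⟨y, rfl⟩ := hp m
      rw [← p.map_nabla, hl, hl, k.map_nabla]
  choose l hl using @key
  refine ⟨CokernelCofork.IsColimit.ofπ p w (fun k hk => l k hk) (fun k hk => hl k hk)
    fun k hk m hm => hom_ext fun a => ?_⟩
  obtain ⟨y, rfl⟩ := hp a
  exact LinearMap.congr_fun (congrArg Hom.lin (hm.trans (hl k hk).symm)) y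

theorem comp_eq_zero_of_exact {X Y Z : BqTau.{u} θ τ} {f : X ⟶ Y} {g : Y ⟶ Z}
    (h : Function.Exact (Hom.lin f) (Hom.lin g)) : f ≫ g = 0 :=
  hom_ext fun m => h.apply_apply_eq_zero m

theorem hasEqualizers (hτ : τ ≠ 0) : HasEqualizers (BqTau.{u} θ τ) := by
  have : HasKernels (BqTau.{u} θ τ) := ⟨fun {X Y} f => by
    obtain ⟨K, i, hi, h⟩ := exists_kernel hτ f
    obtain ⟨hl⟩ := nonempty_isLimit_of_exact hi h (comp_eq_zero_of_exact h)
    exact ⟨⟨_, hl⟩⟩⟩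
  exact Preadditive.hasEqualizers_of_hasKernels

theorem hasCoequalizers (hτ : τ ≠ 0) : HasCoequalizers (BqTau.{u} θ τ) := by
  have : HasCokernels (BqTau.{u} θ τ) := ⟨fun {X Y} f => by
    obtain ⟨Q, p, hp, h⟩ := exists_cokernel hτ f
    obtain ⟨hl⟩ := nonempty_isColimit_of_exact hp h (comp_eq_zero_of_exact h)
    exact ⟨⟨_, hl⟩⟩⟩
  exact Preadditive.hasCoequalizers_of_hasCokernels

end BqTau

/-! ### Additive structure and exact sequences of holomorphic bundles. -/

namespace HolBundle

variable {θ : ℝ} {τ : ℂ}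

theorem hom_ext {E F : HolBundle.{u} θ τ} {f g : E ⟶ F} (h : ∀ m, Hom.lin f m = Hom.lin g m) :
    f = g :=
  Hom.ext (LinearMap.ext h)

noncomputable instance (E F : HolBundle.{u} θ τ) : Add (E ⟶ F) where
  add f g := ⟨Hom.lin f + Hom.lin g, fun m => by simp [f.map_nabla, g.map_nabla]⟩

noncomputable instance (E F : HolBundle.{u} θ τ) : Zero (E ⟶ F) where
  zero := ⟨0, fun m => by simp⟩

noncomputable instance (E F : HolBundle.{u} θ τ) : Neg (E ⟶ F) where
  neg f := ⟨-Hom.lin f, fun m => by simp [f.map_nabla]⟩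

noncomputable instance (E F : HolBundle.{u} θ τ) : AddCommGroup (E ⟶ F) where
  add_assoc f g h := Hom.ext (add_assoc (Hom.lin f) (Hom.lin g) (Hom.lin h))
  zero_add f := Hom.ext (zero_add (Hom.lin f))
  add_zero f := Hom.ext (add_zero (Hom.lin f))
  add_comm f g := Hom.ext (add_comm (Hom.lin f) (Hom.lin g))
  neg_add_cancel f := Hom.ext (neg_add_cancel (Hom.lin f))
  nsmul := nsmulRec
  zsmul := zsmulRec

noncomputable instance : Preadditive (HolBundle.{u} θ τ) where
  add_comp _ _ _ f f' g := hom_ext fun m => map_add (Hom.lin g) (Hom.lin f m) (Hom.lin f' m)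
  comp_add _ _ _ _ _ _ := rfl

/-- The zero bundle. -/
noncomputable def zeroObj (θ : ℝ) (τ : ℂ) : HolBundle.{u} θ τ where
  carrier := PUnit
  finite := inferInstance
  projective := inferInstance
  nabla := 0
  leibniz _ _ := rfl

instance : HasZeroObject (HolBundle.{u} θ τ) :=
  ⟨zeroObj θ τ, (IsZero.iff_id_eq_zero _).mpr (hom_ext fun _ => rfl)⟩

/-- This will be applied to images under ψ_* of kernel sequences, so that existence of kernels of
arbitrary bundle maps is not needed. -/
theorem nonempty_isLimit_of_exact {K X Y : HolBundle.{u} θ τ} {i : K ⟶ X} {f : X ⟶ Y}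
    (hi : Function.Injective (Hom.lin i)) (h : Function.Exact (Hom.lin i) (Hom.lin f))
    (w : i ≫ f = 0) : Nonempty (IsLimit (KernelFork.ofι i w)) := by
  have key : ∀ {W : HolBundle.{u} θ τ} (k : W ⟶ X), k ≫ f = 0 → ∃ l : W ⟶ K, l ≫ i = k := by
    intro W k hk
    obtain ⟨l, hl⟩ := LinearMap.exists_lift_of_exact hi h (Hom.lin k)
      fun a => LinearMap.congr_fun (congrArg Hom.lin hk) a
    exact ⟨⟨l, fun m => hi (by rw [hl, k.map_nabla, i.map_nabla, hl])⟩, hom_ext hl⟩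
  choose l hl using @key
  refine ⟨KernelFork.IsLimit.ofι i w (fun k hk => l k hk) (fun k hk => hl k hk)
    fun k hk m hm => hom_ext fun a => hi ?_⟩
  have := hm.trans (hl k hk).symm
  exact LinearMap.congr_fun (congrArg Hom.lin this) a

theorem nonempty_isColimit_of_exact {X Y Q : HolBundle.{u} θ τ} {f : X ⟶ Y} {p : Y ⟶ Q}
    (hp : Function.Surjective (Hom.lin p)) (h : Function.Exact (Hom.lin f) (Hom.lin p))
    (w : f ≫ p = 0) : Nonempty (IsColimit (CokernelCofork.ofπ p w)) := by
  have key : ∀ {W : HolBundle.{u} θ τ} (k : Y ⟶ W), f ≫ k = 0 → ∃ l : Q ⟶ W, p ≫ l = k := by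
    intro W k hk
    obtain ⟨l, hl⟩ := LinearMap.exists_desc_of_exact hp h (Hom.lin k)
      fun a => LinearMap.congr_fun (congrArg Hom.lin hk) a
    refine ⟨⟨l, fun m => ?_⟩, hom_ext hl⟩
    obtain ⟨y, rfl⟩ := hp m
    rw [← p.map_nabla, hl, hl, k.map_nabla]
  choose l hl using @key
  refine ⟨CokernelCofork.IsColimit.ofπ p w (fun k hk => l k hk) (fun k hk => hl k hk)
    fun k hk m hm => hom_ext fun a => ?_⟩
  obtain ⟨y, rfl⟩ := hp a
  exact LinearMap.congr_fun (congrArg Hom.lin (hm.trans (hl k hk).symm)) y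

end HolBundle

/-! ### Exactness and faithfulness of ψ_*. -/

section PsiStar

variable (θ : ℝ) (τ : ℂ)

theorem psiStar_map_exact {X Y Z : BqTau.{u} θ τ} (f : X ⟶ Y) (g : Y ⟶ Z)
    (h : Function.Exact (BqTau.Hom.lin f) (BqTau.Hom.lin g)) :
    Function.Exact (HolBundle.Hom.lin ((psiStar θ τ).map f))
      (HolBundle.Hom.lin ((psiStar θ τ).map g)) := by
  have := flat_left θ
  exact Module.Flat.lTensor_exact (NCTorus θ) h

theorem psiStar_map_injective {X Y : BqTau.{u} θ τ} (f : X ⟶ Y)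
    (h : Function.Injective (BqTau.Hom.lin f)) :
    Function.Injective (HolBundle.Hom.lin ((psiStar θ τ).map f)) := by
  have := flat_left θ
  exact Module.Flat.lTensor_preserves_injective_linearMap _ h

theorem psiStar_map_surjective {X Y : BqTau.{u} θ τ} (f : X ⟶ Y)
    (h : Function.Surjective (BqTau.Hom.lin f)) :
    Function.Surjective (HolBundle.Hom.lin ((psiStar θ τ).map f)) :=
  LinearMap.lTensor_surjective (NCTorus θ) h

instance : (psiStar.{u} θ τ).PreservesZeroMorphisms :=
  ⟨fun X Y => HolBundle.hom_ext fun m => by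
    change LinearMap.lTensor (NCTorus θ) (0 : X.carrier →ₗ[OCstar] Y.carrier) m = 0
    rw [LinearMap.lTensor_zero]; rfl⟩

/-- In these preadditive categories it is enough to preserve kernels. The module kernel is a kernel
in B_q^τ, flatness keeps its sequence exact, and an exact sequence with injective first map is a
kernel among bundles. -/
theorem psiStar_preservesFiniteLimits (hτ : τ ≠ 0) : PreservesFiniteLimits (psiStar.{u} θ τ) := by
  have := BqTau.hasEqualizers.{u} (θ := θ) hτ
  have : ∀ {X Y : BqTau.{u} θ τ} (f : X ⟶ Y),
      PreservesLimit (parallelPair f 0) (psiStar.{u} θ τ) := fun f => by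
    obtain ⟨K, i, hi, h⟩ := BqTau.exists_kernel hτ f
    have w := BqTau.comp_eq_zero_of_exact h
    obtain ⟨hl⟩ := BqTau.nonempty_isLimit_of_exact hi h w
    obtain ⟨hl'⟩ := HolBundle.nonempty_isLimit_of_exact (psiStar_map_injective θ τ i hi)
      (psiStar_map_exact θ τ i f h) (by rw [← Functor.map_comp, w, Functor.map_zero])
    exact preservesLimit_of_preserves_limit_cone hl ((isLimitMapConeForkEquiv' _ w).symm hl')
  exact Functor.preservesFiniteLimits_of_preservesKernels _

theorem psiStar_preservesFiniteColimits (hτ : τ ≠ 0) :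
    PreservesFiniteColimits (psiStar.{u} θ τ) := by
  have := BqTau.hasCoequalizers.{u} (θ := θ) hτ
  have : ∀ {X Y : BqTau.{u} θ τ} (f : X ⟶ Y),
      PreservesColimit (parallelPair f 0) (psiStar.{u} θ τ) := fun f => by
    obtain ⟨Q, p, hp, h⟩ := BqTau.exists_cokernel hτ f
    have w := BqTau.comp_eq_zero_of_exact h
    obtain ⟨hl⟩ := BqTau.nonempty_isColimit_of_exact hp h w
    obtain ⟨hl'⟩ := HolBundle.nonempty_isColimit_of_exact (psiStar_map_surjective θ τ p hp)
      (psiStar_map_exact θ τ f p h) (by rw [← Functor.map_comp, w, Functor.map_zero])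
    exact preservesColimit_of_preserves_colimit_cocone hl
      ((isColimitMapCoconeCoforkEquiv' _ w).symm hl')
  exact Functor.preservesFiniteColimits_of_preservesCokernels _

/-- In coordinates the map applies ψ to each coefficient, and ψ is injective. -/
theorem one_tmul_injective {M : Type u} [AddCommGroup M] [Module OCstar M] {n : ℕ}
    (e : Module.Basis (Fin n) OCstar M) :
    Function.Injective fun m : M => (1 ⊗ₜ[OCstar] m : BaseChange θ M) := by
  intro m m' h
  refine e.ext_elem fun i => psi_injective θ ?_
  have hE : ∀ m, baseChangeFree θ e (1 ⊗ₜ[OCstar] m) i = psi θ (e.repr m i) := fun m => by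
    simp [baseChangeFree, psi_smul_def]
  rw [← hE, ← hE]
  exact congrFun (congrArg (baseChangeFree θ e) h) i

theorem psiStar_faithful : (psiStar.{u} θ τ).Faithful where
  map_injective {X Y f g} h := BqTau.hom_ext fun m => by
    obtain ⟨n, e, -⟩ := Y.regularSingular
    exact one_tmul_injective θ e
      (LinearMap.congr_fun (congrArg HolBundle.Hom.lin h) (1 ⊗ₜ[OCstar] m))

end PsiStar

end NCT

theorem proposition9 (θ : ℝ) (hθ : Irrational θ) (τ : ℂ) (hτ : τ.im < 0) :
    -- `A_θ` is flat over `O(ℂ*)` via `ψ` (for left and for right multiplication)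
    Module.Flat NCT.OCstar (NCT.NCTorus θ) ∧
    @Module.Flat NCT.OCstar (NCT.NCTorus θ) _ _ (NCT.psiRightModule θ) ∧
    -- `ψ_*` sends exact sequences of modules to exact sequences of modules
    (∀ {X Y Z : NCT.BqTau.{u} θ τ} (f : X ⟶ Y) (g : Y ⟶ Z),
      Function.Exact (NCT.BqTau.Hom.lin f) (NCT.BqTau.Hom.lin g) →
      Function.Exact (NCT.HolBundle.Hom.lin ((NCT.psiStar θ τ).map f))
        (NCT.HolBundle.Hom.lin ((NCT.psiStar θ τ).map g))) ∧
    (∀ {X Y : NCT.BqTau.{u} θ τ} (f : X ⟶ Y),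
      Function.Injective (NCT.BqTau.Hom.lin f) →
      Function.Injective (NCT.HolBundle.Hom.lin ((NCT.psiStar θ τ).map f))) ∧
    (∀ {X Y : NCT.BqTau.{u} θ τ} (f : X ⟶ Y),
      Function.Surjective (NCT.BqTau.Hom.lin f) →
      Function.Surjective (NCT.HolBundle.Hom.lin ((NCT.psiStar θ τ).map f))) ∧
    -- `ψ_*` is exact as a functor
    PreservesFiniteLimits (NCT.psiStar.{u} θ τ) ∧
    PreservesFiniteColimits (NCT.psiStar.{u} θ τ) ∧
    -- `ψ_*` is faithful
    (NCT.psiStar.{u} θ τ).Faithful := by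
  have hτ0 : τ ≠ 0 := by
    rintro rfl
    simp at hτ
  exact ⟨NCT.flat_left θ, NCT.flat_right θ, fun f g h => NCT.psiStar_map_exact θ τ f g h,
    fun f h => NCT.psiStar_map_injective θ τ f h, fun f h => NCT.psiStar_map_surjective θ τ f h,
    NCT.psiStar_preservesFiniteLimits θ τ hτ0, NCT.psiStar_preservesFiniteColimits θ τ hτ0,
    NCT.psiStar_faithful θ τ⟩
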